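/- Let $\mu_\sigma,\mu_\varepsilon$ be two non-zero positive Radon measures on $[0,1]$ such that (T) $\mu_\varepsilon\times\mu_\sigma-\mu_\sigma\times\mu_\varepsilon$ is a non-negative measure on the triangle $\Delta=\{(\alpha,\beta)\in[0,1]^2:\alpha>\beta\}$, and which form a proper fractional model: the support of $\mu_\sigma$ or of $\mu_\varepsilon$ intersects the open interval $(0,1)$. For $s=re^{i\theta}$ with $r>0$, $\theta\in[-\pi,\pi]$ (the two sides $\theta=\pm\pi$ of the cut $(-\infty,0]$ being distinguished) put $$\Phi_\sigma(s)=\int_{[0,1]}r^\alpha e^{i\alpha\theta}\,d\mu_\sigma(\alpha),\qquad \Phi_\varepsilon(s)=\int_{[0,1]}r^\alpha e^{i\alpha\theta}\,d\mu_\varepsilon(\alpha),\qquad \Psi(s)=\sqrt{\Phi_\sigma(s)/\Phi_\varepsilon(s)}.$$ Then $\Phi_\varepsilon(s)\neq0$ and $\Phi_\sigma(s)/\Phi_\varepsilon(s)\notin(-\infty,0]$ for all such $s$, so that $\Psi$ is well defined with the principal square root, and the following holds. 1. There is exactly one tempered distribution $S\in\mathcal S'(\mathbb R^2)$ in the variables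 $(x,t)$ that vanishes on $\mathbb R\times(-\infty,0)$ and whose Laplace transform in $t$ is $$\tilde S(x,s)=\frac{\Psi(s)}{2s}\exp\bigl(-|x|\,s\,\Psi(s)\bigr),\qquad \operatorname{Re}s>0;$$ that is, for every $a>0$ the partial Fourier transform in $t$ of $e^{-at}S$ (with kernel $e^{-iyt}$) is the function $(x,y)\mapsto\tilde S(x,a+iy)$. This $S$ is called the fundamental solution. 2. There is a number $\tau\ge0$ such that, with $k=\sqrt\tau$, $\Phi_\sigma(re^{i\theta})/\Phi_\varepsilon(re^{i\theta})\to\tau$ and $\Psi(re^{i\theta})\to k$ as $r\to\infty$, uniformly for $\theta\in[-\pi,\pi]$. The support of $S$ is contained in the cone $k|x|\le t$, i.e. $|x|\le ct$ with $c=1/k$ (for $k=0$ this is the half plane $t\ge0$). 3. For all $(x,t)$ with $k|x|<t$ (i.e. $|x|<ct$) the integral $$K(x,t)=\frac1{4\pi i}\int_0^\infty\Bigl(\Psi(qe^{-i\pi})e^{|x|q\Psi(qe^{-i\pi})}-\Psi(qe^{i\pi})e^{|x|q\Psi(qe^{i\pi})}\Bigr)e^{-qt}\,dq$$ converges absolutely;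 $K$ is locally integrable on the open set $\{k|x|<t\}$, and on this set the distribution $\partial_tS$ equals the function $K$. -/

import Mathlib

open MeasureTheory Set Filter
open scoped SchwartzMap LineDeriv

noncomputable section

namespace DistributedOrderWave

/-- The transform `Φ(s) = ∫_{[0,1]} s^α dμ(α)` at the point `s = r e^{iθ}` of the Riemann surface of
the logarithm, so that `s^α = r^α e^{iαθ}`. The values `θ = π` and `θ = -π` are the two sides of the
branch cut `(-∞, 0]`. -/
def Phi (μ : Measure unitInterval) (r θ : ℝ) : ℂ :=
  ∫ α : unitInterval, ((r ^ (α : ℝ) : ℝ) : ℂ) * Complex.exp (Complex.I * (α : ℝ) * θ) ∂μ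

/-- The quotient `Φ_σ(s) / Φ_ε(s)` at `s = r e^{iθ}`. -/
def ratio (μσ με : Measure unitInterval) (r θ : ℝ) : ℂ :=
  Phi μσ r θ / Phi με r θ

/-- `Ψ(s) = √(Φ_σ(s) / Φ_ε(s))` at `s = r e^{iθ}`, with the principal square root. -/
def Psi (μσ με : Measure unitInterval) (r θ : ℝ) : ℂ :=
  ratio μσ με r θ ^ (1 / 2 : ℂ)

/-- The triangle `Δ = {(α, β) ∈ [0,1]² : α > β}`. -/
def triangle : Set (unitInterval × unitInterval) := {p | p.2 < p.1}

/-- The thermodynamical restriction (T): `μ_ε × μ_σ - μ_σ × μ_ε` is a non-negative measure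
on the triangle `Δ`. -/
def Thermodynamical (μσ με : Measure unitInterval) : Prop :=
  ∀ A : Set (unitInterval × unitInterval), MeasurableSet A → A ⊆ triangle →
    (μσ.prod με) A ≤ (με.prod μσ) A

/-- Proper fractional models: the support of `μ_σ` or of `μ_ε` intersects the open
interval `(0,1)`. -/
def ProperFractional (μσ με : Measure unitInterval) : Prop :=
  (μσ.support ∩ Ioo 0 1).Nonempty ∨ (με.support ∩ Ioo 0 1).Nonempty

/-- `S̃(x, s) = Ψ(s) / (2 s) * exp(-|x| s Ψ(s))`, for `Re s > 0`. -/
def STilde (μσ με : Measure unitInterval) (x : ℝ) (s : ℂ) : ℂ :=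
  Psi μσ με ‖s‖ s.arg / (2 * s) * Complex.exp (-(|x| : ℝ) * s * Psi μσ με ‖s‖ s.arg)

/-- `S` is the inverse Laplace transform in `t` of `S̃(x, s)`: it is a tempered distribution in
`(x, t)` that vanishes for `t < 0`, and for every `a > 0` the partial Fourier transform in `t`
of `e^{-at} S`, tested against Schwartz functions `η(x, y)`, is the function `S̃(x, a + iy)`. As
`S` vanishes for `t < 0`, the pairing of `e^{-at} S` with the partial Fourier transform of `η` is
`S ζ` for any Schwartz function `ζ` which equals `e^{-at} ∫ η(x, y) e^{-iyt} dy` on a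
neighbourhood `t > -δ` of the half plane `t ≥ 0`. -/
structure IsFundamentalSolution (μσ με : Measure unitInterval) (S : 𝓢'(ℝ × ℝ, ℂ)) : Prop where
  vanishing : Distribution.IsVanishingOn S {p : ℝ × ℝ | p.2 < 0}
  laplace : ∀ a : ℝ, 0 < a → ∀ (δ : ℝ), 0 < δ → ∀ η ζ : 𝓢(ℝ × ℝ, ℂ),
    (∀ x t : ℝ, -δ < t → ζ (x, t) =
      Complex.exp (-a * t) * ∫ y : ℝ, η (x, y) * Complex.exp (-Complex.I * y * t)) →
    S ζ = ∫ p : ℝ × ℝ, STilde μσ με p.1 (a + Complex.I * p.2) * η p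

/-- The integrand `(Ψ(qe^{-iπ}) e^{|x|qΨ(qe^{-iπ})} - Ψ(qe^{iπ}) e^{|x|qΨ(qe^{iπ})}) e^{-qt}`
of the integral along the branch cut. -/
def cutIntegrand (μσ με : Measure unitInterval) (x t q : ℝ) : ℂ :=
  (Psi μσ με q (-Real.pi) * Complex.exp ((|x| : ℝ) * q * Psi μσ με q (-Real.pi))
    - Psi μσ με q Real.pi * Complex.exp ((|x| : ℝ) * q * Psi μσ με q Real.pi))
    * Complex.exp (-q * t)

/-- The function `(1 / 4πi) ∫_0^∞ (…) dq` that represents `K = ∂_t S` inside the cone. -/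
def KCone (μσ με : Measure unitInterval) (p : ℝ × ℝ) : ℂ :=
  1 / (4 * Real.pi * Complex.I) * ∫ q in Ioi (0 : ℝ), cutIntegrand μσ με p.1 p.2 q

/-- The cone `|x| ≤ c t` with `c = 1 / k`; for `k = 0` (that is, `c = ∞`) it is `t ≥ 0`. -/
def cone (k : ℝ) : Set (ℝ × ℝ) := {p | k * |p.1| ≤ p.2}

/-- The inside `|x| < c t` of the cone, with `c = 1 / k`; for `k = 0` it is `t > 0`. -/
def openCone (k : ℝ) : Set (ℝ × ℝ) := {p | k * |p.1| < p.2}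

end DistributedOrderWave

end

noncomputable section

namespace DistributedOrderWave

/-! ### The transforms `Φ` -/

section Transform

variable {μ μσ με : Measure unitInterval} [IsFiniteMeasure μ] [IsFiniteMeasure μσ]
  [IsFiniteMeasure με]

/-! Everything rests on the argument of Ψ. If g(α, β) is antisymmetric and non-negative on the
triangle, then (T) makes its integral against μ_σ × μ_ε non-positive
(`Thermodynamical.integral_prod_nonpos`). Taking g = r^α r^β sin((α - β)θ) gives arg(Φ_σ/Φ_ε) ≤ 0 on
the upper half plane including the upper side of the cut. This yields Re(e^{iθ} Ψ) ≥ |Ψ| cos θ,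
hence the central estimate |exp(-|x| s Ψ + s t)| ≤ exp(Re s (t - |x| |Ψ(s)|))
(`IsModel.norm_exp_le`).

The same antisymmetry shows that Φ_σ/Φ_ε decreases on the positive axis, so that it has a limit τ
there, and that its oscillation on the circle of radius r is controlled by its drop from r to 2r.
This makes the limit uniform in θ. It also needs |Φ_ε(re^{iθ})| to be comparable with Φ_ε(r) up to
both sides of the cut (`exists_lower_bound`).

Let W = s S̃ = (Ψ/2) exp(-|x| s Ψ). Since W/s² is integrable on vertical lines, its inverse Laplace
transform is a continuous function (`wavePrimitive`) of at most quadratic growth in t, and the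
fundamental solution is its t-derivative. For t < k|x| the central estimate keeps the integrand
under control as Re s → ∞, and pushing the line to infinity shows that the function vanishes: this
is the support in the cone. Uniqueness holds because the Laplace transform on Re s = 1 fixes the
values on compactly supported test functions, by Fourier inversion in t, and these are dense.

For t > k|x| the central estimate controls the integrand in the left half plane instead. After
pairing in t with a compactly supported f, the transform of f supplies quadratic decay, and Cauchy's
theorem in the two quadrants above and below the real axis folds the line Re s = 1 onto the cut
(`IsModel.integral_waveSymbol_hankel`). The jump of W across the cut is the integrand of K. -/

theorem _root_.Continuous.integrable_of_compactSpace {X E : Type*} [TopologicalSpace X]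
    [CompactSpace X] [MeasurableSpace X] [OpensMeasurableSpace X] [NormedAddCommGroup E]
    {ν : Measure X} [IsFiniteMeasure ν] {f : X → E} (hf : Continuous f) :
    Integrable f ν :=
  hf.integrable_of_hasCompactSupport (HasCompactSupport.of_compactSpace f)

/-- The value of `Φ` on the positive half line. -/
def realPhi (μ : Measure unitInterval) (r : ℝ) : ℝ := ∫ α : unitInterval, r ^ (α : ℝ) ∂μ

theorem continuous_rpow_coe {r : ℝ} (hr : 0 < r) :
    Continuous fun α : unitInterval => r ^ (α : ℝ) :=
  (Real.continuous_const_rpow hr.ne').comp continuous_subtype_val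

theorem continuous_Phi_integrand {r : ℝ} (hr : 0 < r) (θ β : ℝ) :
    Continuous fun α : unitInterval =>
      ((r ^ (α : ℝ) : ℝ) : ℂ) * Complex.exp (Complex.I * ((α : ℝ) * θ + β : ℝ)) := by
  fun_prop (disch := positivity)

omit [IsFiniteMeasure μ] in
theorem exp_mul_Phi (r θ β : ℝ) : Complex.exp (Complex.I * β) * Phi μ r θ =
    ∫ α : unitInterval, ((r ^ (α : ℝ) : ℝ) : ℂ) *
      Complex.exp (Complex.I * ((α : ℝ) * θ + β : ℝ)) ∂μ := by
  rw [Phi, ← integral_const_mul]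
  congr 1 with α
  rw [mul_left_comm, ← Complex.exp_add]
  congr 2
  push_cast
  ring

theorem exp_mul_Phi_re {r : ℝ} (hr : 0 < r) (θ β : ℝ) :
    (Complex.exp (Complex.I * β) * Phi μ r θ).re =
      ∫ α : unitInterval, r ^ (α : ℝ) * Real.cos ((α : ℝ) * θ + β) ∂μ := by
  rw [exp_mul_Phi]
  have := integral_re (𝕜 := ℂ) ((continuous_Phi_integrand hr θ β).integrable_of_compactSpace (ν := μ))
  simp only [RCLike.re_to_complex] at this
  rw [← this]
  congr 1 with α
  rw [Complex.re_ofReal_mul, mul_comm Complex.I, Complex.exp_ofReal_mul_I_re]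

theorem exp_mul_Phi_im {r : ℝ} (hr : 0 < r) (θ β : ℝ) :
    (Complex.exp (Complex.I * β) * Phi μ r θ).im =
      ∫ α : unitInterval, r ^ (α : ℝ) * Real.sin ((α : ℝ) * θ + β) ∂μ := by
  rw [exp_mul_Phi]
  have := integral_im (𝕜 := ℂ) ((continuous_Phi_integrand hr θ β).integrable_of_compactSpace (ν := μ))
  simp only [RCLike.im_to_complex] at this
  rw [← this]
  congr 1 with α
  rw [Complex.im_ofReal_mul, mul_comm Complex.I, Complex.exp_ofReal_mul_I_im]

theorem Phi_re {r : ℝ} (hr : 0 < r) (θ : ℝ) :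
    (Phi μ r θ).re = ∫ α : unitInterval, r ^ (α : ℝ) * Real.cos ((α : ℝ) * θ) ∂μ := by
  simpa using exp_mul_Phi_re (μ := μ) hr θ 0

theorem Phi_im {r : ℝ} (hr : 0 < r) (θ : ℝ) :
    (Phi μ r θ).im = ∫ α : unitInterval, r ^ (α : ℝ) * Real.sin ((α : ℝ) * θ) ∂μ := by
  simpa using exp_mul_Phi_im (μ := μ) hr θ 0

omit [IsFiniteMeasure μ] in
theorem Phi_zero_right (r : ℝ) : Phi μ r 0 = realPhi μ r := by
  simp only [Phi, realPhi, Complex.ofReal_zero, mul_zero, Complex.exp_zero, mul_one]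
  exact integral_ofReal

theorem Phi_neg {r : ℝ} (hr : 0 < r) (θ : ℝ) :
    Phi μ r (-θ) = (starRingEnd ℂ) (Phi μ r θ) := by
  apply Complex.ext
  · simp [Phi_re hr]
  · simp [Phi_im hr, integral_neg]

theorem realPhi_pos (hμ : μ ≠ 0) {r : ℝ} (hr : 0 < r) : 0 < realPhi μ r := by
  rw [realPhi, integral_pos_iff_support_of_nonneg (fun α => (Real.rpow_pos_of_pos hr _).le)
    (continuous_rpow_coe hr).integrable_of_compactSpace]
  have : Function.support (fun α : unitInterval => r ^ (α : ℝ)) = univ := by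
    ext α; simp [(Real.rpow_pos_of_pos hr _).ne']
  rw [this]
  simpa [pos_iff_ne_zero] using hμ

omit [IsFiniteMeasure μ] in
theorem norm_Phi_le {r : ℝ} (hr : 0 < r) (θ : ℝ) : ‖Phi μ r θ‖ ≤ realPhi μ r := by
  refine (norm_integral_le_integral_norm _).trans (le_of_eq ?_)
  rw [realPhi]
  congr 1 with α
  have : Complex.I * (α : ℝ) * θ = ((α * θ : ℝ) : ℂ) * Complex.I := by push_cast; ring
  rw [norm_mul, this, Complex.norm_exp_ofReal_mul_I, mul_one, Complex.norm_real,
    Real.norm_of_nonneg (Real.rpow_pos_of_pos hr _).le]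

omit [IsFiniteMeasure μ] in
-- In the logarithmic coordinate log r + iθ the transform is a moment generating function of a
-- bounded variable, hence entire. This supplies both joint continuity up to the two sides of the
-- cut and holomorphy off the cut.
theorem Phi_eq_complexMGF {r : ℝ} (hr : 0 < r) (θ : ℝ) :
    Phi μ r θ = ProbabilityTheory.complexMGF (fun α : unitInterval => (α : ℝ)) μ
      (Real.log r + θ * Complex.I) := by
  rw [Phi, ProbabilityTheory.complexMGF]
  congr 1 with α
  rw [Real.rpow_def_of_pos hr, Complex.ofReal_exp, ← Complex.exp_add]
  congr 1
  push_cast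
  ring

theorem differentiable_complexMGF_coe :
    Differentiable ℂ (ProbabilityTheory.complexMGF (fun α : unitInterval => (α : ℝ)) μ) := by
  have h : ProbabilityTheory.integrableExpSet (fun α : unitInterval => (α : ℝ)) μ = univ := by
    ext t
    simp only [ProbabilityTheory.integrableExpSet, mem_ofPred_eq, mem_univ, iff_true]
    exact Continuous.integrable_of_compactSpace (by fun_prop (disch := positivity))
  have := ProbabilityTheory.differentiableOn_complexMGF (X := fun α : unitInterval => (α : ℝ))
    (μ := μ)
  simpa [h, differentiableOn_univ] using this

/-- Rotating by -θ/2 centres the phases αθ: they become (α - 1/2)θ, of size at most |θ|/2, and the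
cosine decreases on [0, π]. Off the cut this already excludes zeros of Φ. -/
theorem cos_half_mul_realPhi_le {r θ : ℝ} (hr : 0 < r) (hθ : |θ| ≤ Real.pi) :
    Real.cos (θ / 2) * realPhi μ r ≤ (Complex.exp (Complex.I * (-θ / 2 : ℝ)) * Phi μ r θ).re := by
  rw [exp_mul_Phi_re hr, realPhi, ← integral_const_mul]
  refine integral_mono
    ((continuous_rpow_coe hr).const_mul _ |>.integrable_of_compactSpace)
    (Continuous.integrable_of_compactSpace ?_) fun α => ?_
  · fun_prop (disch := positivity)
  · simp only
    rw [mul_comm]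
    gcongr
    have : (α : ℝ) * θ + -θ / 2 = (α - 1 / 2) * θ := by ring
    rw [this, ← Real.cos_abs (θ / 2), ← Real.cos_abs ((α - 1 / 2) * θ)]
    have h0 := α.2.1
    have h1 := α.2.2
    have h2 : |(α : ℝ) - 1 / 2| ≤ 1 / 2 := by rw [abs_le]; constructor <;> linarith
    apply Real.cos_le_cos_of_nonneg_of_le_pi (abs_nonneg _)
    · rw [abs_div, abs_two]; linarith [Real.pi_pos]
    · rw [abs_mul, abs_div, abs_two]
      nlinarith [abs_nonneg θ]

theorem re_exp_mul_Phi_pos (hμ : μ ≠ 0) {r θ : ℝ} (hr : 0 < r) (hθ : |θ| < Real.pi) :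
    0 < (Complex.exp (Complex.I * (-θ / 2 : ℝ)) * Phi μ r θ).re := by
  refine lt_of_lt_of_le (mul_pos ?_ (realPhi_pos hμ hr)) (cos_half_mul_realPhi_le hr hθ.le)
  rw [abs_lt] at hθ
  exact Real.cos_pos_of_mem_Ioo ⟨by linarith, by linarith⟩

theorem Phi_im_nonneg {r θ : ℝ} (hr : 0 < r) (hθ : θ ∈ Icc 0 Real.pi) : 0 ≤ (Phi μ r θ).im := by
  rw [Phi_im hr]
  refine integral_nonneg fun α => mul_nonneg (Real.rpow_pos_of_pos hr _).le ?_
  exact Real.sin_nonneg_of_nonneg_of_le_pi (mul_nonneg α.2.1 hθ.1)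
    (by nlinarith [α.2.1, α.2.2, hθ.1, hθ.2])

/-- At θ = π the bound by cos(θ/2) degenerates to 0, and the imaginary part takes over: sin(απ) is
strictly positive for 0 < α < 1. This is where proper fractionality enters. -/
theorem Phi_pi_im_pos {r : ℝ} (hr : 0 < r) (hμ : μ (Ioo 0 1) ≠ 0) :
    0 < (Phi μ r Real.pi).im := by
  have hsin : ∀ α : unitInterval, 0 ≤ Real.sin (α * Real.pi) := fun α =>
    Real.sin_nonneg_of_nonneg_of_le_pi (mul_nonneg α.2.1 Real.pi_pos.le)
      (by nlinarith [α.2.2, Real.pi_pos])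
  have hcont : Continuous fun α : unitInterval => r ^ (α : ℝ) * Real.sin (α * Real.pi) := by
    fun_prop (disch := positivity)
  rw [Phi_im hr, integral_pos_iff_support_of_nonneg
    (fun α => mul_nonneg (Real.rpow_pos_of_pos hr _).le (hsin α))
    hcont.integrable_of_compactSpace]
  refine lt_of_lt_of_le (pos_iff_ne_zero.2 hμ) (measure_mono fun α hα => ?_)
  rw [Function.mem_support]
  have h0 : (0 : ℝ) < α := hα.1
  have h1 : (α : ℝ) < 1 := hα.2
  exact (mul_pos (Real.rpow_pos_of_pos hr _) (Real.sin_pos_of_pos_of_lt_pi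
    (by positivity) (by nlinarith [Real.pi_pos]))).ne'

end Transform

/-! ### The thermodynamical restriction -/

section Symmetrization

variable {μσ με : Measure unitInterval} [IsFiniteMeasure μσ] [IsFiniteMeasure με]

theorem measurableSet_triangle : MeasurableSet triangle :=
  measurableSet_lt measurable_snd measurable_fst

omit [IsFiniteMeasure μσ] [IsFiniteMeasure με] in
theorem Thermodynamical.restrict_le (hT : Thermodynamical μσ με) :
    (μσ.prod με).restrict triangle ≤ (με.prod μσ).restrict triangle := by
  refine Measure.le_iff.2 fun A hA => ?_
  rw [Measure.restrict_apply hA, Measure.restrict_apply hA]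
  exact hT _ (hA.inter measurableSet_triangle) inter_subset_right

/-- Folding the square along its diagonal, where an antisymmetric function vanishes, turns the
integral into that of g over the triangle against μ_σ × μ_ε - μ_ε × μ_σ, which (T) makes
non-positive there. All uses of (T) with integrals go through this. -/
theorem Thermodynamical.integral_prod_nonpos (hT : Thermodynamical μσ με)
    {g : unitInterval × unitInterval → ℝ} (hg : Continuous g) (hanti : ∀ p, g p.swap = -g p)
    (hpos : ∀ p ∈ triangle, 0 ≤ g p) : ∫ p, g p ∂(μσ.prod με) ≤ 0 := by
  have hdec : g = fun p => triangle.indicator g p - triangle.indicator g p.swap := by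
    ext p
    rcases lt_trichotomy p.1 p.2 with h | h | h
    · have h1 : p ∉ triangle := fun h' => lt_asymm h h'
      have h2 : p.swap ∈ triangle := h
      simp [h1, h2, hanti]
    · have h1 : p ∉ triangle := fun h' => h.not_gt h'
      have h2 : p.swap ∉ triangle := fun h' => h.not_lt h'
      have h3 : p.swap = p := Prod.ext h.symm h
      have h4 := hanti p
      rw [h3] at h4
      simp only [h1, h2, not_false_eq_true, indicator_of_notMem, sub_zero]
      linarith
    · have h1 : p ∈ triangle := h
      have h2 : p.swap ∉ triangle := fun h' => lt_asymm h h'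
      simp [h1, h2]
  have hint : ∀ (ν : Measure (unitInterval × unitInterval)) [IsFiniteMeasure ν],
      Integrable (triangle.indicator g) ν := fun ν _ =>
    hg.integrable_of_compactSpace.indicator measurableSet_triangle
  have hs : Integrable (fun p : unitInterval × unitInterval => triangle.indicator g p.swap)
      (μσ.prod με) := (hint (με.prod μσ)).swap
  rw [hdec, integral_sub (hint _) hs, integral_prod_swap (μ := με) (ν := μσ) (triangle.indicator g),
    integral_indicator measurableSet_triangle, integral_indicator measurableSet_triangle, sub_nonpos]
  exact integral_mono_measure hT.restrict_le
    ((ae_restrict_iff' measurableSet_triangle).2 (Eventually.of_forall hpos))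
    hg.integrable_of_compactSpace.restrict

theorem exp_mul_Phi_mul_conj_im {r : ℝ} (hr : 0 < r) (θ β : ℝ) :
    (Complex.exp (Complex.I * β) * (Phi μσ r θ * (starRingEnd ℂ) (Phi με r θ))).im =
      ∫ p : unitInterval × unitInterval, r ^ (p.1 : ℝ) * r ^ (p.2 : ℝ) *
        Real.sin (((p.1 : ℝ) - p.2) * θ + β) ∂(μσ.prod με) := by
  rw [← mul_assoc, Complex.mul_im, exp_mul_Phi_re hr, exp_mul_Phi_im hr, Complex.conj_im,
    Complex.conj_re, Phi_re hr, Phi_im hr, mul_neg, ← integral_prod_mul, ← integral_prod_mul,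
    ← integral_neg, ← integral_add]
  · congr 1 with p
    have : ((p.1 : ℝ) - p.2) * θ + β = (p.1 * θ + β) - p.2 * θ := by ring
    rw [this, Real.sin_sub]
    ring
  · refine (Continuous.integrable_of_compactSpace ?_).neg
    fun_prop (disch := positivity)
  · refine Continuous.integrable_of_compactSpace ?_
    fun_prop (disch := positivity)

/-- The kernel sin((α - β)θ) is antisymmetric, and on the triangle its argument lies in [0, π]. -/
theorem Thermodynamical.Phi_mul_conj_im_nonpos (hT : Thermodynamical μσ με) {r θ : ℝ} (hr : 0 < r)
    (hθ : θ ∈ Icc 0 Real.pi) : (Phi μσ r θ * (starRingEnd ℂ) (Phi με r θ)).im ≤ 0 := by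
  have h := exp_mul_Phi_mul_conj_im (μσ := μσ) (με := με) hr θ 0
  simp only [Complex.ofReal_zero, mul_zero, Complex.exp_zero, one_mul, add_zero] at h
  rw [h]
  refine hT.integral_prod_nonpos (by fun_prop (disch := positivity)) (fun p => ?_) fun p hp => ?_
  · have : ((p.swap.1 : ℝ) - p.swap.2) * θ = -(((p.1 : ℝ) - p.2) * θ) := by simp; ring
    rw [this, Real.sin_neg]
    simp only [Prod.fst_swap, Prod.snd_swap]
    ring
  · have h1 : (p.2 : ℝ) < p.1 := hp
    have h2 := p.1.2.2
    have h3 := p.2.2.1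
    refine mul_nonneg (by positivity) (Real.sin_nonneg_of_nonneg_of_le_pi
      (mul_nonneg (by linarith) hθ.1) ?_)
    nlinarith [hθ.1, hθ.2]

/-- The phase (α - β + 1)θ lies in [0, 2θ], inside [0, π], for all α and β, so positivity is
pointwise and does not rely on (T). It bounds the argument of the quotient from below by -θ. -/
theorem exp_mul_Phi_mul_conj_im_nonneg {r θ : ℝ} (hr : 0 < r) (hθ : θ ∈ Icc 0 (Real.pi / 2)) :
    0 ≤ (Complex.exp (Complex.I * θ) * (Phi μσ r θ * (starRingEnd ℂ) (Phi με r θ))).im := by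
  rw [exp_mul_Phi_mul_conj_im hr]
  refine integral_nonneg fun p => ?_
  have h1 := p.1.2.1
  have h2 := p.1.2.2
  have h3 := p.2.2.1
  have h4 := p.2.2.2
  have h5 := hθ.1
  have h6 := hθ.2
  refine mul_nonneg (by positivity) (Real.sin_nonneg_of_nonneg_of_le_pi ?_ ?_)
  · have : ((p.1 : ℝ) - p.2) * θ + θ = (p.1 + (1 - p.2)) * θ := by ring
    rw [this]
    exact mul_nonneg (by linarith) h5
  · nlinarith

/-- After the common factor (r r')^β is removed, the kernel on the triangle is r'^{α-β} - r^{α-β} ≥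
0. Thus Φ_σ/Φ_ε decreases on the positive axis. -/
theorem Thermodynamical.realPhi_mul_le (hT : Thermodynamical μσ με) {r r' : ℝ} (hr : 0 < r)
    (hrr' : r ≤ r') : realPhi μσ r' * realPhi με r ≤ realPhi μσ r * realPhi με r' := by
  have hr' := hr.trans_le hrr'
  rw [← sub_nonpos]
  simp only [realPhi]
  rw [← integral_prod_mul, ← integral_prod_mul, ← integral_sub
    (Continuous.integrable_of_compactSpace (by fun_prop (disch := positivity)))
    (Continuous.integrable_of_compactSpace (by fun_prop (disch := positivity)))]
  refine hT.integral_prod_nonpos (by fun_prop (disch := positivity)) (fun p => ?_) fun p hp => ?_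
  · simp; ring
  · have h1 : (p.2 : ℝ) < p.1 := hp
    have e1 : r ^ (p.1 : ℝ) = r ^ (p.2 : ℝ) * r ^ ((p.1 : ℝ) - p.2) := by
      rw [← Real.rpow_add hr]; congr 1; ring
    have e2 : r' ^ (p.1 : ℝ) = r' ^ (p.2 : ℝ) * r' ^ ((p.1 : ℝ) - p.2) := by
      rw [← Real.rpow_add hr']; congr 1; ring
    rw [e1, e2]
    have : r ^ ((p.1 : ℝ) - p.2) ≤ r' ^ ((p.1 : ℝ) - p.2) :=
      Real.rpow_le_rpow hr.le hrr' (by linarith)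
    have h5 : 0 < r' ^ (p.2 : ℝ) * r ^ (p.2 : ℝ) := by positivity
    nlinarith

/-- This is 2^b (2^{a-b} - 1) ≥ (a - b) log 2 together with log 2 > 1/2. It lets a linear bound in α
- β be replaced by the kernel that compares radii r and 2r. -/
theorem sub_le_two_mul_two_rpow_sub {a b : ℝ} (hb : 0 ≤ b) (hab : b ≤ a) :
    a - b ≤ 2 * ((2 : ℝ) ^ a - 2 ^ b) := by
  have e : (2 : ℝ) ^ a = 2 ^ b * 2 ^ (a - b) := by
    rw [← Real.rpow_add two_pos]; congr 1; ring
  have h1 : 1 ≤ (2 : ℝ) ^ b := Real.one_le_rpow one_le_two hb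
  have h2 : 1 + (a - b) * Real.log 2 ≤ (2 : ℝ) ^ (a - b) := by
    rw [Real.rpow_def_of_pos two_pos]
    linarith [Real.add_one_le_exp (Real.log 2 * (a - b))]
  have h3 := Real.log_two_gt_d9
  rw [e]
  nlinarith [mul_nonneg (sub_nonneg.2 hab) (sub_nonneg.2 h1), mul_nonneg (sub_nonneg.2 hab) (by linarith : (0:ℝ) ≤ Real.log 2 - 1/2)]

/-- The oscillation of `Φ_σ / Φ_ε` on the circle of radius `r` is controlled by its decrease
between `r` and `2 r` on the positive half line. -/
theorem Thermodynamical.norm_Phi_mul_sub_le (hT : Thermodynamical μσ με) {r θ : ℝ} (hr : 0 < r)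
    (hθ : |θ| ≤ Real.pi) :
    ‖Phi μσ r θ * realPhi με r - Phi με r θ * realPhi μσ r‖ ≤
      8 * (realPhi μσ r * realPhi με (2 * r) - realPhi μσ (2 * r) * realPhi με r) := by
  set Z := Phi μσ r θ * realPhi με r - Phi με r θ * realPhi μσ r with hZ
  -- This phase makes e^{iγ} Z equal to |Z|, so that |Z| becomes a single real integral whose kernel
  -- is antisymmetric in (α, β).
  set γ : ℝ := -Z.arg
  have h1 : ‖Z‖ = (Complex.exp (Complex.I * γ) * Z).re := by
    have e : Complex.exp (Complex.I * γ) * Z = ‖Z‖ := by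
      conv_lhs => rw [← Complex.norm_mul_exp_arg_mul_I Z]
      rw [mul_left_comm, ← Complex.exp_add]
      simp [γ, mul_comm]
    rw [e, Complex.ofReal_re]
  have h2 : ‖Z‖ = ∫ p : unitInterval × unitInterval, (r ^ (p.1 : ℝ) * Real.cos (p.1 * θ + γ) *
      r ^ (p.2 : ℝ) - r ^ (p.1 : ℝ) * (r ^ (p.2 : ℝ) * Real.cos (p.2 * θ + γ))) ∂(μσ.prod με) := by
    rw [integral_sub (Continuous.integrable_of_compactSpace (by fun_prop (disch := positivity)))
      (Continuous.integrable_of_compactSpace (by fun_prop (disch := positivity))),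
      integral_prod_mul (μ := μσ) (ν := με)
        (fun a : unitInterval => r ^ (a : ℝ) * Real.cos (a * θ + γ)) (fun b => r ^ (b : ℝ)),
      integral_prod_mul (μ := μσ) (ν := με)
        (fun a : unitInterval => r ^ (a : ℝ)) (fun b => r ^ (b : ℝ) * Real.cos (b * θ + γ)),
      ← exp_mul_Phi_re hr, ← exp_mul_Phi_re hr, h1, hZ, mul_sub, Complex.sub_re, ← mul_assoc,
      ← mul_assoc, Complex.re_mul_ofReal, Complex.re_mul_ofReal, realPhi, realPhi]
    ring
  have h3 : realPhi μσ (2 * r) * realPhi με r - realPhi μσ r * realPhi με (2 * r) =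
      ∫ p : unitInterval × unitInterval, ((2 * r) ^ (p.1 : ℝ) * r ^ (p.2 : ℝ) -
        r ^ (p.1 : ℝ) * (2 * r) ^ (p.2 : ℝ)) ∂(μσ.prod με) := by
    rw [integral_sub (Continuous.integrable_of_compactSpace (by fun_prop (disch := positivity)))
      (Continuous.integrable_of_compactSpace (by fun_prop (disch := positivity)))]
    simp only [realPhi]
    rw [← integral_prod_mul, ← integral_prod_mul]
  -- On the triangle the two cosines differ by at most |θ|(α - β) ≤ 4(α - β), since π ≤ 4, hence by
  -- at most 8(2^α - 2^β). This is the origin of the constant 8, and it makes the antisymmetric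
  -- integrand non-negative on the triangle.
  have h4 : ‖Z‖ + 8 * (realPhi μσ (2 * r) * realPhi με r - realPhi μσ r * realPhi με (2 * r)) ≤ 0 := by
    rw [h2, h3, ← integral_const_mul, ← integral_add
      (Continuous.integrable_of_compactSpace (by fun_prop (disch := positivity)))
      (Continuous.integrable_of_compactSpace (by fun_prop (disch := positivity)))]
    refine hT.integral_prod_nonpos (by fun_prop (disch := positivity)) (fun p => ?_) fun p hp => ?_
    · simp; ring
    · have h1 : (p.2 : ℝ) < p.1 := hp
      have h5 := sub_le_two_mul_two_rpow_sub p.2.2.1 h1.le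
      have h6 := Real.abs_cos_sub_cos_le (p.1 * θ + γ) (p.2 * θ + γ)
      have h7 : |(p.1 : ℝ) * θ + γ - (p.2 * θ + γ)| ≤ (p.1 - p.2) * 4 := by
        have : (p.1 : ℝ) * θ + γ - (p.2 * θ + γ) = (p.1 - p.2) * θ := by ring
        rw [this, abs_mul, abs_of_pos (sub_pos.2 h1)]
        have := Real.pi_le_four
        have : 0 < (p.1 : ℝ) - p.2 := sub_pos.2 h1
        gcongr
        linarith
      have h8 := (abs_le.1 (h6.trans h7)).1
      rw [Real.mul_rpow two_pos.le hr.le, Real.mul_rpow two_pos.le hr.le]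
      have h9 : 0 < r ^ (p.1 : ℝ) * r ^ (p.2 : ℝ) := by positivity
      nlinarith
  linarith

end Symmetrization

/-! ### Non-vanishing and lower bounds for `Φ` -/

section LowerBound

variable {μ μσ με : Measure unitInterval} [IsFiniteMeasure μ] [IsFiniteMeasure μσ]
  [IsFiniteMeasure με]

omit [IsFiniteMeasure μ] in
theorem measure_Ioo_ne_zero_of_support (h : (μ.support ∩ Ioo 0 1).Nonempty) :
    μ (Ioo 0 1) ≠ 0 := by
  obtain ⟨x, hx, hx'⟩ := h
  exact ((Measure.mem_support_iff_forall _).1 hx _ (isOpen_Ioo.mem_nhds hx')).ne'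

omit [IsFiniteMeasure μσ] [IsFiniteMeasure με] in
theorem ProperFractional.measure_Ioo (h : ProperFractional μσ με) :
    μσ (Ioo 0 1) ≠ 0 ∨ με (Ioo 0 1) ≠ 0 :=
  h.imp measure_Ioo_ne_zero_of_support measure_Ioo_ne_zero_of_support

theorem Thermodynamical.measure_mul_le (hT : Thermodynamical μσ με) {A B : Set unitInterval}
    (hA : MeasurableSet A) (hB : MeasurableSet B) (hAB : ∀ a ∈ A, ∀ b ∈ B, b < a) :
    μσ A * με B ≤ με A * μσ B := by
  rw [← Measure.prod_prod, ← Measure.prod_prod]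
  exact hT _ (hA.prod hB) fun p hp => hAB _ hp.1 _ hp.2

theorem Phi_pi_ne_zero_of_zero_null (hμ : μ ≠ 0) (h : μ (Ioo 0 1) = 0) (h0 : μ {0} = 0) {r : ℝ}
    (hr : 0 < r) : Phi μ r Real.pi ≠ 0 := by
  have hae : ∀ᵐ α ∂μ, α = 1 := by
    refine measure_mono_null (fun α hα => ?_) (measure_union_null h0 h)
    rcases eq_or_ne α 0 with rfl | h'
    · exact Or.inl rfl
    · exact Or.inr ⟨unitInterval.pos_iff_ne_zero.2 h', unitInterval.lt_one_iff_ne_one.2 hα⟩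
  have : Phi μ r Real.pi = ∫ _ : unitInterval, (-r : ℂ) ∂μ := by
    refine integral_congr_ae (hae.mono fun α hα => ?_)
    simp only [hα, Icc.coe_one, Real.rpow_one]
    rw [Complex.ofReal_one, mul_one, mul_comm Complex.I, Complex.exp_pi_mul_I]
    ring
  rw [this]
  simpa [hr.ne', Measure.real, ENNReal.toReal_eq_zero_iff] using hμ

theorem Phi_pi_ne_zero_of_one_null (hμ : μ ≠ 0) (h : μ (Ioo 0 1) = 0) (h1 : μ {1} = 0) {r : ℝ} :
    Phi μ r Real.pi ≠ 0 := by
  have hae : ∀ᵐ α ∂μ, α = 0 := by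
    refine measure_mono_null (fun α hα => ?_) (measure_union_null h1 h)
    rcases eq_or_ne α 1 with rfl | h'
    · exact Or.inl rfl
    · exact Or.inr ⟨unitInterval.pos_iff_ne_zero.2 hα, unitInterval.lt_one_iff_ne_one.2 h'⟩
  have : Phi μ r Real.pi = ∫ _ : unitInterval, (1 : ℂ) ∂μ := by
    refine integral_congr_ae (hae.mono fun α hα => ?_)
    simp [hα]
  rw [this]
  simpa [Measure.real, ENNReal.toReal_eq_zero_iff] using hμ

/-- If μ_ε charges (0,1), the imaginary part is positive. Otherwise μ_σ does, and (T) applied to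
(0,1) × {0} rules out an atom of μ_ε at 0. Then μ_ε is a multiple of the point mass at 1, and there
is no cancellation between the contributions of the exponents 0 and 1, which have opposite signs on
the cut. -/
theorem Thermodynamical.Phi_right_pi_ne_zero (hT : Thermodynamical μσ με) (hε : με ≠ 0)
    (hp : ProperFractional μσ με) {r : ℝ} (hr : 0 < r) : Phi με r Real.pi ≠ 0 := by
  by_cases h : με (Ioo 0 1) = 0
  · have hσ := hp.measure_Ioo.resolve_right (not_not.2 h)
    refine Phi_pi_ne_zero_of_zero_null hε h ?_ hr
    have := hT.measure_mul_le (measurableSet_Ioo (a := 0) (b := 1)) (measurableSet_singleton 0)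
      fun a ha b hb => by rw [mem_singleton_iff.1 hb]; exact ha.1
    rw [h, zero_mul, nonpos_iff_eq_zero, mul_eq_zero] at this
    exact this.resolve_left hσ
  · intro h0
    have := Phi_pi_im_pos hr h
    simp [h0] at this

/-- Mirror image of the argument for μ_ε: (T) on {1} × (0,1) now removes the atom of μ_σ at 1. -/
theorem Thermodynamical.Phi_left_pi_ne_zero (hT : Thermodynamical μσ με) (hσ : μσ ≠ 0)
    (hp : ProperFractional μσ με) {r : ℝ} (hr : 0 < r) : Phi μσ r Real.pi ≠ 0 := by
  by_cases h : μσ (Ioo 0 1) = 0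
  · have hε := hp.measure_Ioo.resolve_left (not_not.2 h)
    refine Phi_pi_ne_zero_of_one_null hσ h ?_
    have := hT.measure_mul_le (measurableSet_singleton 1) (measurableSet_Ioo (a := 0) (b := 1))
      fun a ha b hb => by rw [mem_singleton_iff.1 ha]; exact hb.2
    rw [h, mul_zero, nonpos_iff_eq_zero, mul_eq_zero] at this
    exact this.resolve_right hε
  · intro h0
    have := Phi_pi_im_pos hr h
    simp [h0] at this

theorem Phi_ne_zero_of_pi (hμ : μ ≠ 0) (hpi : ∀ r, 0 < r → Phi μ r Real.pi ≠ 0) {r θ : ℝ}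
    (hr : 0 < r) (hθ : θ ∈ Icc (-Real.pi) Real.pi) : Phi μ r θ ≠ 0 := by
  rcases eq_or_ne θ Real.pi with rfl | h1
  · exact hpi r hr
  rcases eq_or_ne θ (-Real.pi) with rfl | h2
  · rw [Phi_neg hr]
    simpa using hpi r hr
  · intro h0
    have := re_exp_mul_Phi_pos hμ hr
      (abs_lt.2 ⟨lt_of_le_of_ne hθ.1 h2.symm, lt_of_le_of_ne hθ.2 h1⟩)
    simp [h0] at this

theorem ratio_neg {r : ℝ} (hr : 0 < r) (θ : ℝ) :
    ratio μσ με r (-θ) = (starRingEnd ℂ) (ratio μσ με r θ) := by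
  rw [ratio, ratio, Phi_neg hr, Phi_neg hr, map_div₀]

/-- A non-positive quotient would mean Φ_σ = -c Φ_ε with c ≥ 0. Off the cut both have positive real
part after the rotation by -θ/2. On the cut both have non-negative imaginary part and at least one
is strictly positive, while c > 0 because Φ_σ does not vanish. -/
theorem Thermodynamical.ratio_mem_slitPlane (hT : Thermodynamical μσ με) (hσ : μσ ≠ 0)
    (hε : με ≠ 0) (hp : ProperFractional μσ με) {r θ : ℝ} (hr : 0 < r)
    (hθ : θ ∈ Icc (-Real.pi) Real.pi) : ratio μσ με r θ ∈ Complex.slitPlane := by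
  wlog h0 : 0 ≤ θ generalizing θ
  · have := this (θ := -θ) ⟨by linarith [hθ.2], by linarith [hθ.1]⟩ (by linarith)
    rw [ratio_neg hr] at this
    rw [Complex.mem_slitPlane_iff] at this ⊢
    simpa using this
  have hne : Phi με r θ ≠ 0 :=
    Phi_ne_zero_of_pi hε (fun r hr => hT.Phi_right_pi_ne_zero hε hp hr) hr hθ
  have hne' : Phi μσ r θ ≠ 0 :=
    Phi_ne_zero_of_pi hσ (fun r hr => hT.Phi_left_pi_ne_zero hσ hp hr) hr hθ
  by_contra hcon
  rw [Complex.mem_slitPlane_iff, not_or, not_lt, not_not] at hcon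
  set c : ℝ := -(ratio μσ με r θ).re
  have hc : 0 ≤ c := by simpa [c] using hcon.1
  have hratio : ratio μσ με r θ = ((-c : ℝ) : ℂ) := by
    apply Complex.ext
    · simp [c]
    · simp [hcon.2]
  have hΦ : Phi μσ r θ = ((-c : ℝ) : ℂ) * Phi με r θ := by
    rw [← hratio, ratio, div_mul_cancel₀ _ hne]
  rcases eq_or_ne θ Real.pi with rfl | hπ
  · have h1 : 0 ≤ (Phi μσ r Real.pi).im := Phi_im_nonneg hr ⟨h0, le_rfl⟩
    have h2 : 0 ≤ (Phi με r Real.pi).im := Phi_im_nonneg hr ⟨h0, le_rfl⟩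
    have hc' : 0 < c := by
      refine lt_of_le_of_ne hc fun h => hne' ?_
      rw [hΦ, ← h]
      simp
    have h3 : (Phi μσ r Real.pi).im = -c * (Phi με r Real.pi).im := by
      rw [hΦ, Complex.im_ofReal_mul]
    rcases hp.measure_Ioo with h | h
    · have := Phi_pi_im_pos hr h
      nlinarith
    · have := Phi_pi_im_pos hr h
      nlinarith
  · have habs : |θ| < Real.pi := by
      rw [abs_of_nonneg h0]
      exact lt_of_le_of_ne hθ.2 hπ
    have h1 := re_exp_mul_Phi_pos hσ hr habs
    have h2 := re_exp_mul_Phi_pos hε hr habs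
    rw [hΦ, mul_left_comm, Complex.re_ofReal_mul] at h1
    nlinarith

/-- For large r the exponents close to the largest point m of the support dominate. The rotation by
(m - 1/4)θ makes the exponents in (m - 1/2, m] add up without cancellation, up to and including θ =
±π, and the rest is of lower order. -/
theorem exists_lower_bound_of_large (hμ : μ ≠ 0) : ∃ R > 0, ∀ r ≥ R, ∀ θ : ℝ, |θ| ≤ Real.pi →
    1 / 4 * realPhi μ r ≤ ‖Phi μ r θ‖ := by
  have hne : μ.support.Nonempty := Measure.nonempty_support hμ
  obtain ⟨m, hm, hmax⟩ := Measure.isClosed_support.isCompact.exists_isMaxOn hne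
    (continuous_id (X := unitInterval)).continuousOn
  have hae : ∀ᵐ α ∂μ, α ≤ m := by
    filter_upwards [Measure.support_mem_ae (μ := μ)] with α hα using hmax hα
  set A : Set unitInterval := {α | (m : ℝ) - 1 / 4 < α}
  have hA : 0 < μ.real A := by
    rw [measureReal_def, ENNReal.toReal_pos_iff]
    refine ⟨(Measure.mem_support_iff_forall _).1 hm _ ?_, measure_lt_top _ _⟩
    refine (isOpen_lt continuous_const continuous_subtype_val).mem_nhds ?_
    show (m : ℝ) - 1 / 4 < m
    linarith
  have htend := tendsto_rpow_atTop (show (0 : ℝ) < 1 / 4 by norm_num)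
  -- With r^{1/4} at least 6 μ([0,1])/μ(A), the error (3/2) r^{m-1/2} μ([0,1]) is at most a quarter
  -- of r^{m-1/4} μ(A), which is below Φ(r). What remains is 1/2 - 1/4.
  obtain ⟨R, hR⟩ := eventually_atTop.1
    ((htend.eventually_ge_atTop (6 * μ.real univ / μ.real A)).and (eventually_ge_atTop 1))
  refine ⟨max R 1, by positivity, fun r hr θ hθ => ?_⟩
  obtain ⟨h1, hr1⟩ := hR r ((le_max_left _ _).trans hr)
  have hr0 : 0 < r := by linarith
  rw [div_le_iff₀ hA] at h1
  have h2 : r ^ ((m : ℝ) - 1 / 4) * μ.real A ≤ realPhi μ r := by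
    have : ∫ α, A.indicator (fun _ => r ^ ((m : ℝ) - 1 / 4)) α ∂μ ≤ realPhi μ r := by
      refine integral_mono ((integrable_const _).indicator ?_)
        (continuous_rpow_coe hr0).integrable_of_compactSpace fun α => ?_
      · exact measurableSet_lt measurable_const measurable_subtype_coe
      · by_cases hα : α ∈ A
        · simp only [hα, indicator_of_mem]
          exact Real.rpow_le_rpow_of_exponent_le hr1 (le_of_lt hα)
        · simp only [hα, not_false_eq_true, indicator_of_notMem]
          positivity
    rw [integral_indicator_const _ (measurableSet_lt measurable_const measurable_subtype_coe),
      smul_eq_mul] at this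
    linarith
  -- Pointwise in α: for α > m - 1/2 the rotated phase is at most π/4 ≤ π/3, so the cosine is at
  -- least 1/2. For smaller α one has cos ≥ -1 and r^α ≤ r^{m-1/2}, so the subtracted term pays for
  -- 1/2 + 1.
  have h3 : 1 / 2 * realPhi μ r - 3 / 2 * r ^ ((m : ℝ) - 1 / 2) * μ.real univ ≤
      (Complex.exp (Complex.I * (-((m : ℝ) - 1 / 4) * θ : ℝ)) * Phi μ r θ).re := by
    have hint : Integrable (fun α : unitInterval => r ^ (α : ℝ)) μ :=
      (continuous_rpow_coe hr0).integrable_of_compactSpace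
    have e : 1 / 2 * realPhi μ r - 3 / 2 * r ^ ((m : ℝ) - 1 / 2) * μ.real univ =
        ∫ α : unitInterval, (1 / 2 * r ^ (α : ℝ) - 3 / 2 * r ^ ((m : ℝ) - 1 / 2)) ∂μ := by
      rw [integral_sub (hint.const_mul _) (integrable_const _), integral_const_mul, integral_const,
        realPhi, smul_eq_mul]
      ring
    rw [exp_mul_Phi_re hr0, e]
    refine integral_mono_ae ((hint.const_mul _).sub (integrable_const _))
      (Continuous.integrable_of_compactSpace (by fun_prop (disch := positivity)))
      (hae.mono fun α hα => ?_)
    have hα' : (α : ℝ) ≤ m := hα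
    have hpos : 0 < r ^ (α : ℝ) := by positivity
    have hpos' : 0 < r ^ ((m : ℝ) - 1 / 2) := by positivity
    simp only
    by_cases hlt : (m : ℝ) - 1 / 2 < α
    · have : 1 / 2 ≤ Real.cos (α * θ + -((m : ℝ) - 1 / 4) * θ) := by
        rw [← Real.cos_pi_div_three, ← Real.cos_abs (α * θ + _)]
        apply Real.cos_le_cos_of_nonneg_of_le_pi (abs_nonneg _) (by linarith [Real.pi_pos])
        rw [← add_mul, abs_mul]
        have : |(α : ℝ) + -((m : ℝ) - 1 / 4)| ≤ 1 / 4 := by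
          rw [abs_le]; constructor <;> linarith
        nlinarith [abs_nonneg θ, Real.pi_pos]
      nlinarith
    · have h5 : r ^ (α : ℝ) ≤ r ^ ((m : ℝ) - 1 / 2) :=
        Real.rpow_le_rpow_of_exponent_le hr1 (not_lt.1 hlt)
      have h6 := Real.neg_one_le_cos (α * θ + -((m : ℝ) - 1 / 4) * θ)
      nlinarith
  have h4 : (Complex.exp (Complex.I * (-((m : ℝ) - 1 / 4) * θ : ℝ)) * Phi μ r θ).re ≤
      ‖Phi μ r θ‖ := by
    refine (Complex.re_le_norm _).trans (le_of_eq ?_)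
    rw [norm_mul, mul_comm Complex.I, Complex.norm_exp_ofReal_mul_I, one_mul]
  have h5 : r ^ ((m : ℝ) - 1 / 4) = r ^ ((m : ℝ) - 1 / 2) * r ^ (1 / 4 : ℝ) := by
    rw [← Real.rpow_add hr0]; congr 1; ring
  have h6 : 0 < r ^ ((m : ℝ) - 1 / 2) := by positivity
  rw [h5] at h2
  nlinarith

omit [IsFiniteMeasure μ] in
-- The reflection α ↦ 1 - α exchanges r → 0 with r → ∞, so small radii need no separate analysis.
theorem Phi_map_symm {r : ℝ} (hr : 0 < r) (θ : ℝ) :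
    Phi μ r θ = r * Complex.exp (Complex.I * θ) * Phi (μ.map unitInterval.symm) r⁻¹ (-θ) := by
  have hc := continuous_Phi_integrand (inv_pos.2 hr) (-θ) 0
  simp only [add_zero] at hc
  rw [Phi, Phi, integral_map (by fun_prop) ?_, ← integral_const_mul]
  · congr 1 with α
    rw [unitInterval.coe_symm_eq, Real.inv_rpow hr.le, Real.rpow_sub hr, Real.rpow_one, inv_div,
      mul_mul_mul_comm, ← Complex.exp_add, ← Complex.ofReal_mul]
    congr 2
    · field_simp
    · push_cast; ring
  · refine Continuous.aestronglyMeasurable ?_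
    convert hc using 4
    push_cast
    ring

omit [IsFiniteMeasure μ] in
theorem realPhi_map_symm {r : ℝ} (hr : 0 < r) :
    realPhi μ r = r * realPhi (μ.map unitInterval.symm) r⁻¹ := by
  have := Phi_map_symm (μ := μ) hr 0
  simp only [neg_zero, Phi_zero_right, Complex.ofReal_zero, mul_zero, Complex.exp_zero,
    mul_one] at this
  exact_mod_cast this

theorem exists_lower_bound_of_small (hμ : μ ≠ 0) : ∃ R > 0, ∀ r, 0 < r → r ≤ R → ∀ θ : ℝ,
    |θ| ≤ Real.pi → 1 / 4 * realPhi μ r ≤ ‖Phi μ r θ‖ := by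
  have hmeas : Measurable unitInterval.symm := by fun_prop
  have hμ' : μ.map unitInterval.symm ≠ 0 := by
    rwa [Ne, Measure.map_eq_zero_iff hmeas.aemeasurable]
  obtain ⟨R, hR, h⟩ := exists_lower_bound_of_large hμ'
  refine ⟨R⁻¹, inv_pos.2 hR, fun r hr hr' θ hθ => ?_⟩
  have := h r⁻¹ ((le_inv_comm₀ hr hR).1 hr') (-θ) (by rwa [abs_neg])
  rw [Phi_map_symm hr, realPhi_map_symm hr, norm_mul, norm_mul, mul_comm Complex.I,
    Complex.norm_exp_ofReal_mul_I, Complex.norm_real, Real.norm_of_nonneg hr.le]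
  nlinarith

theorem continuousOn_Phi : ContinuousOn (fun p : ℝ × ℝ => Phi μ p.1 p.2) (Ioi 0 ×ˢ univ) := by
  have h : ContinuousOn (fun p : ℝ × ℝ => ProbabilityTheory.complexMGF
      (fun α : unitInterval => (α : ℝ)) μ (Real.log p.1 + p.2 * Complex.I)) (Ioi 0 ×ˢ univ) := by
    refine differentiable_complexMGF_coe.continuous.comp_continuousOn ?_
    have : ContinuousOn (fun p : ℝ × ℝ => Real.log p.1) (Ioi 0 ×ˢ univ) :=
      continuousOn_fst.log fun p hp => (ne_of_gt hp.1)
    fun_prop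
  exact h.congr fun p hp => Phi_eq_complexMGF hp.1 p.2

/-- Both ends are covered by the asymptotic bounds, and the intermediate radii by compactness and
continuity, using that Φ has no zeros up to both sides of the cut. -/
theorem exists_lower_bound (hμ : μ ≠ 0)
    (hne : ∀ r, 0 < r → ∀ θ ∈ Icc (-Real.pi) Real.pi, Phi μ r θ ≠ 0) :
    ∃ c > 0, ∀ r, 0 < r → ∀ θ ∈ Icc (-Real.pi) Real.pi, c * realPhi μ r ≤ ‖Phi μ r θ‖ := by
  obtain ⟨R, hR, hlarge⟩ := exists_lower_bound_of_large hμ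
  obtain ⟨R', hR', hsmall⟩ := exists_lower_bound_of_small hμ
  have hK : IsCompact (Icc R' R ×ˢ Icc (-Real.pi) Real.pi) := isCompact_Icc.prod isCompact_Icc
  have hpos : ∀ p ∈ Icc R' R ×ˢ Icc (-Real.pi) Real.pi, 0 < p.1 := fun p hp => hR'.trans_le hp.1.1
  have hcont : ContinuousOn (fun p : ℝ × ℝ => ‖Phi μ p.1 p.2‖ / ‖Phi μ p.1 0‖)
      (Icc R' R ×ˢ Icc (-Real.pi) Real.pi) := by
    refine ContinuousOn.div ?_ ?_ fun p hp => ?_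
    · exact (continuousOn_Phi.mono fun p hp => ⟨hpos p hp, mem_univ _⟩).norm
    · exact (continuousOn_Phi.comp (f := fun p : ℝ × ℝ => (p.1, (0 : ℝ))) (by fun_prop)
        fun p hp => ⟨hpos p hp, mem_univ _⟩).norm
    · exact norm_ne_zero_iff.2 (hne _ (hpos p hp) 0 ⟨by linarith [Real.pi_pos], Real.pi_pos.le⟩)
  have hmid : ∃ c > 0, ∀ p ∈ Icc R' R ×ˢ Icc (-Real.pi) Real.pi,
      c ≤ ‖Phi μ p.1 p.2‖ / ‖Phi μ p.1 0‖ := by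
    -- Nothing forces R' ≤ R. If the intermediate range is empty, any positive constant serves.
    rcases (Icc R' R ×ˢ Icc (-Real.pi) Real.pi).eq_empty_or_nonempty with he | he
    · exact ⟨1, one_pos, by simp [he]⟩
    · obtain ⟨p, hp, hmin⟩ := hK.exists_isMinOn he hcont
      refine ⟨_, div_pos (norm_pos_iff.2 (hne _ (hpos p hp) _ hp.2)) (norm_pos_iff.2
        (hne _ (hpos p hp) 0 ⟨by linarith [Real.pi_pos], Real.pi_pos.le⟩)), fun q hq => hmin hq⟩
  obtain ⟨c, hc, hmid⟩ := hmid
  refine ⟨min c (1 / 4), by positivity, fun r hr θ hθ => ?_⟩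
  have hφ := realPhi_pos hμ hr
  have h4 : min c (1 / 4) * realPhi μ r ≤ 1 / 4 * realPhi μ r := by gcongr; exact min_le_right _ _
  rcases le_total R r with h | h
  · exact h4.trans (hlarge r h θ (abs_le.2 hθ))
  rcases le_total r R' with h' | h'
  · exact h4.trans (hsmall r hr h' θ (abs_le.2 hθ))
  · have := hmid (r, θ) ⟨⟨h', h⟩, hθ⟩
    simp only [Phi_zero_right, Complex.norm_real, Real.norm_of_nonneg hφ.le] at this
    rw [le_div_iff₀ hφ] at this
    refine le_trans ?_ this
    gcongr
    exact min_le_left _ _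

end LowerBound

/-! ### The functions `Φ_σ / Φ_ε` and `Ψ` -/

/-- The standing assumptions on the pair of constitutive measures. -/
structure IsModel (μσ με : Measure unitInterval) : Prop where
  left_ne_zero : μσ ≠ 0
  right_ne_zero : με ≠ 0
  thermodynamical : Thermodynamical μσ με
  properFractional : ProperFractional μσ με

section Psi

variable {μσ με : Measure unitInterval} [IsFiniteMeasure μσ] [IsFiniteMeasure με]

theorem IsModel.Phi_ne_zero (h : IsModel μσ με) {r θ : ℝ} (hr : 0 < r)
    (hθ : θ ∈ Icc (-Real.pi) Real.pi) : Phi με r θ ≠ 0 :=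
  Phi_ne_zero_of_pi h.right_ne_zero
    (fun _ hr => h.thermodynamical.Phi_right_pi_ne_zero h.right_ne_zero h.properFractional hr) hr hθ

theorem IsModel.ratio_mem_slitPlane (h : IsModel μσ με) {r θ : ℝ} (hr : 0 < r)
    (hθ : θ ∈ Icc (-Real.pi) Real.pi) : ratio μσ με r θ ∈ Complex.slitPlane :=
  h.thermodynamical.ratio_mem_slitPlane h.left_ne_zero h.right_ne_zero h.properFractional hr hθ

/-- The quotient `Φ_σ / Φ_ε` on the positive half line. -/
def realRatio (μσ με : Measure unitInterval) (r : ℝ) : ℝ := realPhi μσ r / realPhi με r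

/-! ### The quotient on the positive axis, its growth and its limit at infinity -/

theorem IsModel.realRatio_pos (h : IsModel μσ με) {r : ℝ} (hr : 0 < r) : 0 < realRatio μσ με r :=
  div_pos (realPhi_pos h.left_ne_zero hr) (realPhi_pos h.right_ne_zero hr)

theorem IsModel.realRatio_le (h : IsModel μσ με) {r r' : ℝ} (hr : 0 < r) (hrr' : r ≤ r') :
    realRatio μσ με r' ≤ realRatio μσ με r := by
  rw [realRatio, realRatio, div_le_div_iff₀ (realPhi_pos h.right_ne_zero (hr.trans_le hrr'))
    (realPhi_pos h.right_ne_zero hr)]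
  exact h.thermodynamical.realPhi_mul_le hr hrr'

theorem realPhi_mul_le_of_le_one {r : ℝ} (hr : 0 < r) (hr1 : r ≤ 1) :
    r * realPhi με 1 ≤ realPhi με r := by
  rw [realPhi, realPhi, ← integral_const_mul]
  refine integral_mono (Continuous.integrable_of_compactSpace (by fun_prop (disch := positivity)))
    (continuous_rpow_coe hr).integrable_of_compactSpace fun α => ?_
  simp only [Real.one_rpow, mul_one]
  simpa using Real.rpow_le_rpow_of_exponent_ge hr hr1 α.2.2

theorem realPhi_le_of_le_one {r : ℝ} (hr : 0 < r) (hr1 : r ≤ 1) :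
    realPhi με r ≤ realPhi με 1 := by
  refine integral_mono (continuous_rpow_coe hr).integrable_of_compactSpace
    (continuous_rpow_coe one_pos).integrable_of_compactSpace fun α => ?_
  exact Real.rpow_le_rpow hr.le hr1 α.2.1

/-- For r ≥ 1 this is monotonicity. For r ≤ 1 the inequalities r ≤ r^α ≤ 1 bound the numerator by
its value at 1 and cost a factor 1/r in the denominator. -/
theorem IsModel.realRatio_bound (h : IsModel μσ με) {r : ℝ} (hr : 0 < r) :
    realRatio μσ με r ≤ realRatio μσ με 1 * (1 + r⁻¹) := by
  have h1 := h.realRatio_pos one_pos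
  rcases le_total 1 r with hr1 | hr1
  · refine (h.realRatio_le one_pos hr1).trans ?_
    have : 0 < r⁻¹ := inv_pos.2 hr
    nlinarith
  · have h2 : realRatio μσ με r ≤ realPhi μσ 1 / (r * realPhi με 1) :=
      div_le_div₀ (realPhi_pos h.left_ne_zero one_pos).le (realPhi_le_of_le_one hr hr1)
        (mul_pos hr (realPhi_pos h.right_ne_zero one_pos)) (realPhi_mul_le_of_le_one hr hr1)
    refine h2.trans ?_
    have h3 : realPhi μσ 1 / (r * realPhi με 1) = realRatio μσ με 1 * r⁻¹ := by
      rw [realRatio, mul_comm r, ← div_div, div_eq_mul_inv _ r]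
    rw [h3]
    nlinarith

theorem IsModel.exists_norm_ratio_le (h : IsModel μσ με) : ∃ C > 0, ∀ r, 0 < r →
    ∀ θ ∈ Icc (-Real.pi) Real.pi, ‖ratio μσ με r θ‖ ≤ C * (1 + r⁻¹) := by
  obtain ⟨c, hc, hlow⟩ := exists_lower_bound h.right_ne_zero fun r hr θ hθ => h.Phi_ne_zero hr hθ
  refine ⟨realRatio μσ με 1 / c, div_pos (h.realRatio_pos one_pos) hc, fun r hr θ hθ => ?_⟩
  have hε := realPhi_pos h.right_ne_zero hr
  calc ‖ratio μσ με r θ‖ = ‖Phi μσ r θ‖ / ‖Phi με r θ‖ := norm_div _ _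
    _ ≤ realPhi μσ r / (c * realPhi με r) :=
        div_le_div₀ (realPhi_pos h.left_ne_zero hr).le (norm_Phi_le hr θ) (mul_pos hc hε)
          (hlow r hr θ hθ)
    _ = realRatio μσ με r / c := by rw [realRatio, div_div, mul_comm]
    _ ≤ realRatio μσ με 1 * (1 + r⁻¹) / c := by gcongr; exact h.realRatio_bound hr
    _ = _ := by ring

/-- This is the oscillation estimate divided by the denominators. The constant 16/c is 8 times 2,
from Φ_ε(2r) ≤ 2 Φ_ε(r), over the constant c of the lower bound for |Φ_ε|. -/
theorem IsModel.exists_norm_ratio_sub_le (h : IsModel μσ με) : ∃ C > 0, ∀ r, 0 < r →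
    ∀ θ ∈ Icc (-Real.pi) Real.pi, ‖ratio μσ με r θ - realRatio μσ με r‖ ≤
      C * (realRatio μσ με r - realRatio μσ με (2 * r)) := by
  obtain ⟨c, hc, hlow⟩ := exists_lower_bound h.right_ne_zero fun r hr θ hθ => h.Phi_ne_zero hr hθ
  refine ⟨16 / c, by positivity, fun r hr θ hθ => ?_⟩
  have hε := realPhi_pos h.right_ne_zero hr
  have hε2 := realPhi_pos h.right_ne_zero (show 0 < 2 * r by positivity)
  have hne := h.Phi_ne_zero hr hθ
  have e : ratio μσ με r θ - realRatio μσ με r =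
      (Phi μσ r θ * realPhi με r - Phi με r θ * realPhi μσ r) / (Phi με r θ * realPhi με r) := by
    have : (realPhi με r : ℂ) ≠ 0 := by exact_mod_cast hε.ne'
    rw [ratio, realRatio]
    push_cast
    rw [div_sub_div _ _ hne this]
  have hmono := h.realRatio_le hr (show r ≤ 2 * r by linarith)
  have h2 : realPhi με (2 * r) ≤ 2 * realPhi με r := by
    rw [realPhi, realPhi, ← integral_const_mul]
    refine integral_mono (continuous_rpow_coe (by positivity)).integrable_of_compactSpace
      (Continuous.integrable_of_compactSpace (by fun_prop (disch := positivity))) fun α => ?_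
    simp only
    rw [Real.mul_rpow two_pos.le hr.le]
    gcongr
    simpa using Real.rpow_le_rpow_of_exponent_le one_le_two α.2.2
  have h3 : realPhi μσ r * realPhi με (2 * r) - realPhi μσ (2 * r) * realPhi με r =
      (realRatio μσ με r - realRatio μσ με (2 * r)) * (realPhi με r * realPhi με (2 * r)) := by
    simp only [realRatio]
    field_simp
  rw [e, norm_div, norm_mul, Complex.norm_real, Real.norm_of_nonneg hε.le, div_le_iff₀
    (mul_pos (norm_pos_iff.2 hne) hε)]
  refine (h.thermodynamical.norm_Phi_mul_sub_le hr (abs_le.2 hθ)).trans ?_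
  rw [h3]
  have h4 : realPhi με r ≤ ‖Phi με r θ‖ / c := by
    rw [le_div_iff₀ hc, mul_comm]; exact hlow r hr θ hθ
  calc 8 * ((realRatio μσ με r - realRatio μσ με (2 * r)) * (realPhi με r * realPhi με (2 * r)))
      ≤ 8 * ((realRatio μσ με r - realRatio μσ με (2 * r)) *
          (‖Phi με r θ‖ / c * (2 * realPhi με r))) := by
        have := sub_nonneg.2 hmono
        gcongr
    _ = _ := by ring

/-- A positive decreasing function converges, so its drop from r to 2r tends to 0. That drop bounds
the oscillation over the whole circle, which gives uniformity in θ. -/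
theorem IsModel.exists_tendsto_ratio (h : IsModel μσ με) : ∃ τ : ℝ, 0 ≤ τ ∧
    TendstoUniformlyOn (ratio μσ με) (fun _ => (τ : ℂ)) atTop (Icc (-Real.pi) Real.pi) := by
  -- Freezing the argument at 1 gives a function antitone on all of ℝ without changing it near
  -- infinity.
  have hanti : Antitone fun r => realRatio μσ με (max r 1) := fun a b hab =>
    h.realRatio_le (by positivity) (max_le_max_right 1 hab)
  have hpos : ∀ r, 0 < realRatio μσ με (max r 1) := fun r => h.realRatio_pos (by positivity)
  have hlim := tendsto_atTop_ciInf hanti ⟨0, by rintro _ ⟨r, rfl⟩; exact (hpos r).le⟩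
  set τ := ⨅ r, realRatio μσ με (max r 1)
  have hlim' : Tendsto (realRatio μσ με) atTop (nhds τ) := hlim.congr' <| by
    filter_upwards [eventually_ge_atTop 1] with r hr
    rw [max_eq_left hr]
  refine ⟨τ, le_ciInf fun r => (hpos r).le, ?_⟩
  obtain ⟨C, hC, hbound⟩ := h.exists_norm_ratio_sub_le
  have hlim2 : Tendsto (fun r => realRatio μσ με (2 * r)) atTop (nhds τ) :=
    hlim'.comp (tendsto_id.const_mul_atTop two_pos)
  have hlim3 : Tendsto (fun r => C * (realRatio μσ με r - realRatio μσ με (2 * r)) +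
      ‖(realRatio μσ με r : ℂ) - τ‖) atTop (nhds 0) := by
    have h1 := (hlim'.sub hlim2).const_mul C
    have h2 : Tendsto (fun r => ‖(realRatio μσ με r : ℂ) - τ‖) atTop (nhds 0) := by
      rw [← tendsto_iff_norm_sub_tendsto_zero]
      exact (Complex.continuous_ofReal.tendsto τ).comp hlim'
    simpa using h1.add h2
  rw [Metric.tendstoUniformlyOn_iff]
  intro ε hε
  filter_upwards [hlim3.eventually_lt_const hε, eventually_gt_atTop 0] with r hr hr0 θ hθ
  rw [dist_comm, dist_eq_norm]
  refine lt_of_le_of_lt ?_ hr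
  calc ‖ratio μσ με r θ - τ‖ = ‖(ratio μσ με r θ - realRatio μσ με r) +
      ((realRatio μσ με r : ℂ) - τ)‖ := by congr 1; ring
    _ ≤ _ := (norm_add_le _ _).trans (by gcongr; exact hbound r hr0 θ hθ)

theorem _root_.TendstoUniformlyOn.comp_continuousAt {α ι X Y : Type*} [PseudoMetricSpace X]
    [PseudoMetricSpace Y] {f : ι → α → X} {c : X} {l : Filter ι} {s : Set α} {g : X → Y}
    (h : TendstoUniformlyOn f (fun _ => c) l s) (hg : ContinuousAt g c) :
    TendstoUniformlyOn (fun i x => g (f i x)) (fun _ => g c) l s := by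
  rw [Metric.tendstoUniformlyOn_iff] at *
  intro ε hε
  obtain ⟨δ, hδ, h'⟩ := Metric.continuousAt_iff.1 hg ε hε
  filter_upwards [h δ hδ] with a ha x hx
  rw [dist_comm]
  exact h' (by rw [dist_comm]; exact ha x hx)

/-- The value τ = 0 lies outside the slit plane and needs the separate continuity of the power at 0,
which holds because the exponent has positive real part. -/
theorem continuousAt_cpow_half {τ : ℝ} (hτ : 0 ≤ τ) :
    ContinuousAt (fun z : ℂ => z ^ (1 / 2 : ℂ)) τ := by
  rcases hτ.eq_or_lt with rfl | hτ
  · exact (Complex.continuousAt_cpow_zero_of_re_pos (z := 1 / 2) (by norm_num)).comp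
      (f := fun z : ℂ => (z, (1 / 2 : ℂ))) (x := ((0 : ℝ) : ℂ)) (by fun_prop)
  · exact continuousAt_id.cpow continuousAt_const (Or.inl (by simpa using hτ))

omit [IsFiniteMeasure μσ] [IsFiniteMeasure με] in
theorem tendsto_Psi_of_tendsto_ratio {τ : ℝ} (hτ : 0 ≤ τ)
    (hlim : TendstoUniformlyOn (ratio μσ με) (fun _ => (τ : ℂ)) atTop
      (Icc (-Real.pi) Real.pi)) :
    TendstoUniformlyOn (Psi μσ με) (fun _ => ((√τ : ℝ) : ℂ)) atTop (Icc (-Real.pi) Real.pi) := by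
  have := hlim.comp_continuousAt (continuousAt_cpow_half hτ)
  have e : ((√τ : ℝ) : ℂ) = (τ : ℂ) ^ (1 / 2 : ℂ) := by
    rw [Real.sqrt_eq_rpow, Complex.ofReal_cpow hτ]
    norm_num
  rw [e]
  exact this

/-! ### Modulus, symmetry and argument of Ψ -/

omit [IsFiniteMeasure μσ] [IsFiniteMeasure με] in
theorem Psi_sq (r θ : ℝ) : Psi μσ με r θ ^ 2 = ratio μσ με r θ := by
  have := Complex.cpow_nat_inv_pow (ratio μσ με r θ) two_ne_zero
  rw [Psi]
  convert this using 3
  norm_num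

theorem IsModel.exists_norm_Psi_le (h : IsModel μσ με) : ∃ C > 0, ∀ r, 0 < r →
    ∀ θ ∈ Icc (-Real.pi) Real.pi, ‖Psi μσ με r θ‖ ≤ C * (1 + r ^ (-(1 / 2) : ℝ)) := by
  obtain ⟨C, hC, hb⟩ := h.exists_norm_ratio_le
  refine ⟨√C, by positivity, fun r hr θ hθ => ?_⟩
  have hp : (r ^ (-(1 / 2) : ℝ)) ^ 2 = r⁻¹ := by
    rw [← Real.rpow_natCast, ← Real.rpow_mul hr.le, ← Real.rpow_neg_one]
    norm_num
  have h0 : 0 < r ^ (-(1 / 2) : ℝ) := by positivity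
  refine le_of_sq_le_sq ?_ (by positivity)
  rw [← norm_pow, Psi_sq, mul_pow, Real.sq_sqrt hC.le]
  refine (hb r hr θ hθ).trans ?_
  gcongr
  nlinarith

theorem IsModel.Psi_neg (h : IsModel μσ με) {r θ : ℝ} (hr : 0 < r)
    (hθ : θ ∈ Icc (-Real.pi) Real.pi) :
    Psi μσ με r (-θ) = (starRingEnd ℂ) (Psi μσ με r θ) := by
  have := Complex.mem_slitPlane_iff_arg.1 (h.ratio_mem_slitPlane hr hθ)
  rw [Psi, ratio_neg hr, Complex.conj_cpow _ _ this.1, Psi]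
  norm_num [Complex.conj_ofNat]

theorem IsModel.arg_ratio_nonpos (h : IsModel μσ με) {r θ : ℝ} (hr : 0 < r)
    (hθ : θ ∈ Icc 0 Real.pi) : (ratio μσ με r θ).arg ≤ 0 := by
  have hslit := h.ratio_mem_slitPlane hr ⟨by linarith [hθ.1, Real.pi_pos], hθ.2⟩
  have him : (ratio μσ με r θ).im ≤ 0 := by
    rw [ratio, div_eq_mul_inv, Complex.inv_def, ← mul_assoc, Complex.im_mul_ofReal]
    exact mul_nonpos_of_nonpos_of_nonneg (h.thermodynamical.Phi_mul_conj_im_nonpos hr hθ)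
      (inv_nonneg.2 (Complex.normSq_nonneg _))
  rcases him.lt_or_eq with him | him
  · exact (Complex.arg_neg_iff.2 him).le
  · have : 0 < (ratio μσ με r θ).re := by
      rcases hslit with hre | hre
      · exact hre
      · exact absurd him hre
    rw [Complex.arg_eq_zero_iff.2 ⟨this.le, him⟩]

/-- Multiplication by e^{iθ} brings the quotient into the closed upper half plane. Since θ + arg >
-π, this excludes a negative θ + arg: its sine would be negative. -/
theorem IsModel.neg_le_arg_ratio (h : IsModel μσ με) {r θ : ℝ} (hr : 0 < r)
    (hθ : θ ∈ Icc 0 (Real.pi / 2)) : -θ ≤ (ratio μσ με r θ).arg := by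
  have hθ' : θ ∈ Icc 0 Real.pi := ⟨hθ.1, by linarith [hθ.2, Real.pi_pos]⟩
  have hslit := h.ratio_mem_slitPlane hr ⟨by linarith [hθ.1, Real.pi_pos], hθ'.2⟩
  have hnonpos := h.arg_ratio_nonpos hr hθ'
  have him : 0 ≤ (Complex.exp (Complex.I * θ) * ratio μσ με r θ).im := by
    rw [ratio, div_eq_mul_inv, Complex.inv_def, ← mul_assoc, ← mul_assoc, Complex.im_mul_ofReal,
      mul_assoc]
    exact mul_nonneg (exp_mul_Phi_mul_conj_im_nonneg hr hθ)
      (inv_nonneg.2 (Complex.normSq_nonneg _))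
  have e : Complex.exp (Complex.I * θ) * ratio μσ με r θ = (‖ratio μσ με r θ‖ : ℂ) *
      Complex.exp ((θ + (ratio μσ με r θ).arg : ℝ) * Complex.I) := by
    conv_lhs => rw [← Complex.norm_mul_exp_arg_mul_I (ratio μσ με r θ)]
    rw [mul_left_comm, ← Complex.exp_add]
    congr 2
    push_cast
    ring
  rw [e, Complex.im_ofReal_mul, Complex.exp_ofReal_mul_I_im] at him
  have hn : 0 < ‖ratio μσ με r θ‖ := norm_pos_iff.2 (Complex.slitPlane_ne_zero hslit)
  by_contra! hcon
  have := Real.sin_neg_of_neg_of_neg_pi_lt (x := θ + (ratio μσ με r θ).arg) (by linarith)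
    (by linarith [Complex.neg_pi_lt_arg (ratio μσ με r θ), hθ.1])
  nlinarith

/-- For θ ≥ 0 the argument of Ψ is a/2 with a = arg(Φ_σ/Φ_ε) ≤ 0, and a ≥ -θ or, when θ ≥ π/2, a >
-π ≥ -2θ. Hence |θ + a/2| ≤ θ, and the cosine is larger there. Negative θ follow by conjugation. -/
theorem IsModel.norm_Psi_mul_cos_le (h : IsModel μσ με) {r θ : ℝ} (hr : 0 < r)
    (hθ : θ ∈ Icc (-Real.pi) Real.pi) : ‖Psi μσ με r θ‖ * Real.cos θ ≤
      (Complex.exp (θ * Complex.I) * Psi μσ με r θ).re := by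
  wlog h0 : 0 ≤ θ generalizing θ
  · have := this (θ := -θ) ⟨by linarith [hθ.2], by linarith [hθ.1]⟩ (by linarith)
    rw [h.Psi_neg hr hθ, RCLike.norm_conj, Real.cos_neg] at this
    refine this.trans (le_of_eq ?_)
    rw [← Complex.conj_re (Complex.exp (θ * Complex.I) * Psi μσ με r θ), map_mul,
      ← Complex.exp_conj]
    simp
  have hslit := h.ratio_mem_slitPlane hr hθ
  have hne := Complex.slitPlane_ne_zero hslit
  set a := (ratio μσ με r θ).arg with ha
  have hPsi : Psi μσ με r θ =
      (Real.exp (Real.log ‖ratio μσ με r θ‖ / 2) : ℂ) * Complex.exp ((a / 2 : ℝ) * Complex.I) := by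
    rw [Psi, Complex.cpow_def_of_ne_zero hne, Complex.log, Complex.ofReal_exp, ← Complex.exp_add]
    congr 1
    push_cast
    ring
  have hnorm : ‖Psi μσ με r θ‖ = Real.exp (Real.log ‖ratio μσ με r θ‖ / 2) := by
    rw [hPsi, norm_mul, Complex.norm_exp_ofReal_mul_I, mul_one,
      Complex.norm_real, Real.norm_of_nonneg (Real.exp_pos _).le]
  rw [hnorm, hPsi, mul_left_comm, ← Complex.exp_add, Complex.re_ofReal_mul,
    ← add_mul, ← Complex.ofReal_add, Complex.exp_ofReal_mul_I_re]
  gcongr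
  have h1 := h.arg_ratio_nonpos hr ⟨h0, hθ.2⟩
  rw [← Real.cos_abs (θ + a / 2)]
  refine Real.cos_le_cos_of_nonneg_of_le_pi (abs_nonneg _) hθ.2 (abs_le.2 ⟨?_, by linarith⟩)
  rcases le_total θ (Real.pi / 2) with h2 | h2
  · linarith [h.neg_le_arg_ratio hr ⟨h0, h2⟩]
  · linarith [Complex.neg_pi_lt_arg (ratio μσ με r θ), Real.pi_pos]

theorem IsModel.continuousOn_Psi (h : IsModel μσ με) :
    ContinuousOn (fun p : ℝ × ℝ => Psi μσ με p.1 p.2) (Ioi 0 ×ˢ Icc (-Real.pi) Real.pi) := by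
  have hmono : Ioi (0 : ℝ) ×ˢ Icc (-Real.pi) Real.pi ⊆ Ioi 0 ×ˢ univ :=
    prod_mono_right (subset_univ _)
  refine ContinuousOn.cpow ?_ continuousOn_const fun p hp => h.ratio_mem_slitPlane hp.1 hp.2
  exact (continuousOn_Phi.mono hmono).div (continuousOn_Phi.mono hmono)
    fun p hp => h.Phi_ne_zero hp.1 hp.2

/-- `Ψ` as a function on the complex plane. -/
def planePsi (μσ με : Measure unitInterval) (s : ℂ) : ℂ := Psi μσ με ‖s‖ s.arg

theorem IsModel.differentiableOn_planePsi (h : IsModel μσ με) :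
    DifferentiableOn ℂ (planePsi μσ με) Complex.slitPlane := by
  have hΦ : ∀ (μ : Measure unitInterval) [IsFiniteMeasure μ],
      DifferentiableOn ℂ (fun s : ℂ => Phi μ ‖s‖ s.arg) Complex.slitPlane := fun μ _ => by
    refine DifferentiableOn.congr (f := fun s : ℂ => ProbabilityTheory.complexMGF
      (fun α : unitInterval => (α : ℝ)) μ (Complex.log s)) ?_ fun s hs => ?_
    · exact differentiable_complexMGF_coe.comp_differentiableOn
        (differentiableOn_id.clog fun s hs => hs)
    · rw [Phi_eq_complexMGF (norm_pos_iff.2 (Complex.slitPlane_ne_zero hs)), Complex.log]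
  have harg : ∀ s : ℂ, s.arg ∈ Icc (-Real.pi) Real.pi := fun s =>
    ⟨(Complex.neg_pi_lt_arg s).le, Complex.arg_le_pi s⟩
  refine DifferentiableOn.cpow_const ?_ fun s hs =>
    h.ratio_mem_slitPlane (norm_pos_iff.2 (Complex.slitPlane_ne_zero hs)) (harg s)
  exact (hΦ μσ).div (hΦ με) fun s hs =>
    h.Phi_ne_zero (norm_pos_iff.2 (Complex.slitPlane_ne_zero hs)) (harg s)

end Psi

/-! ### Contour integrals -/

section Contour

theorem norm_sq_add_mul_I (a y : ℝ) : ‖(a + y * Complex.I : ℂ)‖ ^ 2 = a ^ 2 + y ^ 2 := by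
  rw [Complex.sq_norm, Complex.normSq_add_mul_I]

theorem abs_le_norm_add_mul_I (a y : ℝ) : |a| ≤ ‖(a + y * Complex.I : ℂ)‖ := by
  simpa using Complex.abs_re_le_norm (a + y * Complex.I : ℂ)

theorem abs_le_norm_add_mul_I' (a y : ℝ) : |y| ≤ ‖(a + y * Complex.I : ℂ)‖ := by
  simpa using Complex.abs_im_le_norm (a + y * Complex.I : ℂ)

theorem integrable_inv_sq_add_sq {a : ℝ} (ha : 0 < a) :
    Integrable fun y : ℝ => (a ^ 2 + y ^ 2)⁻¹ := by
  have := (integrable_inv_one_add_sq.comp_div ha.ne').const_mul (a ^ 2)⁻¹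
  refine this.congr (Eventually.of_forall fun y => ?_)
  simp only
  rw [← mul_inv]
  field_simp

theorem integral_inv_sq_add_sq {a : ℝ} (ha : 0 < a) :
    ∫ y : ℝ, (a ^ 2 + y ^ 2)⁻¹ = Real.pi / a := by
  have h : ∀ y : ℝ, (a ^ 2 + y ^ 2)⁻¹ = (a ^ 2)⁻¹ * (1 + (y / a) ^ 2)⁻¹ := fun y => by
    rw [← mul_inv]
    field_simp
  simp_rw [h]
  rw [integral_const_mul, Measure.integral_comp_div (fun y => (1 + y ^ 2)⁻¹) a,
    integral_univ_inv_one_add_sq, abs_of_pos ha, smul_eq_mul]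
  field_simp

theorem integrable_vertical {f : ℝ → ℂ} (hf : Continuous f) {a C : ℝ} (ha : 0 < a)
    (hbound : ∀ y, ‖f y‖ ≤ C / (a ^ 2 + y ^ 2)) : Integrable f :=
  ((integrable_inv_sq_add_sq ha).const_mul C).mono' hf.aestronglyMeasurable
    (Eventually.of_forall fun y => (hbound y).trans_eq (div_eq_mul_inv _ _))

/-- Integrals over vertical lines in the right half plane agree for integrands with quadratic
decay. -/
theorem integral_vertical_eq {F : ℂ → ℂ} (hF : DifferentiableOn ℂ F {s | 0 < s.re}) {a b C : ℝ}
    (ha : 0 < a) (hab : a ≤ b)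
    (hbound : ∀ s : ℂ, a ≤ s.re → s.re ≤ b → ‖F s‖ ≤ C / ‖s‖ ^ 2) :
    ∫ y : ℝ, F (a + y * Complex.I) = ∫ y : ℝ, F (b + y * Complex.I) := by
  have hb := ha.trans_le hab
  have hcont : ∀ c : ℝ, 0 < c → Continuous fun y : ℝ => F (c + y * Complex.I) := fun c hc =>
    hF.continuousOn.comp_continuous (by fun_prop) fun y => by simpa using hc
  have hint : ∀ c : ℝ, a ≤ c → c ≤ b → Integrable fun y : ℝ => F (c + y * Complex.I) :=
    fun c hc hc' => integrable_vertical (hcont c (ha.trans_le hc)) (ha.trans_le hc) fun y => by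
      rw [← norm_sq_add_mul_I]
      exact hbound _ (by simpa using hc) (by simpa using hc')
  have hC : 0 ≤ C := by
    have h := (norm_nonneg _).trans (hbound a (by simp) (by simpa using hab))
    rw [Complex.norm_real] at h
    by_contra! hneg
    exact h.not_gt (div_neg_of_neg_of_pos hneg (pow_pos (norm_pos_iff.2 ha.ne') 2))
  have hlim : ∀ c : ℝ, a ≤ c → c ≤ b → Tendsto (fun R : ℝ => ∫ y in -R..R, F (c + y * Complex.I))
      atTop (nhds (∫ y : ℝ, F (c + y * Complex.I))) := fun c hc hc' =>
    intervalIntegral_tendsto_integral (hint c hc hc') tendsto_neg_atTop_atBot tendsto_id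
  have hhor : ∀ ε : ℝ, |ε| = 1 → Tendsto
      (fun R : ℝ => ∫ x in a..b, F (x + (ε * R : ℝ) * Complex.I)) atTop (nhds 0) := fun ε hε => by
    have h0 : Tendsto (fun R : ℝ => C / R ^ 2 * |b - a|) atTop (nhds 0) := by
      have := (tendsto_const_nhds (x := C)).div_atTop (tendsto_pow_atTop (α := ℝ) two_ne_zero)
      simpa using this.mul_const |b - a|
    refine squeeze_zero_norm' ?_ h0
    filter_upwards [eventually_gt_atTop 0] with R hR
    refine intervalIntegral.norm_integral_le_of_norm_le_const fun x hx => ?_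
    rw [uIoc_of_le hab] at hx
    refine (hbound _ (by simpa using hx.1.le) (by simpa using hx.2)).trans ?_
    have := abs_le_norm_add_mul_I' x (ε * R)
    rw [abs_mul, hε, one_mul, abs_of_pos hR] at this
    gcongr
  have hrect : ∀ R : ℝ, 0 < R → (∫ x in a..b, F (x + ((-1) * R : ℝ) * Complex.I)) -
      (∫ x in a..b, F (x + (1 * R : ℝ) * Complex.I)) +
      Complex.I * (∫ y in -R..R, F (b + y * Complex.I)) -
      Complex.I * (∫ y in -R..R, F (a + y * Complex.I)) = 0 := fun R hR => by
    have := Complex.integral_boundary_rect_eq_zero_of_differentiableOn F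
      ⟨a, -R⟩ ⟨b, R⟩ (hF.mono fun s hs => by
        rw [Complex.mem_reProdIm, uIcc_of_le hab] at hs
        exact ha.trans_le hs.1.1)
    simpa using this
  have hlim0 := (((hhor (-1) (by simp)).sub (hhor 1 (by simp))).add
    ((hlim b hab le_rfl).const_mul Complex.I)).sub ((hlim a le_rfl hab).const_mul Complex.I)
  have h0 := tendsto_nhds_unique_of_eventuallyEq hlim0 tendsto_const_nhds
    ((eventually_gt_atTop 0).mono hrect)
  rw [sub_zero, zero_add, sub_eq_zero] at h0
  exact (mul_left_cancel₀ Complex.I_ne_zero h0).symm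

/-- The model for functions with an inverse square root singularity at `0` and quadratic decay
at infinity. -/
def rootDecay (r : ℝ) : ℝ := (1 + r ^ (-(1 / 2) : ℝ)) / (1 + r ^ 2)

theorem rootDecay_nonneg {r : ℝ} (hr : 0 ≤ r) : 0 ≤ rootDecay r := by
  rw [rootDecay]; positivity

theorem rootDecay_le_rootDecay {r r' : ℝ} (hr : 0 < r) (hrr' : r ≤ r') :
    rootDecay r' ≤ rootDecay r := by
  have := Real.rpow_le_rpow_of_nonpos hr hrr' (show (-(1 / 2) : ℝ) ≤ 0 by norm_num)
  rw [rootDecay, rootDecay]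
  gcongr

theorem rootDecay_le {r : ℝ} (hr : 1 ≤ r) : rootDecay r ≤ 2 / r ^ 2 := by
  have := Real.rpow_le_one_of_one_le_of_nonpos hr (show (-(1 / 2) : ℝ) ≤ 0 by norm_num)
  rw [rootDecay]
  apply div_le_div₀ (by norm_num) (by linarith) (by positivity) (by linarith)

theorem measurable_rootDecay : Measurable rootDecay := by
  unfold rootDecay
  fun_prop

theorem integrableOn_rootDecay : IntegrableOn rootDecay (Ioi 0) := by
  rw [← Ioc_union_Ioi_eq_Ioi zero_le_one]
  refine IntegrableOn.union ?_ ?_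
  · have h1 : IntegrableOn (fun u : ℝ => 1 + u ^ (-(1 / 2) : ℝ)) (Ioc 0 1) := by
      rw [← intervalIntegrable_iff_integrableOn_Ioc_of_le zero_le_one]
      exact intervalIntegrable_const.add
        (intervalIntegral.intervalIntegrable_rpow' (by norm_num))
    refine h1.mono' measurable_rootDecay.aestronglyMeasurable ?_
    refine (ae_restrict_iff' measurableSet_Ioc).2 (Eventually.of_forall fun u hu => ?_)
    have := hu.1
    rw [Real.norm_of_nonneg (rootDecay_nonneg this.le)]
    exact div_le_self (by positivity) (by nlinarith)
  · refine (integrable_inv_one_add_sq.const_mul 2).integrableOn.mono'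
      measurable_rootDecay.aestronglyMeasurable ?_
    refine (ae_restrict_iff' measurableSet_Ioi).2 (Eventually.of_forall fun u (hu : 1 < u) => ?_)
    have h1 := Real.rpow_le_one_of_one_le_of_nonpos hu.le (show (-(1 / 2) : ℝ) ≤ 0 by norm_num)
    rw [Real.norm_of_nonneg (rootDecay_nonneg (by linarith)), rootDecay, div_eq_mul_inv]
    gcongr
    linarith

theorem integrable_rootDecay_abs : Integrable fun u : ℝ => rootDecay |u| := by
  rw [← integrableOn_univ, ← Iic_union_Ioi (a := (0 : ℝ))]
  refine IntegrableOn.union ?_ ?_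
  · have h := integrableOn_rootDecay
    rw [← neg_zero, ← integrableOn_Ici_iff_integrableOn_Ioi] at h
    refine h.comp_neg_Iic.congr_fun (fun u hu => ?_) measurableSet_Iic
    simp only [abs_of_nonpos (mem_Iic.1 hu)]
  · refine integrableOn_rootDecay.congr_fun (fun u hu => ?_) measurableSet_Ioi
    simp only [abs_of_pos (mem_Ioi.1 hu)]

/-- Cauchy's theorem in the quadrant `Re s < 1`, `Im s > 0`, with boundary values on the real
axis. -/
theorem integral_quadrant_eq_zero {F : ℂ → ℂ} (hF : DifferentiableOn ℂ F {s | 0 < s.im}) {C : ℝ}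
    (hbound : ∀ s : ℂ, 0 < s.im → s.re ≤ 1 → ‖F s‖ ≤ C * rootDecay ‖s‖) {F₀ : ℝ → ℂ}
    (hF₀ : ∀ u : ℝ, u ≠ 0 → Tendsto (fun ρ : ℝ => F (u + ρ * Complex.I)) (nhdsWithin 0 (Ioi 0))
      (nhds (F₀ u))) :
    (∫ u in Iic (1 : ℝ), F₀ u) + Complex.I * ∫ y in Ioi (0 : ℝ), F (1 + y * Complex.I) = 0 := by
  have hC : 0 ≤ C := by
    have h := (norm_nonneg _).trans (hbound Complex.I (by simp) (by simp))
    rw [Complex.norm_I, rootDecay] at h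
    norm_num at h
    exact h
  have hboundu : ∀ u : ℝ, u ≠ 0 → u ≤ 1 → ∀ ρ : ℝ, 0 < ρ →
      ‖F (u + ρ * Complex.I)‖ ≤ C * rootDecay |u| := fun u hu hu1 ρ hρ => by
    refine (hbound _ (by simpa using hρ) (by simpa using hu1)).trans ?_
    gcongr
    exact rootDecay_le_rootDecay (abs_pos.2 hu) (abs_le_norm_add_mul_I u ρ)
  have hboundy : ∀ u : ℝ, u ≤ 1 → ∀ ρ : ℝ, 0 < ρ →
      ‖F (u + ρ * Complex.I)‖ ≤ C * rootDecay ρ := fun u hu1 ρ hρ => by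
    refine (hbound _ (by simpa using hρ) (by simpa using hu1)).trans ?_
    gcongr
    refine rootDecay_le_rootDecay hρ ?_
    simpa [abs_of_pos hρ] using abs_le_norm_add_mul_I' u ρ
  have hcontu : ∀ ρ : ℝ, 0 < ρ → Continuous fun u : ℝ => F (u + ρ * Complex.I) := fun ρ hρ =>
    hF.continuousOn.comp_continuous (by fun_prop) fun u => by simpa using hρ
  have hcontOn : ∀ u : ℝ, ContinuousOn (fun y : ℝ => F (u + y * Complex.I)) (Ioi 0) := fun u =>
    hF.continuousOn.comp (by fun_prop) fun y (hy : 0 < y) => by simpa using hy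
  have hne : ∀ᵐ u : ℝ ∂volume, u ≠ 0 := by simp [ae_iff]
  have hintu : ∀ ρ : ℝ, 0 < ρ → IntegrableOn (fun u : ℝ => F (u + ρ * Complex.I)) (Iic 1) :=
    fun ρ hρ => (integrable_rootDecay_abs.const_mul C).integrableOn.mono'
      (hcontu ρ hρ).aestronglyMeasurable
      ((ae_restrict_iff' measurableSet_Iic).2 (hne.mono fun u hu hu1 => hboundu u hu hu1 ρ hρ))
  have hinty : IntegrableOn (fun y : ℝ => F (1 + y * Complex.I)) (Ioi 0) := by
    have h1 := hcontOn 1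
    simp only [Complex.ofReal_one] at h1
    refine (integrableOn_rootDecay.const_mul C).mono' (h1.aestronglyMeasurable measurableSet_Ioi)
      ((ae_restrict_iff' measurableSet_Ioi).2 (Eventually.of_forall fun y hy => ?_))
    simpa using hboundy 1 le_rfl y hy
  -- At a fixed height ρ the contour is a limit of rectangles: the top and left sides have length at
  -- most 1 + R and an integrand O(R⁻²).
  have step : ∀ ρ : ℝ, 0 < ρ → (∫ u in Iic (1 : ℝ), F (u + ρ * Complex.I)) +
      Complex.I * ∫ y in Ioi ρ, F (1 + y * Complex.I) = 0 := fun ρ hρ => by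
    have hR2 : Tendsto (fun R : ℝ => C * (2 / R ^ 2) * (1 + R)) atTop (nhds 0) := by
      have h1 : Tendsto (fun R : ℝ => C * 2 * ((R⁻¹) ^ 2 + R⁻¹)) atTop (nhds 0) := by
        have := ((tendsto_inv_atTop_zero (𝕜 := ℝ)).pow 2).add tendsto_inv_atTop_zero
        simpa using this.const_mul (C * 2)
      refine h1.congr' ?_
      filter_upwards [eventually_gt_atTop 0] with R hR
      field_simp
    have htop : Tendsto (fun R : ℝ => ∫ u in -R..1, F (u + R * Complex.I)) atTop (nhds 0) := by
      refine squeeze_zero_norm' ?_ hR2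
      filter_upwards [eventually_ge_atTop 1] with R hR
      have h1 : -R ≤ 1 := by linarith
      have : |1 - -R| = 1 + R := by rw [abs_of_nonneg (by linarith)]; ring
      rw [← this]
      refine intervalIntegral.norm_integral_le_of_norm_le_const fun u hu => ?_
      rw [uIoc_of_le h1] at hu
      refine (hboundy u hu.2 R (by linarith)).trans ?_
      gcongr
      exact rootDecay_le hR
    have hleft : Tendsto (fun R : ℝ => ∫ y in ρ..R, F ((-R : ℝ) + y * Complex.I)) atTop
        (nhds 0) := by
      refine squeeze_zero_norm' ?_ hR2
      filter_upwards [eventually_ge_atTop 1, eventually_ge_atTop ρ] with R hR hρR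
      have : |R - ρ| ≤ 1 + R := by rw [abs_of_nonneg (by linarith)]; linarith
      refine (intervalIntegral.norm_integral_le_of_norm_le_const fun y hy => ?_).trans
        (mul_le_mul_of_nonneg_left this (by positivity))
      rw [uIoc_of_le hρR] at hy
      refine (hboundu (-R) (by linarith) (by linarith) y (hρ.trans hy.1)).trans ?_
      rw [abs_neg, abs_of_pos (by linarith)]
      gcongr
      exact rootDecay_le hR
    have hbot : Tendsto (fun R : ℝ => ∫ u in -R..1, F (u + ρ * Complex.I)) atTop
        (nhds (∫ u in Iic (1 : ℝ), F (u + ρ * Complex.I))) :=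
      intervalIntegral_tendsto_integral_Iic 1 (hintu ρ hρ) tendsto_neg_atTop_atBot
    have hright : Tendsto (fun R : ℝ => ∫ y in ρ..R, F (1 + y * Complex.I)) atTop
        (nhds (∫ y in Ioi ρ, F (1 + y * Complex.I))) :=
      intervalIntegral_tendsto_integral_Ioi ρ (hinty.mono_set (Ioi_subset_Ioi hρ.le)) tendsto_id
    have hrect : ∀ R : ℝ, ρ < R → (∫ u in -R..1, F (u + ρ * Complex.I)) -
        (∫ u in -R..1, F (u + R * Complex.I)) +
        Complex.I * (∫ y in ρ..R, F (1 + y * Complex.I)) -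
        Complex.I * (∫ y in ρ..R, F ((-R : ℝ) + y * Complex.I)) = 0 := fun R hR => by
      have := Complex.integral_boundary_rect_eq_zero_of_differentiableOn F
        ⟨-R, ρ⟩ ⟨1, R⟩ (hF.mono fun s hs => by
          rw [Complex.mem_reProdIm, uIcc_of_le hR.le] at hs
          exact hρ.trans_le hs.2.1)
      simpa using this
    have hlim := ((hbot.sub htop).add (hright.const_mul Complex.I)).sub
      (hleft.const_mul Complex.I)
    have h0 := tendsto_nhds_unique_of_eventuallyEq hlim tendsto_const_nhds
      ((eventually_gt_atTop ρ).mono hrect)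
    simpa using h0
  -- Lowering the contour to the real axis is justified by domination: the singularity |u|^{-1/2} at
  -- the origin is integrable.
  have hlimu : Tendsto (fun ρ : ℝ => ∫ u in Iic (1 : ℝ), F (u + ρ * Complex.I))
      (nhdsWithin 0 (Ioi 0)) (nhds (∫ u in Iic (1 : ℝ), F₀ u)) := by
    refine tendsto_integral_filter_of_dominated_convergence (fun u => C * rootDecay |u|) ?_ ?_
      (integrable_rootDecay_abs.const_mul C).integrableOn ?_
    · filter_upwards [self_mem_nhdsWithin] with ρ hρ
      exact (hcontu ρ hρ).aestronglyMeasurable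
    · filter_upwards [self_mem_nhdsWithin] with ρ hρ
      exact (ae_restrict_iff' measurableSet_Iic).2
        (hne.mono fun u hu hu1 => hboundu u hu hu1 ρ hρ)
    · exact ae_restrict_of_ae (hne.mono fun u hu => hF₀ u hu)
  have hlimy : Tendsto (fun ρ : ℝ => ∫ y in Ioi ρ, F (1 + y * Complex.I))
      (nhdsWithin 0 (Ioi 0)) (nhds (∫ y in Ioi (0 : ℝ), F (1 + y * Complex.I))) := by
    have hc : Tendsto (fun ρ : ℝ => ∫ y in (0 : ℝ)..ρ, F (1 + y * Complex.I))
        (nhdsWithin 0 (Ioi 0)) (nhds 0) := by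
      have := intervalIntegral.continuousWithinAt_primitive (a := 0) (b₀ := 0) (b₁ := 0) (b₂ := 1)
        (μ := volume) (f := fun y : ℝ => F (1 + y * Complex.I)) (by simp) (by
          simp only [min_self, zero_le_one, max_eq_right]
          rw [intervalIntegrable_iff_integrableOn_Ioc_of_le zero_le_one]
          exact hinty.mono_set Ioc_subset_Ioi_self)
      have h2 := this.tendsto
      simp only [intervalIntegral.integral_same] at h2
      exact h2.mono_left (nhdsWithin_le_of_mem (mem_of_superset
        (Ioc_mem_nhdsGT zero_lt_one) Ioc_subset_Icc_self))
    have h3 := (tendsto_const_nhds (x := ∫ y in Ioi (0 : ℝ), F (1 + y * Complex.I))).sub hc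
    rw [sub_zero] at h3
    refine h3.congr' ?_
    filter_upwards [self_mem_nhdsWithin] with ρ (hρ : 0 < ρ)
    rw [intervalIntegral.integral_of_le hρ.le, ← Ioc_union_Ioi_eq_Ioi hρ.le,
      setIntegral_union (Ioc_disjoint_Ioi le_rfl) measurableSet_Ioi
        (hinty.mono_set Ioc_subset_Ioi_self) (hinty.mono_set (Ioi_subset_Ioi hρ.le))]
    ring
  exact tendsto_nhds_unique_of_eventuallyEq (hlimu.add (hlimy.const_mul Complex.I))
    tendsto_const_nhds (eventually_nhdsWithin_of_forall step)

end Contour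

/-! ### The second primitive of the kernel -/

section WaveSymbol

variable {μσ με : Measure unitInterval} [IsFiniteMeasure μσ] [IsFiniteMeasure με]

theorem arg_mem_Icc (s : ℂ) : s.arg ∈ Icc (-Real.pi) Real.pi :=
  ⟨(Complex.neg_pi_lt_arg s).le, Complex.arg_le_pi s⟩

/-- The Laplace transform `Ψ(s) / 2 * exp (-|x| s Ψ(s))` of the kernel `K`. -/
def waveSymbol (μσ με : Measure unitInterval) (x : ℝ) (s : ℂ) : ℂ :=
  planePsi μσ με s / 2 * Complex.exp (-(|x| : ℝ) * s * planePsi μσ με s)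

omit [IsFiniteMeasure μσ] [IsFiniteMeasure με] in
theorem STilde_eq (x : ℝ) (s : ℂ) : STilde μσ με x s = waveSymbol μσ με x s / s := by
  rw [STilde, waveSymbol, planePsi, div_mul_eq_div_div, div_mul_eq_mul_div]

theorem IsModel.differentiableOn_waveSymbol (h : IsModel μσ με) (x : ℝ) :
    DifferentiableOn ℂ (waveSymbol μσ με x) Complex.slitPlane := by
  have := h.differentiableOn_planePsi
  unfold waveSymbol
  fun_prop

/-- The inequality for Re(e^{iθ} Ψ) is multiplied by |x| r. The exponent is Re s times t - |x||Ψ|: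
outside the cone the factors favour Re s > 0, and inside the cone they favour Re s < 0. Both halves
of the theorem come from this. -/
theorem IsModel.norm_exp_le (h : IsModel μσ με) {r θ : ℝ} (hr : 0 < r)
    (hθ : θ ∈ Icc (-Real.pi) Real.pi) (x t : ℝ) :
    ‖Complex.exp (-(|x| : ℝ) * (r * Complex.exp (θ * Complex.I)) * Psi μσ με r θ +
      r * Complex.exp (θ * Complex.I) * t)‖ ≤
      Real.exp (r * Real.cos θ * (t - |x| * ‖Psi μσ με r θ‖)) := by
  have h1 := h.norm_Psi_mul_cos_le hr hθ
  have e : -((|x| : ℝ) : ℂ) * (r * Complex.exp (θ * Complex.I)) * Psi μσ με r θ +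
      r * Complex.exp (θ * Complex.I) * t = ((-(|x| * r) : ℝ) : ℂ) *
        (Complex.exp (θ * Complex.I) * Psi μσ με r θ) + ((r * t : ℝ) : ℂ) *
        Complex.exp (θ * Complex.I) := by
    push_cast; ring
  rw [Complex.norm_exp, Real.exp_le_exp, e, Complex.add_re, Complex.re_ofReal_mul,
    Complex.re_ofReal_mul, Complex.exp_ofReal_mul_I_re]
  have := mul_le_mul_of_nonneg_left h1 (mul_nonneg (abs_nonneg x) hr.le)
  linarith

theorem IsModel.norm_exp_le_plane (h : IsModel μσ με) {s : ℂ} (hs : s ≠ 0) (x t : ℝ) :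
    ‖Complex.exp (-(|x| : ℝ) * s * planePsi μσ με s + s * t)‖ ≤
      Real.exp (s.re * (t - |x| * ‖planePsi μσ με s‖)) := by
  have := h.norm_exp_le (norm_pos_iff.2 hs) (arg_mem_Icc s) x t
  rwa [Complex.norm_mul_exp_arg_mul_I, Complex.norm_mul_cos_arg] at this

theorem IsModel.exists_norm_waveSymbol_le (h : IsModel μσ με) : ∃ C > 0, ∀ (x : ℝ) (s : ℂ),
    0 < s.re → ‖waveSymbol μσ με x s‖ ≤ C * (1 + ‖s‖ ^ (-(1 / 2) : ℝ)) := by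
  obtain ⟨C, hC, hΨ⟩ := h.exists_norm_Psi_le
  refine ⟨C, hC, fun x s hs => ?_⟩
  have hs0 : s ≠ 0 := fun h0 => by simp [h0] at hs
  have h1 := h.norm_exp_le_plane hs0 x 0
  have h2 : Real.exp (s.re * (0 - |x| * ‖planePsi μσ με s‖)) ≤ 1 := by
    rw [Real.exp_le_one_iff, zero_sub]
    exact mul_nonpos_of_nonneg_of_nonpos hs.le (neg_nonpos.2 (by positivity))
  simp only [Complex.ofReal_zero, mul_zero, add_zero] at h1
  have h3 := hΨ _ (norm_pos_iff.2 hs0) _ (arg_mem_Icc s)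
  change ‖planePsi μσ με s‖ ≤ _ at h3
  rw [waveSymbol, norm_mul, norm_div, Complex.norm_two]
  calc ‖planePsi μσ με s‖ / 2 * _ ≤ ‖planePsi μσ με s‖ / 2 * 1 := by
        gcongr; exact h1.trans h2
    _ ≤ _ := by linarith [norm_nonneg (planePsi μσ με s)]

theorem slitPlane_of_re_pos {s : ℂ} (hs : 0 < s.re) : s ∈ Complex.slitPlane := Or.inl hs

theorem IsModel.continuous_waveSymbol_vertical (h : IsModel μσ με) {a : ℝ} (ha : 0 < a) :
    Continuous fun p : ℝ × ℝ => waveSymbol μσ με p.1 (a + p.2 * Complex.I) := by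
  have h1 : Continuous fun p : ℝ × ℝ => planePsi μσ με (a + p.2 * Complex.I) :=
    h.differentiableOn_planePsi.continuousOn.comp_continuous (by fun_prop) fun p =>
      slitPlane_of_re_pos (by simpa using ha)
  unfold waveSymbol
  fun_prop

theorem add_mul_I_ne_zero {a : ℝ} (ha : 0 < a) (y : ℝ) : (a + y * Complex.I : ℂ) ≠ 0 := fun h => by
  have := congrArg Complex.re h
  simp [ha.ne'] at this

/-- The Laplace inversion integral of `waveSymbol / s ^ 2` along the line `Re s = a`. -/
def lineIntegral (μσ με : Measure unitInterval) (a x t : ℝ) : ℂ :=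
  1 / (2 * Real.pi) * ∫ y : ℝ, waveSymbol μσ με x (a + y * Complex.I) /
    (a + y * Complex.I) ^ 2 * Complex.exp ((a + y * Complex.I) * t)

/-- The second primitive in `t` of the kernel `K`, which is the first primitive of the fundamental
solution. -/
def wavePrimitive (μσ με : Measure unitInterval) (p : ℝ × ℝ) : ℂ := lineIntegral μσ με 1 p.1 p.2

/-! ### Vanishing, growth and continuity of the inversion integral -/

theorem norm_exp_vertical (a y t : ℝ) :
    ‖Complex.exp ((a + y * Complex.I) * t)‖ = Real.exp (a * t) := by
  rw [Complex.norm_exp]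
  simp

theorem IsModel.exists_norm_vertical_le (h : IsModel μσ με) : ∃ C > 0, ∀ a : ℝ, 0 < a →
    ∀ (x : ℝ) (s : ℂ), a ≤ s.re → ‖waveSymbol μσ με x s / s ^ 2‖ ≤
      C * (1 + a ^ (-(1 / 2) : ℝ)) / ‖s‖ ^ 2 := by
  obtain ⟨C, hC, hW⟩ := h.exists_norm_waveSymbol_le
  refine ⟨C, hC, fun a ha x s hs => ?_⟩
  rw [norm_div, norm_pow]
  gcongr
  refine (hW x s (ha.trans_le hs)).trans ?_
  have := Real.rpow_le_rpow_of_nonpos ha (hs.trans (Complex.re_le_norm s))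
    (by norm_num : (-(1 / 2) : ℝ) ≤ 0)
  gcongr

theorem IsModel.continuous_vertical (h : IsModel μσ με) {a : ℝ} (ha : 0 < a) :
    Continuous fun p : ℝ × ℝ => waveSymbol μσ με p.1 (a + p.2 * Complex.I) /
      (a + p.2 * Complex.I) ^ 2 :=
  (h.continuous_waveSymbol_vertical ha).div (by fun_prop)
    fun p => pow_ne_zero 2 (add_mul_I_ne_zero ha p.2)

theorem IsModel.integrable_waveSymbol_div (h : IsModel μσ με) {a : ℝ} (ha : 0 < a) (x : ℝ) :
    Integrable fun y : ℝ => waveSymbol μσ με x (a + y * Complex.I) / (a + y * Complex.I) ^ 2 := by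
  obtain ⟨C, hC, hb⟩ := h.exists_norm_vertical_le
  have hc : Continuous fun y : ℝ => waveSymbol μσ με x (a + y * Complex.I) /
      (a + y * Complex.I) ^ 2 := by
    have := (h.continuous_vertical ha).comp (f := fun y : ℝ => (x, y)) (by fun_prop)
    simpa only [Function.comp_def] using this
  have hbound : ∀ y : ℝ, ‖waveSymbol μσ με x (a + y * Complex.I) / (a + y * Complex.I) ^ 2‖ ≤
      C * (1 + a ^ (-(1 / 2) : ℝ)) / (a ^ 2 + y ^ 2) := fun y => by
    rw [← norm_sq_add_mul_I]
    exact hb a ha x _ (by simp)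
  exact integrable_vertical hc ha hbound

theorem IsModel.lineIntegral_eq (h : IsModel μσ με) {a b : ℝ} (ha : 0 < a) (hab : a ≤ b)
    (x t : ℝ) : lineIntegral μσ με a x t = lineIntegral μσ με b x t := by
  obtain ⟨C, hC, hb⟩ := h.exists_norm_vertical_le
  rw [lineIntegral, lineIntegral, integral_vertical_eq (F := fun s => waveSymbol μσ με x s / s ^ 2 *
    Complex.exp (s * t)) (C := C * (1 + a ^ (-(1 / 2) : ℝ)) * Real.exp (b * |t|)) ?_ ha hab ?_]
  · refine DifferentiableOn.mul (DifferentiableOn.div ?_ (by fun_prop) fun s hs => ?_) (by fun_prop)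
    · exact (h.differentiableOn_waveSymbol x).mono fun s hs => slitPlane_of_re_pos hs
    · refine pow_ne_zero 2 fun h0 => ?_
      rw [h0] at hs
      simp at hs
  · intro s hs hs'
    rw [norm_mul, mul_div_right_comm]
    gcongr
    · exact hb a ha x s hs
    · rw [Complex.norm_exp]
      gcongr
      rw [Complex.re_mul_ofReal]
      exact (mul_le_mul_of_nonneg_left (le_abs_self t) (ha.le.trans hs)).trans
        (mul_le_mul_of_nonneg_right hs' (abs_nonneg t))

theorem IsModel.wavePrimitive_eq (h : IsModel μσ με) {a : ℝ} (ha : 0 < a) (p : ℝ × ℝ) :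
    wavePrimitive μσ με p = lineIntegral μσ με a p.1 p.2 := by
  rcases le_total a 1 with h1 | h1
  · exact (h.lineIntegral_eq ha h1 _ _).symm
  · exact h.lineIntegral_eq one_pos h1 _ _

omit [IsFiniteMeasure μσ] [IsFiniteMeasure με] in
-- The denominator s² contributes the integral of 1/(a² + y²), which is π/a. This gain of 1/a makes
-- the integral vanish as the line moves to infinity.
theorem norm_lineIntegral_le {a x t B : ℝ} (ha : 0 < a)
    (hB : ∀ y : ℝ, ‖waveSymbol μσ με x (a + y * Complex.I) *
      Complex.exp ((a + y * Complex.I) * t)‖ ≤ B) :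
    ‖lineIntegral μσ με a x t‖ ≤ B / a := by
  have h1 : ‖∫ y : ℝ, waveSymbol μσ με x (a + y * Complex.I) /
      (a + y * Complex.I) ^ 2 * Complex.exp ((a + y * Complex.I) * t)‖ ≤ B * (Real.pi / a) := by
    rw [← integral_inv_sq_add_sq ha, ← integral_const_mul]
    refine norm_integral_le_of_norm_le ((integrable_inv_sq_add_sq ha).const_mul B)
      (Eventually.of_forall fun y => ?_)
    rw [div_mul_eq_mul_div, norm_div, norm_pow, norm_sq_add_mul_I, div_eq_mul_inv]
    gcongr
    exact hB y
  have hB0 : 0 ≤ B := (norm_nonneg _).trans (hB 0)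
  have h2 : ‖(1 / (2 * Real.pi) : ℂ)‖ = 1 / (2 * Real.pi) := by
    have : (1 / (2 * Real.pi) : ℂ) = ((1 / (2 * Real.pi) : ℝ) : ℂ) := by push_cast; rfl
    rw [this, Complex.norm_real, Real.norm_of_nonneg (by positivity)]
  rw [lineIntegral, norm_mul, h2]
  calc _ ≤ 1 / (2 * Real.pi) * (B * (Real.pi / a)) := by gcongr
    _ = B / a / 2 := by field_simp
    _ ≤ B / a := half_le_self (by positivity)

/-- The value does not depend on the line Re s = a. Once a is so large that |x||Ψ| ≥ t on the whole
line, the integrand without 1/s² is bounded uniformly in a, and a → ∞ finishes. -/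
theorem IsModel.wavePrimitive_eq_zero (h : IsModel μσ με) {k : ℝ}
    (hk : TendstoUniformlyOn (Psi μσ με) (fun _ => (k : ℂ)) atTop (Icc (-Real.pi) Real.pi))
    (hk0 : 0 ≤ k) {p : ℝ × ℝ} (hp : p.2 < k * |p.1|) : wavePrimitive μσ με p = 0 := by
  obtain ⟨C, hC, hΨ⟩ := h.exists_norm_Psi_le
  have hev : ∀ᶠ r : ℝ in atTop, ∀ θ ∈ Icc (-Real.pi) Real.pi, p.2 ≤ |p.1| * ‖Psi μσ με r θ‖ := by
    -- The tolerance used for x ≠ 0 divides by |x|. On the axis the hypothesis simply says t < 0.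
    rcases (abs_nonneg p.1).eq_or_lt with h0 | h0
    · refine Eventually.of_forall fun r θ _ => ?_
      rw [← h0] at hp ⊢
      linarith
    · rw [Metric.tendstoUniformlyOn_iff] at hk
      filter_upwards [hk ((k * |p.1| - p.2) / |p.1|) (div_pos (sub_pos.2 hp) h0)] with r hr θ hθ
      have h1 := hr θ hθ
      rw [dist_eq_norm, lt_div_iff₀ h0] at h1
      have h2 := norm_sub_norm_le (k : ℂ) (Psi μσ με r θ)
      rw [Complex.norm_real, Real.norm_of_nonneg hk0] at h2
      nlinarith
  obtain ⟨R, hR⟩ := eventually_atTop.1 hev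
  have hlim : Tendsto (fun a : ℝ => C * 2 / a) atTop (nhds 0) :=
    tendsto_const_nhds.div_atTop tendsto_id
  refine norm_eq_zero.1 (le_antisymm (ge_of_tendsto hlim ?_) (norm_nonneg _))
  filter_upwards [eventually_ge_atTop (max R 1)] with a ha
  have ha1 : 1 ≤ a := (le_max_right _ _).trans ha
  have ha0 : 0 < a := by linarith
  rw [h.wavePrimitive_eq ha0]
  refine norm_lineIntegral_le ha0 fun y => ?_
  set s : ℂ := a + y * Complex.I with hs
  have hre : s.re = a := by simp [hs]
  have hsa : a ≤ ‖s‖ := hre ▸ Complex.re_le_norm s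
  have hs0 : s ≠ 0 := add_mul_I_ne_zero ha0 y
  have h1 : ‖planePsi μσ με s‖ ≤ C * 2 := by
    refine (hΨ _ (norm_pos_iff.2 hs0) _ (arg_mem_Icc s)).trans ?_
    have := Real.rpow_le_one_of_one_le_of_nonpos (ha1.trans hsa)
      (show (-(1 / 2) : ℝ) ≤ 0 by norm_num)
    gcongr
    linarith
  have h2 : p.2 ≤ |p.1| * ‖planePsi μσ με s‖ :=
    hR ‖s‖ (((le_max_left _ _).trans ha).trans hsa) _ (arg_mem_Icc s)
  rw [waveSymbol, mul_assoc, ← Complex.exp_add, norm_mul, norm_div, Complex.norm_two]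
  have h3 := h.norm_exp_le_plane hs0 p.1 p.2
  have h4 : Real.exp (s.re * (p.2 - |p.1| * ‖planePsi μσ με s‖)) ≤ 1 := by
    rw [Real.exp_le_one_iff, hre]
    exact mul_nonpos_of_nonneg_of_nonpos ha0.le (by linarith)
  calc _ ≤ ‖planePsi μσ με s‖ / 2 * 1 := by gcongr; exact h3.trans h4
    _ ≤ C * 2 := by linarith [norm_nonneg (planePsi μσ με s)]

/-- On the line Re s = a ≤ 1 the bound is of order e^{at}/a². The choice a = 1/(1 + t) keeps the
exponential below e and leaves (1 + t)², which is what makes the distribution tempered. -/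
theorem IsModel.exists_norm_wavePrimitive_le (h : IsModel μσ με) {k : ℝ}
    (hk : TendstoUniformlyOn (Psi μσ με) (fun _ => (k : ℂ)) atTop (Icc (-Real.pi) Real.pi))
    (hk0 : 0 ≤ k) : ∃ C > 0, ∀ p : ℝ × ℝ, ‖wavePrimitive μσ με p‖ ≤ C * (1 + |p.2|) ^ 2 := by
  obtain ⟨C, hC, hW⟩ := h.exists_norm_waveSymbol_le
  have hline : ∀ a : ℝ, 0 < a → a ≤ 1 → ∀ p : ℝ × ℝ, ‖wavePrimitive μσ με p‖ ≤
      C * (2 * a⁻¹) * Real.exp (a * p.2) / a := fun a ha ha1 p => by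
    rw [h.wavePrimitive_eq ha]
    refine norm_lineIntegral_le ha fun y => ?_
    rw [norm_mul, norm_exp_vertical]
    gcongr
    refine (hW _ _ (by simpa using ha)).trans ?_
    gcongr
    have h1 : ‖(a + y * Complex.I : ℂ)‖ ^ (-(1 / 2) : ℝ) ≤ a ^ (-(1 / 2) : ℝ) :=
      Real.rpow_le_rpow_of_nonpos ha (by simpa [abs_of_pos ha] using abs_le_norm_add_mul_I a y)
        (by norm_num)
    have h2 : a ^ (-(1 / 2) : ℝ) ≤ a ^ (-1 : ℝ) :=
      Real.rpow_le_rpow_of_exponent_ge ha ha1 (by norm_num)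
    rw [Real.rpow_neg_one] at h2
    have h3 : 1 ≤ a⁻¹ := (one_le_inv₀ ha).2 ha1
    linarith
  refine ⟨C * 2 * Real.exp 1, by positivity, fun p => ?_⟩
  rcases le_total p.2 0 with hp | hp
  · rcases hp.lt_or_eq with hp | hp
    · rw [h.wavePrimitive_eq_zero hk hk0 (hp.trans_le (by positivity)), norm_zero]
      positivity
    · refine (hline 1 one_pos le_rfl p).trans ?_
      have := Real.one_le_exp (zero_le_one)
      simp only [hp, mul_zero, Real.exp_zero, abs_zero]
      nlinarith
  · have ha : 0 < (1 + p.2)⁻¹ := by positivity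
    refine (hline (1 + p.2)⁻¹ ha (inv_le_one_of_one_le₀ (by linarith)) p).trans ?_
    have h1 : (1 + p.2)⁻¹ * p.2 ≤ 1 := by
      rw [inv_mul_le_iff₀ (by positivity)]; linarith
    rw [inv_inv, div_inv_eq_mul, abs_of_nonneg hp]
    calc C * (2 * (1 + p.2)) * Real.exp ((1 + p.2)⁻¹ * p.2) * (1 + p.2)
        ≤ C * (2 * (1 + p.2)) * Real.exp 1 * (1 + p.2) := by gcongr
      _ = _ := by ring

theorem IsModel.continuous_wavePrimitive (h : IsModel μσ με) :
    Continuous (wavePrimitive μσ με) := by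
  obtain ⟨C, hC, hb⟩ := h.exists_norm_vertical_le
  have hcont := h.continuous_vertical one_pos
  -- Splitting off e^t leaves an oscillating factor of modulus 1, so one integrable bound works for
  -- all (x, t).
  have e : wavePrimitive μσ με = fun p : ℝ × ℝ => 1 / (2 * Real.pi) * (Complex.exp p.2 *
      ∫ y : ℝ, waveSymbol μσ με p.1 ((1 : ℝ) + y * Complex.I) / ((1 : ℝ) + y * Complex.I) ^ 2 *
        Complex.exp (y * Complex.I * p.2)) := by
    ext p
    rw [wavePrimitive, lineIntegral, ← integral_const_mul (Complex.exp p.2)]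
    congr 2 with y
    rw [mul_left_comm, ← Complex.exp_add]
    congr 2
    push_cast
    ring
  rw [e]
  refine continuous_const.mul ((by fun_prop : Continuous fun p : ℝ × ℝ =>
    Complex.exp (p.2 : ℂ)).mul ?_)
  refine continuous_of_dominated (bound := fun y => C * (1 + 1 ^ (-(1 / 2) : ℝ)) *
    ((1 : ℝ) ^ 2 + y ^ 2)⁻¹) (fun p => ?_) (fun p => Eventually.of_forall fun y => ?_)
    ((integrable_inv_sq_add_sq one_pos).const_mul _) (Eventually.of_forall fun y => ?_)
  · have h1 := hcont.comp (by fun_prop : Continuous fun y : ℝ => (p.1, y))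
    exact (h1.mul (by fun_prop)).aestronglyMeasurable
  · have h2 : ‖Complex.exp (y * Complex.I * p.2)‖ = 1 := by
      rw [mul_right_comm, ← Complex.ofReal_mul, Complex.norm_exp_ofReal_mul_I]
    rw [norm_mul, h2, mul_one, ← div_eq_mul_inv, ← norm_sq_add_mul_I]
    exact hb 1 one_pos _ _ (by simp)
  · have h1 := hcont.comp (by fun_prop : Continuous fun p : ℝ × ℝ => (p.1, y))
    exact h1.mul (by fun_prop)

end WaveSymbol

/-! ### Schwartz functions on the plane -/

section Schwartz

/-! ### Slices of Schwartz functions -/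

theorem exists_slice_bound (ψ : 𝓢(ℝ × ℝ, ℂ)) :
    ∃ C, 0 ≤ C ∧ ∀ x t : ℝ, ‖ψ (x, t)‖ ≤ C * (1 + t ^ 2)⁻¹ := by
  obtain ⟨C, hC⟩ : ∃ C, ∀ p : ℝ × ℝ, (1 + ‖p‖) ^ 2 * ‖ψ p‖ ≤ C := by
    refine ⟨2 ^ 2 * ((Finset.Iic ((2, 0) : ℕ × ℕ)).sup
      fun m => SchwartzMap.seminorm ℂ m.1 m.2) ψ, fun p => ?_⟩
    have := SchwartzMap.one_add_le_sup_seminorm_apply (𝕜 := ℂ) (m := (2, 0)) (k := 2) (n := 0)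
      le_rfl le_rfl ψ p
    rwa [norm_iteratedFDeriv_zero] at this
  refine ⟨C, le_trans (by positivity) (hC 0), fun x t => ?_⟩
  rw [← div_eq_mul_inv, le_div_iff₀ (by positivity), mul_comm]
  refine le_trans ?_ (hC (x, t))
  gcongr
  have h1 : |t| ≤ ‖((x, t) : ℝ × ℝ)‖ := norm_snd_le (x, t)
  nlinarith [abs_nonneg t, sq_abs t, norm_nonneg ((x, t) : ℝ × ℝ)]

/-- The restriction of a Schwartz function on the plane to the line `{x} × ℝ`. -/
def schwartzSlice (x : ℝ) : 𝓢(ℝ × ℝ, ℂ) →L[ℂ] 𝓢(ℝ, ℂ) :=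
  SchwartzMap.compCLMOfAntilipschitz ℂ (K := 1) (g := fun t : ℝ => (x, t))
    (by
      have h1 := (ContinuousLinearMap.inr ℝ ℝ ℝ).hasTemperateGrowth.add
        (Function.HasTemperateGrowth.const ((x, 0) : ℝ × ℝ))
      convert h1 using 2 with t
      ext <;> simp)
    (AntilipschitzWith.of_le_mul_dist fun t t' => by simp [Prod.dist_eq])

@[simp]
theorem schwartzSlice_apply (x : ℝ) (ψ : 𝓢(ℝ × ℝ, ℂ)) (t : ℝ) :
    schwartzSlice x ψ t = ψ (x, t) := rfl

/-! #### Partial Fourier transforms -/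

/-- The partial Fourier transform in the second variable. -/
def partialFourier (ψ : 𝓢(ℝ × ℝ, ℂ)) (p : ℝ × ℝ) : ℂ :=
  ∫ t : ℝ, ψ (p.1, t) * Complex.exp (Complex.I * p.2 * t)

theorem norm_exp_I_mul_mul (y t : ℝ) : ‖Complex.exp (Complex.I * y * t)‖ = 1 := by
  rw [mul_assoc, ← Complex.ofReal_mul, Complex.norm_exp_I_mul_ofReal]

theorem integrable_slice_mul_exp (ψ : 𝓢(ℝ × ℝ, ℂ)) (p : ℝ × ℝ) :
    Integrable fun t : ℝ => ψ (p.1, t) * Complex.exp (Complex.I * p.2 * t) := by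
  refine (schwartzSlice p.1 ψ).integrable.norm.mono' (by fun_prop)
    (Eventually.of_forall fun t => ?_)
  rw [norm_mul, norm_exp_I_mul_mul, mul_one, schwartzSlice_apply]

theorem exists_norm_partialFourier_le (ψ : 𝓢(ℝ × ℝ, ℂ)) : ∃ C, ∀ p, ‖partialFourier ψ p‖ ≤ C := by
  obtain ⟨C, hC, h⟩ := exists_slice_bound ψ
  refine ⟨∫ t : ℝ, C * (1 + t ^ 2)⁻¹, fun p => norm_integral_le_of_norm_le
    (integrable_inv_one_add_sq.const_mul C) (Eventually.of_forall fun t => ?_)⟩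
  rw [norm_mul, norm_exp_I_mul_mul, mul_one]
  exact h _ _

theorem hasTemperateGrowth_fst :
    Function.HasTemperateGrowth fun p : ℝ × ℝ => (p.1 : ℂ) :=
  (Complex.ofRealCLM ∘L ContinuousLinearMap.fst ℝ ℝ ℝ).hasTemperateGrowth

theorem hasTemperateGrowth_snd :
    Function.HasTemperateGrowth fun p : ℝ × ℝ => (p.2 : ℂ) :=
  (Complex.ofRealCLM ∘L ContinuousLinearMap.snd ℝ ℝ ℝ).hasTemperateGrowth

/-- Multiplication of Schwartz functions by the first coordinate. -/
def mulFst : 𝓢(ℝ × ℝ, ℂ) →L[ℂ] 𝓢(ℝ × ℝ, ℂ) :=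
  SchwartzMap.smulLeftCLM ℂ fun p : ℝ × ℝ => (p.1 : ℂ)

/-- Multiplication of Schwartz functions by the second coordinate. -/
def mulSnd : 𝓢(ℝ × ℝ, ℂ) →L[ℂ] 𝓢(ℝ × ℝ, ℂ) :=
  SchwartzMap.smulLeftCLM ℂ fun p : ℝ × ℝ => (p.2 : ℂ)

theorem mulFst_apply (ψ : 𝓢(ℝ × ℝ, ℂ)) (p : ℝ × ℝ) : mulFst ψ p = p.1 * ψ p :=
  SchwartzMap.smulLeftCLM_apply_apply hasTemperateGrowth_fst ψ p

theorem mulSnd_apply (ψ : 𝓢(ℝ × ℝ, ℂ)) (p : ℝ × ℝ) : mulSnd ψ p = p.2 * ψ p :=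
  SchwartzMap.smulLeftCLM_apply_apply hasTemperateGrowth_snd ψ p

theorem hasDerivAt_snd (ψ : 𝓢(ℝ × ℝ, ℂ)) (x t : ℝ) :
    HasDerivAt (fun t => ψ (x, t)) (∂_{((0, 1) : ℝ × ℝ)} ψ (x, t)) t := by
  rw [SchwartzMap.lineDerivOp_apply_eq_fderiv]
  exact (ψ.hasFDerivAt (x, t)).comp_hasDerivAt t ((hasDerivAt_const t x).prodMk (hasDerivAt_id t))

theorem fst_mul_partialFourier (ψ : 𝓢(ℝ × ℝ, ℂ)) (p : ℝ × ℝ) :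
    p.1 * partialFourier ψ p = partialFourier (mulFst ψ) p := by
  rw [partialFourier, partialFourier, ← integral_const_mul]
  congr 1 with t
  simp only [mulFst_apply]
  ring

theorem snd_mul_partialFourier (ψ : 𝓢(ℝ × ℝ, ℂ)) (p : ℝ × ℝ) :
    p.2 * partialFourier ψ p = Complex.I * partialFourier (∂_{((0, 1) : ℝ × ℝ)} ψ) p := by
  have hexp : ∀ t : ℝ, HasDerivAt (fun t : ℝ => Complex.exp (Complex.I * p.2 * t))
      (Complex.exp (Complex.I * p.2 * t) * (Complex.I * p.2)) t := fun t => by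
    have h1 := (((hasDerivAt_id (t : ℂ)).const_mul (Complex.I * p.2)).cexp).comp_ofReal
    simpa using h1
  have h := integral_mul_deriv_eq_deriv_mul_of_integrable (fun t _ => hasDerivAt_snd ψ p.1 t)
    (fun t _ => hexp t) ?_ (integrable_slice_mul_exp _ p) (integrable_slice_mul_exp _ p)
  · rw [partialFourier, partialFourier, ← neg_eq_iff_eq_neg.2 h, ← integral_neg,
      ← integral_const_mul, ← integral_const_mul]
    congr 1 with t
    linear_combination (p.2 * ψ (p.1, t) * Complex.exp (Complex.I * p.2 * t)) * Complex.I_sq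
  · refine ((integrable_slice_mul_exp ψ p).mul_const (Complex.I * p.2)).congr
      (Eventually.of_forall fun t => ?_)
    simp only [Pi.mul_apply]
    ring

/-- The derivative is again built from partial Fourier transforms of Schwartz functions, so
smoothness and decay of all derivatives follow by induction over all ψ at once. -/
theorem hasFDerivAt_partialFourier (ψ : 𝓢(ℝ × ℝ, ℂ)) (p : ℝ × ℝ) :
    HasFDerivAt (partialFourier ψ)
      (ContinuousLinearMap.smulRightL ℝ (ℝ × ℝ) ℂ (ContinuousLinearMap.fst ℝ ℝ ℝ)
          (partialFourier (∂_{((1, 0) : ℝ × ℝ)} ψ) p) +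
        ContinuousLinearMap.smulRightL ℝ (ℝ × ℝ) ℂ (ContinuousLinearMap.snd ℝ ℝ ℝ)
          (partialFourier (Complex.I • mulSnd ψ) p)) p := by
  set L₁ := ContinuousLinearMap.smulRightL ℝ (ℝ × ℝ) ℂ (ContinuousLinearMap.fst ℝ ℝ ℝ)
  set L₂ := ContinuousLinearMap.smulRightL ℝ (ℝ × ℝ) ℂ (ContinuousLinearMap.snd ℝ ℝ ℝ)
  set ψ₁ := ∂_{((1, 0) : ℝ × ℝ)} ψ with hψ₁
  set ψ₂ := Complex.I • mulSnd ψ with hψ₂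
  obtain ⟨C₁, hC₁, h₁⟩ := exists_slice_bound ψ₁
  obtain ⟨C₂, hC₂, h₂⟩ := exists_slice_bound ψ₂
  have hi₁ := integrable_slice_mul_exp ψ₁ p
  have hi₂ := integrable_slice_mul_exp ψ₂ p
  have hF' : Integrable fun t : ℝ => L₁ (ψ₁ (p.1, t) * Complex.exp (Complex.I * p.2 * t)) +
      L₂ (ψ₂ (p.1, t) * Complex.exp (Complex.I * p.2 * t)) :=
    (L₁.integrable_comp hi₁).add (L₂.integrable_comp hi₂)
  have hmain := hasFDerivAt_integral_of_dominated_of_fderiv_le (𝕜 := ℝ) (s := univ) (x₀ := p)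
    (F := fun (q : ℝ × ℝ) (t : ℝ) => ψ (q.1, t) * Complex.exp (Complex.I * q.2 * t))
    (F' := fun (q : ℝ × ℝ) (t : ℝ) => L₁ (ψ₁ (q.1, t) * Complex.exp (Complex.I * q.2 * t)) +
      L₂ (ψ₂ (q.1, t) * Complex.exp (Complex.I * q.2 * t)))
    (bound := fun t => ‖L₁‖ * (C₁ * (1 + t ^ 2)⁻¹) + ‖L₂‖ * (C₂ * (1 + t ^ 2)⁻¹))
    univ_mem (Eventually.of_forall fun q => (integrable_slice_mul_exp ψ q).aestronglyMeasurable)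
    (integrable_slice_mul_exp ψ p) hF'.aestronglyMeasurable
    (Eventually.of_forall fun t q _ => ?_)
    (((integrable_inv_one_add_sq.const_mul C₁).const_mul _).add
      ((integrable_inv_one_add_sq.const_mul C₂).const_mul _))
    (Eventually.of_forall fun t q _ => ?_)
  · rw [integral_add (L₁.integrable_comp hi₁) (L₂.integrable_comp hi₂),
      L₁.integral_comp_comm hi₁, L₂.integral_comp_comm hi₂] at hmain
    exact hmain
  · refine (norm_add_le _ _).trans (add_le_add ?_ ?_)
    · refine (L₁.le_opNorm _).trans ?_
      rw [norm_mul, norm_exp_I_mul_mul, mul_one]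
      gcongr
      exact h₁ _ _
    · refine (L₂.le_opNorm _).trans ?_
      rw [norm_mul, norm_exp_I_mul_mul, mul_one]
      gcongr
      exact h₂ _ _
  · have hψ : HasFDerivAt (fun q : ℝ × ℝ => ψ (q.1, t))
        ((fderiv ℝ ψ (q.1, t)).comp ((ContinuousLinearMap.fst ℝ ℝ ℝ).prod 0)) q :=
      (ψ.hasFDerivAt (q.1, t)).comp q (hasFDerivAt_fst.prodMk (hasFDerivAt_const t q))
    have hlin : HasFDerivAt (fun q : ℝ × ℝ => Complex.I * q.2 * t)
        ((ContinuousLinearMap.snd ℝ ℝ ℝ).smulRight (Complex.I * t)) q := by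
      have := ((ContinuousLinearMap.snd ℝ ℝ ℝ).smulRight (Complex.I * t)).hasFDerivAt (x := q)
      refine this.congr_of_eventuallyEq (Eventually.of_forall fun q' => ?_)
      simp [mul_comm, mul_left_comm]
    refine (hψ.mul hlin.cexp).congr_fderiv ?_
    ext
    · simp [L₁, L₂, hψ₁, SchwartzMap.lineDerivOp_apply_eq_fderiv, mul_comm]
    · have h0 : fderiv ℝ ψ (q.1, t) (0, 0) = 0 := map_zero _
      simp [L₁, L₂, hψ₂, mulSnd_apply, h0]
      ring

theorem contDiff_partialFourier (n : ℕ) (ψ : 𝓢(ℝ × ℝ, ℂ)) :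
    ContDiff ℝ n (partialFourier ψ) := by
  induction n generalizing ψ with
  | zero =>
    rw [Nat.cast_zero, contDiff_zero, continuous_iff_continuousAt]
    exact fun p => (hasFDerivAt_partialFourier ψ p).continuousAt
  | succ n ih =>
    rw [Nat.cast_succ, contDiff_succ_iff_hasFDerivAt]
    refine ⟨_, ?_, hasFDerivAt_partialFourier ψ⟩
    exact ((ContinuousLinearMap.contDiff _).comp (ih _)).add
      ((ContinuousLinearMap.contDiff _).comp (ih _))

/-- Each coordinate factor is traded for an operation on ψ: multiplication by x commutes with the
transform, and multiplication by y becomes ∂_t. -/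
theorem exists_decay_partialFourier_zero (k : ℕ) (ψ : 𝓢(ℝ × ℝ, ℂ)) :
    ∃ C, ∀ p, ‖p‖ ^ k * ‖partialFourier ψ p‖ ≤ C := by
  induction k generalizing ψ with
  | zero => simpa using exists_norm_partialFourier_le ψ
  | succ k ih =>
    obtain ⟨C₁, h₁⟩ := ih (mulFst ψ)
    obtain ⟨C₂, h₂⟩ := ih (∂_{((0, 1) : ℝ × ℝ)} ψ)
    refine ⟨C₁ + C₂, fun p => ?_⟩
    have e₁ := congrArg norm (fst_mul_partialFourier ψ p)
    have e₂ := congrArg norm (snd_mul_partialFourier ψ p)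
    rw [norm_mul, Complex.norm_real] at e₁
    rw [norm_mul, norm_mul, Complex.norm_real, Complex.norm_I, one_mul] at e₂
    have hp : ‖p‖ ≤ ‖p.1‖ + ‖p.2‖ :=
      max_le (le_add_of_nonneg_right (norm_nonneg _)) (le_add_of_nonneg_left (norm_nonneg _))
    calc ‖p‖ ^ (k + 1) * ‖partialFourier ψ p‖
        = ‖p‖ ^ k * (‖p‖ * ‖partialFourier ψ p‖) := by ring
      _ ≤ ‖p‖ ^ k * ((‖p.1‖ + ‖p.2‖) * ‖partialFourier ψ p‖) := by gcongr
      _ = ‖p‖ ^ k * ‖partialFourier (mulFst ψ) p‖ +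
          ‖p‖ ^ k * ‖partialFourier (∂_{((0, 1) : ℝ × ℝ)} ψ) p‖ := by
        rw [← e₁, ← e₂]; ring
      _ ≤ C₁ + C₂ := add_le_add (h₁ p) (h₂ p)

theorem exists_decay_partialFourier (k n : ℕ) (ψ : 𝓢(ℝ × ℝ, ℂ)) :
    ∃ C, ∀ p, ‖p‖ ^ k * ‖iteratedFDeriv ℝ n (partialFourier ψ) p‖ ≤ C := by
  induction n generalizing ψ with
  | zero => simpa using exists_decay_partialFourier_zero k ψ
  | succ n ih =>
    set L₁ := ContinuousLinearMap.smulRightL ℝ (ℝ × ℝ) ℂ (ContinuousLinearMap.fst ℝ ℝ ℝ)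
    set L₂ := ContinuousLinearMap.smulRightL ℝ (ℝ × ℝ) ℂ (ContinuousLinearMap.snd ℝ ℝ ℝ)
    set f₁ := partialFourier (∂_{((1, 0) : ℝ × ℝ)} ψ)
    set f₂ := partialFourier (Complex.I • mulSnd ψ)
    obtain ⟨C₁, h₁⟩ := ih (∂_{((1, 0) : ℝ × ℝ)} ψ)
    obtain ⟨C₂, h₂⟩ := ih (Complex.I • mulSnd ψ)
    have hd : fderiv ℝ (partialFourier ψ) = (L₁ ∘ f₁) + (L₂ ∘ f₂) :=
      funext fun p => (hasFDerivAt_partialFourier ψ p).fderiv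
    have hf₁ : ContDiff ℝ n f₁ := contDiff_partialFourier n _
    have hf₂ : ContDiff ℝ n f₂ := contDiff_partialFourier n _
    refine ⟨‖L₁‖ * C₁ + ‖L₂‖ * C₂, fun p => ?_⟩
    rw [← norm_iteratedFDeriv_fderiv, hd, iteratedFDeriv_add_apply
      (L₁.contDiff.comp hf₁).contDiffAt (L₂.contDiff.comp hf₂).contDiffAt]
    calc ‖p‖ ^ k * ‖iteratedFDeriv ℝ n (L₁ ∘ f₁) p + iteratedFDeriv ℝ n (L₂ ∘ f₂) p‖
        ≤ ‖p‖ ^ k * (‖L₁‖ * ‖iteratedFDeriv ℝ n f₁ p‖ + ‖L₂‖ * ‖iteratedFDeriv ℝ n f₂ p‖) := by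
          gcongr
          exact (norm_add_le _ _).trans (add_le_add
            (L₁.norm_iteratedFDeriv_comp_left hf₁.contDiffAt le_rfl)
            (L₂.norm_iteratedFDeriv_comp_left hf₂.contDiffAt le_rfl))
      _ = ‖L₁‖ * (‖p‖ ^ k * ‖iteratedFDeriv ℝ n f₁ p‖) +
          ‖L₂‖ * (‖p‖ ^ k * ‖iteratedFDeriv ℝ n f₂ p‖) := by ring
      _ ≤ ‖L₁‖ * C₁ + ‖L₂‖ * C₂ := by
          gcongr
          · exact h₁ p
          · exact h₂ p

/-- The partial Fourier transform of a Schwartz function as a Schwartz function. -/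
def schwartzPartialFourier (ψ : 𝓢(ℝ × ℝ, ℂ)) : 𝓢(ℝ × ℝ, ℂ) where
  toFun := partialFourier ψ
  smooth' := contDiff_infty.2 fun n => contDiff_partialFourier n ψ
  decay' k n := exists_decay_partialFourier k n ψ

/-! #### Fourier inversion on the line with angular frequencies -/

open FourierTransform in
-- Conversion from angular frequency to the kernel e^{2πi}. The rescaling y/(2π) is the source of
-- every factor 2π below.
theorem integral_mul_exp_eq_fourierInv (f : 𝓢(ℝ, ℂ)) (y : ℝ) :
    ∫ t : ℝ, f t * Complex.exp (Complex.I * y * t) = 𝓕⁻ (f : ℝ → ℂ) (y / (2 * Real.pi)) := by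
  rw [Real.fourierInv_eq']
  congr 1 with t
  rw [smul_eq_mul, mul_comm]
  congr 2
  have : (2 * Real.pi * inner ℝ t (y / (2 * Real.pi)) : ℝ) = t * y := by
    rw [RCLike.inner_apply, conj_trivial]
    field_simp
  rw [this]
  push_cast
  ring

open FourierTransform in
theorem integrable_integral_mul_exp (f : 𝓢(ℝ, ℂ)) :
    Integrable fun y : ℝ => ∫ t : ℝ, f t * Complex.exp (Complex.I * y * t) := by
  simp_rw [integral_mul_exp_eq_fourierInv f, ← SchwartzMap.fourierInv_coe]
  exact (𝓕⁻ f).integrable.comp_div (by positivity)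

open FourierTransform in
theorem integral_integral_mul_exp (f : 𝓢(ℝ, ℂ)) (t : ℝ) :
    ∫ y : ℝ, (∫ v : ℝ, f v * Complex.exp (Complex.I * y * v)) * Complex.exp (-Complex.I * y * t) =
      2 * Real.pi * f t := by
  have h1 : ∀ y : ℝ, (∫ v : ℝ, f v * Complex.exp (Complex.I * y * v)) *
      Complex.exp (-Complex.I * y * t) =
      (fun w : ℝ => Complex.exp ((-2 * Real.pi * w * t : ℝ) * Complex.I) • 𝓕⁻ f w)
        (y / (2 * Real.pi)) := fun y => by
    simp only
    rw [integral_mul_exp_eq_fourierInv, ← SchwartzMap.fourierInv_coe, smul_eq_mul, mul_comm]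
    congr 2
    have : (-2 * Real.pi * (y / (2 * Real.pi)) * t : ℝ) = -(y * t) := by field_simp
    rw [this]
    push_cast
    ring
  simp_rw [h1]
  rw [Measure.integral_comp_div (fun w : ℝ => Complex.exp ((-2 * Real.pi * w * t : ℝ) *
    Complex.I) • 𝓕⁻ f w), ← Real.fourier_real_eq_integral_exp_smul, ← SchwartzMap.fourier_coe,
    fourier_fourierInv_eq, abs_of_pos (by positivity), Complex.real_smul]
  push_cast
  ring

theorem integral_integral_mul_exp' (f : 𝓢(ℝ, ℂ)) (t : ℝ) :
    ∫ y : ℝ, (∫ v : ℝ, f v * Complex.exp (-Complex.I * v * y)) * Complex.exp (Complex.I * y * t) =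
      2 * Real.pi * f t := by
  rw [← integral_integral_mul_exp, ← integral_neg_eq_self]
  congr 1 with y
  congr 2
  · congr 1 with v
    congr 2
    push_cast
    ring
  · push_cast
    ring

theorem integrable_integral_mul_exp' (f : 𝓢(ℝ, ℂ)) :
    Integrable fun y : ℝ => ∫ v : ℝ, f v * Complex.exp (-Complex.I * v * y) := by
  have := (integrable_integral_mul_exp f).comp_neg
  refine this.congr (Eventually.of_forall fun y => ?_)
  simp only
  congr 1 with v
  congr 2
  push_cast
  ring

/-! #### Density of compactly supported functions -/

/-- The approximants are χ(x/(n+1)) φ with a bump χ equal to 1 on the unit ball. The error lives on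
|x| ≥ n + 1, where one spare power of |x| in the seminorms of φ pays a factor 1/(n+1). -/
theorem exists_tendsto_hasCompactSupport {E : Type*} [NormedAddCommGroup E] [NormedSpace ℝ E]
    [FiniteDimensional ℝ E] (φ : 𝓢(E, ℂ)) : ∃ u : ℕ → 𝓢(E, ℂ),
      (∀ n, HasCompactSupport (u n)) ∧ Tendsto u atTop (nhds φ) := by
  let χ : ContDiffBump (0 : E) := ⟨1, 2, one_pos, one_lt_two⟩
  have hχ : ContDiff ℝ (⊤ : ℕ∞) (χ : E → ℝ) := χ.contDiff
  let g : ℕ → E →L[ℝ] E := fun n => ((n : ℝ) + 1)⁻¹ • ContinuousLinearMap.id ℝ E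
  have hg : ∀ n x, g n x = ((n : ℝ) + 1)⁻¹ • x := fun n x => rfl
  have hg1 : ∀ n, ‖g n‖ ≤ 1 := fun n => by
    refine ContinuousLinearMap.opNorm_le_bound _ zero_le_one fun x => ?_
    rw [hg, norm_smul, Real.norm_of_nonneg (by positivity)]
    gcongr
    exact inv_le_one_of_one_le₀ (by linarith [n.cast_nonneg (α := ℝ)])
  let ρ : ℕ → E → ℝ := fun n x => χ (g n x)
  have hρ : ∀ n, ContDiff ℝ (⊤ : ℕ∞) (ρ n) := fun n => hχ.comp (g n).contDiff
  have hρsupp : ∀ n, HasCompactSupport (ρ n) := fun n => by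
    refine HasCompactSupport.of_support_subset_isCompact
      (isCompact_closedBall (0 : E) (2 * (n + 1))) fun x hx => ?_
    have : g n x ∈ Function.support χ := hx
    rw [χ.support_eq, mem_ball_zero_iff, hg, norm_smul, Real.norm_of_nonneg (by positivity),
      inv_mul_lt_iff₀ (by positivity)] at this
    rw [mem_closedBall_zero_iff]
    have h2 : χ.rOut = 2 := rfl
    rw [h2] at this
    linarith
  have hu : ∀ n, HasCompactSupport fun x => ρ n x • φ x := fun n => (hρsupp n).smul_right
  let u : ℕ → 𝓢(E, ℂ) := fun n => (hu n).toSchwartzMap ((hρ n).smul (φ.smooth ⊤))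
  refine ⟨u, hu, ?_⟩
  rw [(schwartz_withSeminorms ℂ E ℂ).tendsto_nhds]
  rintro ⟨k, m⟩ ε hε
  -- The dilations have norm at most 1, so the derivatives of the cutoffs are bounded uniformly in
  -- n.
  have hB : ∃ B, 0 ≤ B ∧ ∀ i ≤ m, ∀ n x, ‖iteratedFDeriv ℝ i (fun y => ρ n y - 1) x‖ ≤ B := by
    have h1 : ∀ i : ℕ, ∃ B, ∀ x, ‖iteratedFDeriv ℝ i (fun y => χ y - 1) x‖ ≤ B := fun i => by
      have hs : HasCompactSupport (iteratedFDeriv ℝ i (χ : E → ℝ)) :=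
        χ.hasCompactSupport.iteratedFDeriv i
      have hc : Continuous (iteratedFDeriv ℝ i (χ : E → ℝ)) :=
        hχ.continuous_iteratedFDeriv (by exact_mod_cast le_top)
      obtain ⟨B, hB⟩ := hs.exists_bound_of_continuous hc
      obtain ⟨B', hB'⟩ : ∃ B', ∀ x : E, ‖iteratedFDeriv ℝ i (fun _ : E => (1 : ℝ)) x‖ ≤ B' := by
        rcases i with _ | i
        · exact ⟨1, fun x => by simp⟩
        · exact ⟨0, fun x => by simp [iteratedFDeriv_const_of_ne (Nat.succ_ne_zero i)]⟩
      refine ⟨B + B', fun x => ?_⟩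
      have e : (fun y => χ y - 1) = (χ : E → ℝ) - fun _ => (1 : ℝ) := rfl
      rw [e, iteratedFDeriv_sub_apply (hχ.of_le (by exact_mod_cast le_top)).contDiffAt
        contDiffAt_const]
      exact (norm_sub_le _ _).trans (add_le_add (hB x) (hB' x))
    choose B hB using h1
    refine ⟨∑ i ∈ Finset.range (m + 1), |B i|, by positivity, fun i hi n x => ?_⟩
    have e : (fun y => ρ n y - 1) = (fun y => χ y - 1) ∘ g n := rfl
    have hc : ContDiff ℝ (⊤ : ℕ∞) fun y => χ y - 1 := hχ.sub contDiff_const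
    rw [e, (g n).iteratedFDeriv_comp_right hc x (by exact_mod_cast le_top)]
    refine (ContinuousMultilinearMap.norm_compContinuousLinearMap_le _ _).trans ?_
    have h2 : ∏ _j : Fin i, ‖g n‖ ≤ 1 := Finset.prod_le_one (fun _ _ => norm_nonneg _)
      fun _ _ => hg1 n
    calc _ ≤ |B i| * 1 := by
          gcongr
          exact (hB i _).trans (le_abs_self _)
      _ ≤ _ := by
          rw [mul_one]
          exact Finset.single_le_sum (f := fun i => |B i|) (fun _ _ => abs_nonneg _)
            (Finset.mem_range.2 (Nat.lt_succ_of_le hi))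
  obtain ⟨B, hB0, hB⟩ := hB
  set D : ℝ := ∑ i ∈ Finset.range (m + 1),
    (m.choose i : ℝ) * B * SchwartzMap.seminorm ℂ (k + 1) (m - i) φ with hD
  have hbound : ∀ n : ℕ, SchwartzMap.seminorm ℂ k m (u n - φ) ≤ D * ((n : ℝ) + 1)⁻¹ := fun n => by
    refine SchwartzMap.seminorm_le_bound ℂ k m _ (by positivity) fun x => ?_
    have e : ((u n - φ : 𝓢(E, ℂ)) : E → ℂ) = fun y => (ρ n y - 1) • φ y := by
      ext y
      simp [u, sub_smul]
    rw [e]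
    rcases lt_or_ge ‖x‖ ((n : ℝ) + 1) with hx | hx
    · have hev : (fun y => (ρ n y - 1) • φ y) =ᶠ[nhds x] fun _ => 0 := by
        filter_upwards [(isOpen_lt continuous_norm continuous_const).mem_nhds hx] with y hy
        have : ρ n y = 1 := by
          refine χ.one_of_mem_closedBall ?_
          rw [mem_closedBall_zero_iff, hg, norm_smul, Real.norm_of_nonneg (by positivity)]
          have h1 : χ.rIn = 1 := rfl
          rw [h1, inv_mul_le_iff₀ (by positivity), mul_one]
          exact le_of_lt hy
        rw [this, sub_self, zero_smul]
      rw [(hev.iteratedFDeriv ℝ m).eq_of_nhds]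
      have : iteratedFDeriv ℝ m (fun _ : E => (0 : ℂ)) x = 0 := by simp
      rw [this, norm_zero, mul_zero]
      positivity
    · have hx0 : (0 : ℝ) < (n : ℝ) + 1 := by positivity
      have hρ' : ContDiff ℝ (⊤ : ℕ∞) fun y => ρ n y - 1 := (hρ n).sub contDiff_const
      have h1 := norm_iteratedFDeriv_smul_le hρ' (φ.smooth ⊤) x (n := m)
        (by exact_mod_cast le_top)
      calc ‖x‖ ^ k * ‖iteratedFDeriv ℝ m (fun y => (ρ n y - 1) • φ y) x‖
          ≤ ‖x‖ ^ k * ∑ i ∈ Finset.range (m + 1), (m.choose i : ℝ) *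
            ‖iteratedFDeriv ℝ i (fun y => ρ n y - 1) x‖ * ‖iteratedFDeriv ℝ (m - i) φ x‖ := by
            gcongr
        _ ≤ ∑ i ∈ Finset.range (m + 1), (m.choose i : ℝ) * B *
            SchwartzMap.seminorm ℂ (k + 1) (m - i) φ * ((n : ℝ) + 1)⁻¹ := by
            rw [Finset.mul_sum]
            refine Finset.sum_le_sum fun i hi => ?_
            have h2 := hB i (Nat.lt_succ_iff.1 (Finset.mem_range.1 hi)) n x
            have h3 := SchwartzMap.le_seminorm ℂ (k + 1) (m - i) φ x
            have h4 : ‖x‖ ^ k * ‖iteratedFDeriv ℝ (m - i) φ x‖ ≤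
                SchwartzMap.seminorm ℂ (k + 1) (m - i) φ * ((n : ℝ) + 1)⁻¹ := by
              rw [← div_eq_mul_inv, le_div_iff₀ hx0]
              refine le_trans ?_ h3
              rw [pow_succ, mul_right_comm]
              gcongr
            calc _ = (m.choose i : ℝ) * ‖iteratedFDeriv ℝ i (fun y => ρ n y - 1) x‖ *
                  (‖x‖ ^ k * ‖iteratedFDeriv ℝ (m - i) φ x‖) := by ring
              _ ≤ (m.choose i : ℝ) * B *
                  (SchwartzMap.seminorm ℂ (k + 1) (m - i) φ * ((n : ℝ) + 1)⁻¹) := by gcongr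
              _ = _ := by ring
        _ = D * ((n : ℝ) + 1)⁻¹ := by rw [hD, Finset.sum_mul]
  have hlim : Tendsto (fun n : ℕ => D * ((n : ℝ) + 1)⁻¹) atTop (nhds 0) := by
    have := tendsto_one_div_add_atTop_nhds_zero_nat (𝕜 := ℝ)
    simpa using this.const_mul D
  filter_upwards [hlim.eventually_lt_const hε] with n hn
  exact (hbound n).trans_lt hn

end Schwartz

/-! ### Existence and uniqueness of the fundamental solution -/

section Distribution

/-- The order 5 is 2, for the quadratic weight in t, plus 3, an exponent above the dimension 2 and
hence integrable on the plane. -/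
theorem exists_schwartz_weight_bound (ζ : 𝓢(ℝ × ℝ, ℂ)) (p : ℝ × ℝ) :
    (1 + |p.2|) ^ 2 * ‖ζ p‖ ≤ 2 ^ 5 * ((Finset.Iic ((5, 0) : ℕ × ℕ)).sup
      fun m => SchwartzMap.seminorm ℂ m.1 m.2) ζ * (1 + ‖p‖) ^ (-3 : ℝ) := by
  have h := SchwartzMap.one_add_le_sup_seminorm_apply (𝕜 := ℂ) (m := (5, 0)) (k := 5) (n := 0)
    le_rfl le_rfl ζ p
  rw [norm_iteratedFDeriv_zero] at h
  have hp : 0 < 1 + ‖p‖ := by positivity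
  have h2 : |p.2| ≤ ‖p‖ := norm_snd_le p
  have e : (1 + ‖p‖) ^ (-3 : ℝ) = ((1 + ‖p‖) ^ 3)⁻¹ := by
    rw [Real.rpow_neg hp.le]
    norm_cast
  rw [e, ← div_eq_mul_inv, le_div_iff₀ (by positivity)]
  refine le_trans ?_ h
  calc (1 + |p.2|) ^ 2 * ‖ζ p‖ * (1 + ‖p‖) ^ 3 ≤ (1 + ‖p‖) ^ 2 * ‖ζ p‖ * (1 + ‖p‖) ^ 3 := by gcongr
    _ = _ := by ring

theorem integrable_one_add_norm_plane :
    Integrable fun p : ℝ × ℝ => (1 + ‖p‖) ^ (-3 : ℝ) :=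
  integrable_one_add_norm (by
    rw [Module.finrank_prod, Module.finrank_self]
    norm_num)

theorem integrable_mul_schwartz {f : ℝ × ℝ → ℂ} (hf : Continuous f) {C : ℝ}
    (hb : ∀ p, ‖f p‖ ≤ C * (1 + |p.2|) ^ 2) (ζ : 𝓢(ℝ × ℝ, ℂ)) :
    Integrable fun p => f p * ζ p := by
  have hC : 0 ≤ C := by simpa using (norm_nonneg _).trans (hb 0)
  refine ((integrable_one_add_norm_plane.const_mul (2 ^ 5 * ((Finset.Iic ((5, 0) : ℕ × ℕ)).sup
    fun m => SchwartzMap.seminorm ℂ m.1 m.2) ζ)).const_mul C).mono'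
    (hf.mul ζ.continuous).aestronglyMeasurable (Eventually.of_forall fun p => ?_)
  rw [norm_mul]
  calc ‖f p‖ * ‖ζ p‖ ≤ C * (1 + |p.2|) ^ 2 * ‖ζ p‖ := by gcongr; exact hb p
    _ = C * ((1 + |p.2|) ^ 2 * ‖ζ p‖) := by ring
    _ ≤ _ := mul_le_mul_of_nonneg_left (exists_schwartz_weight_bound ζ p) hC

/-- A continuous function of moderate growth is a tempered distribution. -/
theorem exists_temperedDistribution {f : ℝ × ℝ → ℂ} (hf : Continuous f) {C : ℝ}
    (hb : ∀ p, ‖f p‖ ≤ C * (1 + |p.2|) ^ 2) :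
    ∃ T : 𝓢'(ℝ × ℝ, ℂ), ∀ ζ : 𝓢(ℝ × ℝ, ℂ), T ζ = ∫ p, f p * ζ p := by
  have hC : 0 ≤ C := by simpa using (norm_nonneg _).trans (hb 0)
  refine ⟨ContinuousLinearMap.toPointwiseConvergenceCLM _ _ _ _
    (SchwartzMap.mkCLMtoNormedSpace (𝕜 := ℂ) (fun ζ : 𝓢(ℝ × ℝ, ℂ) => ∫ p, f p * ζ p)
      (fun ζ ζ' => ?_) (fun c ζ => ?_) ?_), fun ζ => rfl⟩
  · rw [← integral_add (integrable_mul_schwartz hf hb ζ) (integrable_mul_schwartz hf hb ζ')]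
    congr 1 with p
    rw [add_apply, mul_add]
  · rw [RingHom.id_apply, smul_eq_mul, ← integral_const_mul]
    congr 1 with p
    rw [smul_apply, smul_eq_mul, mul_left_comm]
  · refine ⟨Finset.Iic (5, 0), C * 2 ^ 5 * ∫ p : ℝ × ℝ, (1 + ‖p‖) ^ (-3 : ℝ),
      mul_nonneg (by positivity) (integral_nonneg fun p => by positivity), fun ζ => ?_⟩
    have h1 : ‖∫ p, f p * ζ p‖ ≤ ∫ p : ℝ × ℝ, C * (2 ^ 5 * ((Finset.Iic ((5, 0) : ℕ × ℕ)).sup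
        fun m => SchwartzMap.seminorm ℂ m.1 m.2) ζ * (1 + ‖p‖) ^ (-3 : ℝ)) := by
      refine norm_integral_le_of_norm_le ((integrable_one_add_norm_plane.const_mul _).const_mul C)
        (Eventually.of_forall fun p => ?_)
      rw [norm_mul]
      calc ‖f p‖ * ‖ζ p‖ ≤ C * (1 + |p.2|) ^ 2 * ‖ζ p‖ := by gcongr; exact hb p
        _ = C * ((1 + |p.2|) ^ 2 * ‖ζ p‖) := by ring
        _ ≤ _ := mul_le_mul_of_nonneg_left (exists_schwartz_weight_bound ζ p) hC
    rw [integral_const_mul, integral_const_mul] at h1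
    refine h1.trans (le_of_eq ?_)
    change _ = C * 2 ^ 5 * (∫ p : ℝ × ℝ, (1 + ‖p‖) ^ (-3 : ℝ)) *
      ((Finset.Iic ((5, 0) : ℕ × ℕ)).sup fun m => SchwartzMap.seminorm ℂ m.1 m.2) ζ
    ring

variable {μσ με : Measure unitInterval} [IsFiniteMeasure μσ] [IsFiniteMeasure με]

/-- Compact support makes e^t φ a Schwartz function, so by Fourier inversion in t it is a partial
Fourier transform of some η, and φ is admissible in the Laplace condition with a = 1. The value S φ
is then prescribed, whatever S is. -/
theorem exists_isFundamentalSolution_apply_eq (μσ με : Measure unitInterval)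
    (φ : 𝓢(ℝ × ℝ, ℂ)) (hφ : HasCompactSupport φ) :
    ∃ η : 𝓢(ℝ × ℝ, ℂ), ∀ S : 𝓢'(ℝ × ℝ, ℂ), IsFundamentalSolution μσ με S →
      S φ = ∫ p : ℝ × ℝ, STilde μσ με p.1 ((1 : ℝ) + Complex.I * p.2) * η p := by
  have hsm : ContDiff ℝ (⊤ : ℕ∞) fun p : ℝ × ℝ => Complex.exp p.2 * φ p :=
    ((Complex.ofRealCLM.contDiff.comp contDiff_snd).cexp).mul (φ.smooth ⊤)
  let ψ : 𝓢(ℝ × ℝ, ℂ) := (hφ.mul_left (f := fun p : ℝ × ℝ => Complex.exp p.2)).toSchwartzMap hsm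
  have hψ : ∀ p, ψ p = Complex.exp p.2 * φ p := fun p => rfl
  refine ⟨(1 / (2 * Real.pi) : ℂ) • schwartzPartialFourier ψ, fun S hS => ?_⟩
  refine hS.laplace 1 one_pos 1 one_pos _ _ fun x t _ => ?_
  have h1 := integral_integral_mul_exp (schwartzSlice x ψ) t
  have hpi : (Real.pi : ℂ) ≠ 0 := by exact_mod_cast Real.pi_ne_zero
  have h2 : ∫ y : ℝ, ((1 / (2 * Real.pi) : ℂ) • schwartzPartialFourier ψ) (x, y) *
      Complex.exp (-Complex.I * y * t) = ψ (x, t) := by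
    have : ∀ y : ℝ, ((1 / (2 * Real.pi) : ℂ) • schwartzPartialFourier ψ) (x, y) *
        Complex.exp (-Complex.I * y * t) = 1 / (2 * Real.pi) *
        ((∫ v : ℝ, schwartzSlice x ψ v * Complex.exp (Complex.I * y * v)) *
          Complex.exp (-Complex.I * y * t)) := fun y => by
      rw [smul_apply, smul_eq_mul, mul_assoc]
      rfl
    simp_rw [this]
    rw [integral_const_mul, h1, schwartzSlice_apply]
    field_simp
  rw [h2, hψ, ← mul_assoc, ← Complex.exp_add]
  simp

omit [IsFiniteMeasure μσ] [IsFiniteMeasure με] in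
theorem IsFundamentalSolution.unique {S S' : 𝓢'(ℝ × ℝ, ℂ)}
    (hS : IsFundamentalSolution μσ με S) (hS' : IsFundamentalSolution μσ με S') : S = S' := by
  ext φ
  obtain ⟨u, hu, hlim⟩ := exists_tendsto_hasCompactSupport φ
  have h1 : Tendsto (fun n => S (u n)) atTop (nhds (S φ)) :=
    ((map_continuous S).tendsto φ).comp hlim
  have h2 : Tendsto (fun n => S' (u n)) atTop (nhds (S' φ)) :=
    ((map_continuous S').tendsto φ).comp hlim
  refine tendsto_nhds_unique h1 (h2.congr fun n => ?_)
  obtain ⟨η, hη⟩ := exists_isFundamentalSolution_apply_eq μσ με (u n) (hu n)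
  rw [hη S hS, hη S' hS']

/-- The factor e^{-at} cancels the modulus of e^{st} on the line. The double integral then converges
absolutely, and after exchanging the order the inner integral is Fourier inversion for f. -/
theorem IsModel.integral_lineIntegral_mul (h : IsModel μσ με) {a : ℝ} (ha : 0 < a) (x : ℝ)
    (f : 𝓢(ℝ, ℂ)) :
    ∫ t : ℝ, lineIntegral μσ με a x t * (Complex.exp (-a * t) *
      ∫ y : ℝ, f y * Complex.exp (-Complex.I * y * t)) =
    ∫ y : ℝ, waveSymbol μσ με x (a + y * Complex.I) / (a + y * Complex.I) ^ 2 * f y := by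
  set G : ℝ → ℂ := fun y => waveSymbol μσ με x (a + y * Complex.I) / (a + y * Complex.I) ^ 2
    with hG
  set g : ℝ → ℂ := fun t => ∫ y : ℝ, f y * Complex.exp (-Complex.I * y * t) with hg
  have hGint : Integrable G := h.integrable_waveSymbol_div ha x
  have hgint : Integrable g := integrable_integral_mul_exp' f
  have e : ∀ t : ℝ, lineIntegral μσ με a x t * (Complex.exp (-a * t) * g t) =
      ∫ y : ℝ, 1 / (2 * Real.pi) * (G y * g t * Complex.exp (Complex.I * y * t)) := fun t => by
    rw [lineIntegral, integral_const_mul, mul_assoc]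
    congr 1
    rw [← integral_mul_const]
    congr 1 with y
    have : Complex.exp ((a + y * Complex.I) * t) * Complex.exp (-a * t) =
        Complex.exp (Complex.I * y * t) := by
      rw [← Complex.exp_add]; congr 1; ring
    rw [← this]
    ring
  have hint : Integrable (Function.uncurry fun (t y : ℝ) =>
      1 / (2 * Real.pi : ℂ) * (G y * g t * Complex.exp (Complex.I * y * t)))
      (volume.prod volume) := by
    refine Integrable.const_mul ?_ _
    have h1 : Integrable (fun z : ℝ × ℝ => G z.2 * g z.1) (volume.prod volume) :=
      (hgint.mul_prod hGint).congr (Eventually.of_forall fun z => mul_comm _ _)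
    refine h1.norm.mono' (h1.aestronglyMeasurable.mul
      (by fun_prop : Continuous fun z : ℝ × ℝ =>
        Complex.exp (Complex.I * z.2 * z.1)).aestronglyMeasurable)
      (Eventually.of_forall fun z => ?_)
    rw [norm_mul _ (Complex.exp _), norm_exp_I_mul_mul, mul_one]
  rw [integral_congr_ae (Eventually.of_forall e), integral_integral_swap hint]
  congr 1 with y
  have h2 := integral_integral_mul_exp' f y
  have hpi : (Real.pi : ℂ) ≠ 0 := by exact_mod_cast Real.pi_ne_zero
  have h3 : ∫ t : ℝ, 1 / (2 * Real.pi : ℂ) * (G y * g t * Complex.exp (Complex.I * y * t)) =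
      1 / (2 * Real.pi) * G y * ∫ t : ℝ, g t * Complex.exp (Complex.I * t * y) := by
    rw [← integral_const_mul]
    congr 1 with t
    rw [mul_right_comm Complex.I]
    ring
  rw [h3, h2]
  change _ = G y * f y
  field_simp

theorem hasDerivAt_integral_mul_exp (η : 𝓢(ℝ × ℝ, ℂ)) (x t : ℝ) :
    HasDerivAt (fun t : ℝ => ∫ y : ℝ, η (x, y) * Complex.exp (-Complex.I * y * t))
      (-∫ y : ℝ, (Complex.I • mulSnd η) (x, y) * Complex.exp (-Complex.I * y * t)) t := by
  have e : ∀ (ψ : 𝓢(ℝ × ℝ, ℂ)) (t : ℝ), ∫ y : ℝ, ψ (x, y) * Complex.exp (-Complex.I * y * t) =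
      partialFourier ψ (x, -t) := fun ψ t => by
    rw [partialFourier]
    congr 1 with y
    congr 2
    push_cast
    ring
  simp_rw [e]
  have h1 := (hasFDerivAt_partialFourier η (x, -t)).comp_hasDerivAt t
    ((hasDerivAt_const t x).prodMk (hasDerivAt_neg t))
  refine h1.congr_deriv ?_
  simp

/-- Moving ∂_t to the test function replaces η by (a + iy)η, that is by sη, up to a sign that
cancels. This turns W/s² into W/s, which is the required transform. The support statement holds
because T itself is given by a function that vanishes outside the cone. -/
theorem IsModel.isFundamentalSolution (h : IsModel μσ με) {k : ℝ} (hk0 : 0 ≤ k)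
    (hk : TendstoUniformlyOn (Psi μσ με) (fun _ => (k : ℂ)) atTop (Icc (-Real.pi) Real.pi))
    {T : 𝓢'(ℝ × ℝ, ℂ)} (hT : ∀ ζ : 𝓢(ℝ × ℝ, ℂ), T ζ = ∫ p, wavePrimitive μσ με p * ζ p) :
    IsFundamentalSolution μσ με (∂_{((0, 1) : ℝ × ℝ)} T) ∧
      Distribution.IsVanishingOn (∂_{((0, 1) : ℝ × ℝ)} T : 𝓢'(ℝ × ℝ, ℂ)) (cone k)ᶜ := by
  have hvan : Distribution.IsVanishingOn (∂_{((0, 1) : ℝ × ℝ)} T : 𝓢'(ℝ × ℝ, ℂ)) (cone k)ᶜ := by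
    intro ζ hζ
    rw [TemperedDistribution.lineDerivOp_apply_apply, hT]
    refine integral_eq_zero_of_ae (Eventually.of_forall fun p => ?_)
    by_cases hp : p ∈ cone k
    · have : p ∉ tsupport (∂_{((0, 1) : ℝ × ℝ)} ζ : 𝓢(ℝ × ℝ, ℂ)) := fun hp' =>
        hζ (SchwartzMap.tsupport_lineDerivOp_subset _ ζ hp') hp
      simp [image_eq_zero_of_notMem_tsupport this]
    · have hp' : p.2 < k * |p.1| := not_le.1 hp
      simp [h.wavePrimitive_eq_zero hk hk0 hp']
  have hsub : {p : ℝ × ℝ | p.2 < 0} ⊆ (cone k)ᶜ := fun p (hp : p.2 < 0) (hp' : k * |p.1| ≤ p.2) =>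
    absurd (hp'.trans_lt hp) (not_lt.2 (by positivity))
  refine ⟨⟨hvan.mono hsub, ?_⟩, hvan⟩
  intro a ha δ hδ η ζ hζ
  obtain ⟨C, hC, hb⟩ := h.exists_norm_wavePrimitive_le hk hk0
  obtain ⟨K, hK, hbK⟩ := h.exists_norm_vertical_le
  set η₁ : 𝓢(ℝ × ℝ, ℂ) := (a : ℂ) • η + Complex.I • mulSnd η with hη₁
  have hη₁_apply : ∀ p : ℝ × ℝ, η₁ p = (a + p.2 * Complex.I) * η p := fun p => by
    rw [hη₁, add_apply, smul_apply, smul_apply, mulSnd_apply, smul_eq_mul, smul_eq_mul]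
    ring
  have hderiv : ∀ x t : ℝ, -δ < t → (∂_{((0, 1) : ℝ × ℝ)} ζ : 𝓢(ℝ × ℝ, ℂ)) (x, t) =
      -(Complex.exp (-a * t) *
        ∫ y : ℝ, schwartzSlice x η₁ y * Complex.exp (-Complex.I * y * t)) := fun x t ht => by
    have h1 := hasDerivAt_snd ζ x t
    have hexp : HasDerivAt (fun t : ℝ => Complex.exp (-a * t)) (Complex.exp (-a * t) * -a) t := by
      have := (((hasDerivAt_id (t : ℂ)).const_mul (-a : ℂ)).cexp).comp_ofReal
      simpa using this
    have h2 := hexp.mul (hasDerivAt_integral_mul_exp η x t)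
    have h3 := h2.congr_of_eventuallyEq (f₁ := fun t => ζ (x, t))
      (by filter_upwards [lt_mem_nhds ht] with t' ht' using hζ x t' ht')
    rw [h1.unique h3]
    have hint : ∀ ψ : 𝓢(ℝ × ℝ, ℂ), Integrable fun y : ℝ =>
        ψ (x, y) * Complex.exp (-Complex.I * y * t) := fun ψ => by
      have := integrable_slice_mul_exp ψ (x, -t)
      refine this.congr (Eventually.of_forall fun y => ?_)
      simp only
      congr 2
      push_cast
      ring
    have h4 : ∫ y : ℝ, schwartzSlice x η₁ y * Complex.exp (-Complex.I * y * t) =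
        a * (∫ y : ℝ, η (x, y) * Complex.exp (-Complex.I * y * t)) +
        ∫ y : ℝ, (Complex.I • mulSnd η) (x, y) * Complex.exp (-Complex.I * y * t) := by
      rw [← integral_const_mul, ← integral_add ((hint η).const_mul _) (hint _)]
      congr 1 with y
      rw [schwartzSlice_apply, hη₁, add_apply, smul_apply, smul_eq_mul]
      ring
    rw [h4]
    ring
  have hR : Integrable fun p : ℝ × ℝ => waveSymbol μσ με p.1 (a + p.2 * Complex.I) /
      (a + p.2 * Complex.I) ^ 2 * η₁ p := by
    refine η₁.integrable.bdd_mul (c := K * (1 + a ^ (-(1 / 2) : ℝ)) / a ^ 2)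
      (h.continuous_vertical ha).aestronglyMeasurable (Eventually.of_forall fun p => ?_)
    refine (hbK a ha _ _ (by simp)).trans ?_
    gcongr
    simpa [abs_of_pos ha] using abs_le_norm_add_mul_I a p.2
  have hRHS : ∫ p : ℝ × ℝ, STilde μσ με p.1 (a + Complex.I * p.2) * η p =
      ∫ p : ℝ × ℝ, waveSymbol μσ με p.1 (a + p.2 * Complex.I) /
        (a + p.2 * Complex.I) ^ 2 * η₁ p := by
    congr 1 with p
    have hne := add_mul_I_ne_zero ha p.2
    rw [mul_comm Complex.I, STilde_eq, hη₁_apply]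
    field_simp
  rw [TemperedDistribution.lineDerivOp_apply_apply, hT, hRHS, Measure.volume_eq_prod,
    integral_prod _ hR, integral_prod _ (integrable_mul_schwartz h.continuous_wavePrimitive hb _)]
  congr 1 with x
  refine Eq.trans ?_ (h.integral_lineIntegral_mul ha x (schwartzSlice x η₁))
  congr 1 with t
  rw [← h.wavePrimitive_eq ha (x, t)]
  -- For t ≤ -δ nothing is known about ζ, but the primitive vanishes there.
  rcases lt_or_ge (-δ) t with ht | ht
  · rw [neg_apply, hderiv x t ht, neg_neg]
  · have : wavePrimitive μσ με (x, t) = 0 := h.wavePrimitive_eq_zero hk hk0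
      (lt_of_lt_of_le (by linarith : t < 0) (by positivity))
    rw [this, zero_mul, zero_mul]

theorem isClosed_cone (k : ℝ) : IsClosed (cone k) :=
  isClosed_le (by fun_prop) continuous_snd

end Distribution

/-! ### The kernel inside the cone -/

section Kernel

variable {μσ με : Measure unitInterval} [IsFiniteMeasure μσ] [IsFiniteMeasure με]

theorem exists_between_mul_lt {k y t : ℝ} (hk : 0 ≤ k) (h : k * y < t) :
    ∃ y' > y, ∃ t' < t, k * y' < t' := by
  have hd : 0 < t - k * y := by linarith
  refine ⟨y + (t - k * y) / (4 * (k + 1)), by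
    have : 0 < (t - k * y) / (4 * (k + 1)) := by positivity
    linarith, t - (t - k * y) / 2, by linarith, ?_⟩
  have e : k * ((t - k * y) / (4 * (k + 1))) = (t - k * y) / 4 * (k / (k + 1)) := by
    field_simp
  have h1 : k / (k + 1) ≤ 1 := (div_le_one (by positivity)).2 (by linarith)
  rw [mul_add, e]
  nlinarith

/-- Three regimes for the exponent Re s (t - |x||Ψ|). For 0 ≤ Re s ≤ 1 it is at most t. For Re s ≤ 0
and large r, Ψ is so close to k that t ≥ |x||Ψ|, and it is non-positive. For bounded r it is bounded
because r|Ψ| is. -/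
theorem IsModel.exists_norm_Psi_mul_exp_le (h : IsModel μσ με) {k : ℝ} (hk0 : 0 ≤ k)
    (hk : TendstoUniformlyOn (Psi μσ με) (fun _ => (k : ℂ)) atTop (Icc (-Real.pi) Real.pi))
    {x₁ t₁ : ℝ} (t₂ : ℝ) (hx₁ : 0 ≤ x₁) (h₁ : k * x₁ < t₁) :
    ∃ C > 0, ∀ x : ℝ, |x| ≤ x₁ → ∀ t ∈ Icc t₁ t₂, ∀ r, 0 < r → ∀ θ ∈ Icc (-Real.pi) Real.pi,
      r * Real.cos θ ≤ 1 →
      ‖Psi μσ με r θ * Complex.exp (-(|x| : ℝ) * (r * Complex.exp (θ * Complex.I)) * Psi μσ με r θ +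
        r * Complex.exp (θ * Complex.I) * t)‖ ≤ C * (1 + r ^ (-(1 / 2) : ℝ)) := by
  obtain ⟨C, hC, hΨ⟩ := h.exists_norm_Psi_le
  have hev : ∀ᶠ r : ℝ in atTop, ∀ θ ∈ Icc (-Real.pi) Real.pi, x₁ * ‖Psi μσ με r θ‖ ≤ t₁ := by
    -- Dividing by x₁ + 1 instead of x₁ keeps the tolerance meaningful at x₁ = 0.
    have hε : 0 < (t₁ - k * x₁) / (x₁ + 1) := div_pos (by linarith) (by linarith)
    filter_upwards [Metric.tendstoUniformlyOn_iff.1 hk _ hε] with r hr θ hθ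
    have h2 := hr θ hθ
    rw [dist_comm, dist_eq_norm] at h2
    have h3 : ‖Psi μσ με r θ‖ ≤ k + (t₁ - k * x₁) / (x₁ + 1) := by
      have := norm_sub_norm_le (Psi μσ με r θ) k
      rw [Complex.norm_real, Real.norm_of_nonneg hk0] at this
      linarith
    have h4 : x₁ * ((t₁ - k * x₁) / (x₁ + 1)) ≤ t₁ - k * x₁ := by
      rw [mul_div_assoc', div_le_iff₀ (by linarith)]
      nlinarith
    nlinarith [mul_le_mul_of_nonneg_left h3 hx₁]
  obtain ⟨R, hR⟩ := (hev.and (eventually_ge_atTop 0)).exists_forall_of_atTop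
  have hR0 : 0 ≤ R := (hR R le_rfl).2
  refine ⟨C * Real.exp (|t₂| + x₁ * C * (1 + 2 * R)), by positivity,
    fun x hx t ht r hr θ hθ hrθ => ?_⟩
  have ht0 : 0 < t := lt_of_lt_of_le (lt_of_le_of_lt (by positivity) h₁) ht.1
  have ht2 : t ≤ |t₂| := ht.2.trans (le_abs_self _)
  have hE : Real.exp (r * Real.cos θ * (t - |x| * ‖Psi μσ με r θ‖)) ≤
      Real.exp (|t₂| + x₁ * C * (1 + 2 * R)) := by
    rw [Real.exp_le_exp]
    have hn : 0 ≤ x₁ * C * (1 + 2 * R) := by positivity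
    have hxΨ : |x| * ‖Psi μσ με r θ‖ ≤ x₁ * ‖Psi μσ με r θ‖ := by gcongr
    have hxΨ0 : 0 ≤ |x| * ‖Psi μσ με r θ‖ := by positivity
    rcases le_total 0 (Real.cos θ) with hc | hc
    · have h0 : 0 ≤ r * Real.cos θ := by positivity
      nlinarith [mul_nonneg h0 hxΨ0, mul_le_mul_of_nonneg_right hrθ ht0.le]
    · have h0 : r * Real.cos θ ≤ 0 := mul_nonpos_of_nonneg_of_nonpos hr.le hc
      rcases le_total R r with hRr | hRr
      · have := (hR r hRr).1 θ hθ
        have h1 : 0 ≤ t - |x| * ‖Psi μσ με r θ‖ := by linarith [ht.1]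
        linarith [mul_nonpos_of_nonpos_of_nonneg h0 h1, abs_nonneg t₂]
      · have hrr : r * r ^ (-(1 / 2) : ℝ) ≤ 1 + r := by
          have e : r * r ^ (-(1 / 2) : ℝ) = r ^ (1 / 2 : ℝ) := by
            nth_rewrite 1 [← Real.rpow_one r]
            rw [← Real.rpow_add hr]
            norm_num
          rw [e, ← Real.sqrt_eq_rpow]
          nlinarith [Real.sq_sqrt hr.le, sq_nonneg (√r - 1)]
        have hcos : -(r * Real.cos θ) ≤ r := by nlinarith [Real.neg_one_le_cos θ]
        have h5 : -(r * Real.cos θ) * (|x| * ‖Psi μσ με r θ‖) ≤ x₁ * C * (1 + 2 * R) :=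
          calc -(r * Real.cos θ) * (|x| * ‖Psi μσ με r θ‖)
              ≤ r * (x₁ * (C * (1 + r ^ (-(1 / 2) : ℝ)))) := by
                refine mul_le_mul hcos (hxΨ.trans ?_) hxΨ0 hr.le
                exact mul_le_mul_of_nonneg_left (hΨ r hr θ hθ) hx₁
            _ = x₁ * C * (r + r * r ^ (-(1 / 2) : ℝ)) := by ring
            _ ≤ _ := by
                refine mul_le_mul_of_nonneg_left ?_ (by positivity)
                linarith
        nlinarith [mul_nonpos_of_nonpos_of_nonneg h0 ht0.le, abs_nonneg t₂]
  rw [norm_mul]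
  calc _ ≤ C * (1 + r ^ (-(1 / 2) : ℝ)) * Real.exp (|t₂| + x₁ * C * (1 + 2 * R)) :=
        mul_le_mul (hΨ r hr θ hθ) ((h.norm_exp_le hr hθ x t).trans hE) (norm_nonneg _)
          (by positivity)
    _ = _ := by ring

omit [IsFiniteMeasure μσ] [IsFiniteMeasure με] in
theorem cutIntegrand_eq (x t q : ℝ) : cutIntegrand μσ με x t q =
    Psi μσ με q (-Real.pi) * Complex.exp (-(|x| : ℝ) * (q * Complex.exp ((-Real.pi : ℝ) *
      Complex.I)) * Psi μσ με q (-Real.pi) + q * Complex.exp ((-Real.pi : ℝ) * Complex.I) * t) -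
    Psi μσ με q Real.pi * Complex.exp (-(|x| : ℝ) * (q * Complex.exp (Real.pi * Complex.I)) *
      Psi μσ με q Real.pi + q * Complex.exp (Real.pi * Complex.I) * t) := by
  have e : Complex.exp ((-Real.pi : ℝ) * Complex.I) = -1 := by
    rw [Complex.ofReal_neg, neg_mul, Complex.exp_neg, Complex.exp_pi_mul_I]
    norm_num
  have e' : ∀ z : ℂ, Complex.exp (-(|x| : ℝ) * (q * -1) * z + q * -1 * t) =
      Complex.exp ((|x| : ℝ) * q * z) * Complex.exp (-q * t) := fun z => by
    rw [← Complex.exp_add]; congr 1; ring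
  rw [cutIntegrand, e, Complex.exp_pi_mul_I, e', e']
  ring

omit [IsFiniteMeasure μσ] [IsFiniteMeasure με] in
theorem cutIntegrand_eq_mul_exp (x t t' q : ℝ) : cutIntegrand μσ με x t q =
    cutIntegrand μσ με x t' q * Complex.exp (-q * (t - t')) := by
  have e : Complex.exp (-q * t) = Complex.exp (-q * t') * Complex.exp (-q * (t - t')) := by
    rw [← Complex.exp_add]; congr 1; ring
  rw [cutIntegrand, cutIntegrand, e, ← mul_assoc]

theorem one_add_sq_mul_exp_neg_le {δ q : ℝ} (hδ : 0 < δ) (hq : 0 ≤ q) :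
    Real.exp (-q * δ) ≤ (1 + 2 / δ ^ 2) / (1 + q ^ 2) := by
  have h1 := Real.quadratic_le_exp_of_nonneg (mul_nonneg hq hδ.le)
  have h2 : Real.exp (-q * δ) * Real.exp (q * δ) = 1 := by
    rw [← Real.exp_add]; simp
  have h3 : 1 + q ^ 2 ≤ (1 + 2 / δ ^ 2) * Real.exp (q * δ) := by
    have e : q ^ 2 = 2 / δ ^ 2 * ((q * δ) ^ 2 / 2) := by field_simp
    have h4 : 1 ≤ Real.exp (q * δ) := Real.one_le_exp (by positivity)
    have h5 : (q * δ) ^ 2 / 2 ≤ Real.exp (q * δ) := by nlinarith [mul_nonneg hq hδ.le]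
    have := mul_le_mul_of_nonneg_left h5 (show 0 ≤ 2 / δ ^ 2 by positivity)
    linarith
  rw [le_div_iff₀ (by positivity)]
  calc Real.exp (-q * δ) * (1 + q ^ 2)
      ≤ Real.exp (-q * δ) * ((1 + 2 / δ ^ 2) * Real.exp (q * δ)) := by gcongr
    _ = (1 + 2 / δ ^ 2) * (Real.exp (-q * δ) * Real.exp (q * δ)) := by ring
    _ = _ := by rw [h2, mul_one]

/-- The uniform bound is applied at a time t₀ strictly between k x₁ and t₁. The remaining factor
e^{-q(t - t₀)} supplies the quadratic decay. -/
theorem IsModel.exists_norm_cutIntegrand_le (h : IsModel μσ με) {k : ℝ} (hk0 : 0 ≤ k)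
    (hk : TendstoUniformlyOn (Psi μσ με) (fun _ => (k : ℂ)) atTop (Icc (-Real.pi) Real.pi))
    {x₁ t₁ : ℝ} (hx₁ : 0 ≤ x₁) (h₁ : k * x₁ < t₁) :
    ∃ C > 0, ∀ x : ℝ, |x| ≤ x₁ → ∀ t, t₁ ≤ t → ∀ q, 0 < q →
      ‖cutIntegrand μσ με x t q‖ ≤ C * rootDecay q := by
  obtain ⟨t₀, h₀, ht₀⟩ := exists_between h₁
  obtain ⟨C, hC, hb⟩ := h.exists_norm_Psi_mul_exp_le hk0 hk t₀ hx₁ h₀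
  have hδ : 0 < t₁ - t₀ := sub_pos.2 ht₀
  refine ⟨2 * C * (1 + 2 / (t₁ - t₀) ^ 2), by positivity, fun x hx t ht q hq => ?_⟩
  have hpi := Real.pi_pos
  have h1 := hb x hx t₀ ⟨le_rfl, le_rfl⟩ q hq Real.pi ⟨by linarith, le_rfl⟩ (by
    rw [Real.cos_pi]; linarith)
  have h2 := hb x hx t₀ ⟨le_rfl, le_rfl⟩ q hq (-Real.pi) ⟨le_rfl, by linarith⟩ (by
    rw [Real.cos_neg, Real.cos_pi]; linarith)
  have h3 : ‖cutIntegrand μσ με x t₀ q‖ ≤ 2 * C * (1 + q ^ (-(1 / 2) : ℝ)) := by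
    rw [cutIntegrand_eq]
    refine (norm_sub_le _ _).trans ((add_le_add h2 h1).trans (le_of_eq ?_))
    ring
  have h4 : ‖Complex.exp (-q * (t - t₀))‖ ≤ (1 + 2 / (t₁ - t₀) ^ 2) / (1 + q ^ 2) := by
    have e : (-q * (t - t₀) : ℂ) = ((-q * (t - t₀) : ℝ) : ℂ) := by push_cast; ring
    rw [e, Complex.norm_exp_ofReal]
    refine le_trans ?_ (one_add_sq_mul_exp_neg_le hδ hq.le)
    rw [Real.exp_le_exp]
    nlinarith
  rw [cutIntegrand_eq_mul_exp x t t₀, norm_mul]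
  refine (mul_le_mul h3 h4 (norm_nonneg _) (by positivity)).trans (le_of_eq ?_)
  rw [rootDecay]
  ring

theorem IsModel.continuousOn_cutIntegrand (h : IsModel μσ με) (x : ℝ) :
    ContinuousOn (fun p : ℝ × ℝ => cutIntegrand μσ με x p.1 p.2) (univ ×ˢ Ioi 0) := by
  have hpi := Real.pi_pos
  have hΨ : ∀ θ ∈ Icc (-Real.pi) Real.pi,
      ContinuousOn (fun p : ℝ × ℝ => Psi μσ με p.2 θ) (univ ×ˢ Ioi 0) := fun θ hθ =>
    h.continuousOn_Psi.comp (f := fun p : ℝ × ℝ => (p.2, θ)) (by fun_prop)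
      fun p hp => ⟨hp.2, hθ⟩
  have h1 := hΨ Real.pi ⟨by linarith, le_rfl⟩
  have h2 := hΨ (-Real.pi) ⟨le_rfl, by linarith⟩
  unfold cutIntegrand
  fun_prop

theorem IsModel.continuousOn_cutIntegrand_right (h : IsModel μσ με) (x t : ℝ) :
    ContinuousOn (cutIntegrand μσ με x t) (Ioi 0) :=
  (h.continuousOn_cutIntegrand x).comp (f := fun q : ℝ => (t, q)) (by fun_prop)
    fun q hq => ⟨mem_univ _, hq⟩

theorem IsModel.integrableOn_cutIntegrand (h : IsModel μσ με) {k : ℝ} (hk0 : 0 ≤ k)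
    (hk : TendstoUniformlyOn (Psi μσ με) (fun _ => (k : ℂ)) atTop (Icc (-Real.pi) Real.pi))
    {x t : ℝ} (hp : (x, t) ∈ openCone k) : IntegrableOn (cutIntegrand μσ με x t) (Ioi 0) := by
  obtain ⟨C, hC, hb⟩ := h.exists_norm_cutIntegrand_le hk0 hk (abs_nonneg x) hp
  exact (integrableOn_rootDecay.const_mul C).mono'
    ((h.continuousOn_cutIntegrand_right x t).aestronglyMeasurable measurableSet_Ioi)
    ((ae_restrict_iff' measurableSet_Ioi).2 (Eventually.of_forall fun q hq =>
      hb x le_rfl t le_rfl q hq))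

theorem isOpen_openCone (k : ℝ) : IsOpen (openCone k) :=
  isOpen_lt (by fun_prop) continuous_snd

theorem IsModel.continuousOn_KCone (h : IsModel μσ με) {k : ℝ} (hk0 : 0 ≤ k)
    (hk : TendstoUniformlyOn (Psi μσ με) (fun _ => (k : ℂ)) atTop (Icc (-Real.pi) Real.pi)) :
    ContinuousOn (KCone μσ με) (openCone k) := by
  intro p hp
  obtain ⟨x₁, hx₁, t₁, ht₁, h₁⟩ := exists_between_mul_lt hk0 (show k * |p.1| < p.2 from hp)
  obtain ⟨C, hC, hb⟩ := h.exists_norm_cutIntegrand_le hk0 hk ((abs_nonneg _).trans hx₁.le) h₁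
  have hn : ∀ᶠ p' : ℝ × ℝ in nhds p, |p'.1| ≤ x₁ ∧ t₁ ≤ p'.2 := by
    have h2 : ∀ᶠ p' : ℝ × ℝ in nhds p, |p'.1| < x₁ :=
      (isOpen_lt (by fun_prop) continuous_const).mem_nhds hx₁
    have h3 : ∀ᶠ p' : ℝ × ℝ in nhds p, t₁ < p'.2 :=
      (isOpen_lt continuous_const continuous_snd).mem_nhds ht₁
    filter_upwards [h2, h3] with p' h2 h3 using ⟨h2.le, h3.le⟩
  have hc : ContinuousAt (fun p : ℝ × ℝ => ∫ q in Ioi (0 : ℝ), cutIntegrand μσ με p.1 p.2 q) p := by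
    refine continuousAt_of_dominated (bound := fun q => C * rootDecay q)
      (Eventually.of_forall fun p' => (h.continuousOn_cutIntegrand_right _ _).aestronglyMeasurable
        measurableSet_Ioi) ?_ (integrableOn_rootDecay.const_mul C)
      (Eventually.of_forall fun q => ?_)
    · filter_upwards [hn] with p' hp'
      exact (ae_restrict_iff' measurableSet_Ioi).2 (Eventually.of_forall fun q hq =>
        hb _ hp'.1 _ hp'.2 q hq)
    · unfold cutIntegrand
      fun_prop
  exact (continuousAt_const.mul hc).continuousWithinAt

end Kernel

/-! ### The Hankel contour -/

section Laplace

/-- The two-sided Laplace transform, with kernel `e^{st}`. -/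
def expTransform (f : ℝ → ℂ) (s : ℂ) : ℂ := ∫ t : ℝ, Complex.exp (s * t) * f t

theorem integrable_exp_mul {f : ℝ → ℂ} (hf : Continuous f) (hfc : HasCompactSupport f) (s : ℂ) :
    Integrable fun t : ℝ => Complex.exp (s * t) * f t :=
  (by fun_prop : Continuous fun t : ℝ => Complex.exp (s * t) * f t).integrable_of_hasCompactSupport
    (hfc.mul_left (f := fun t : ℝ => Complex.exp (s * t)))

theorem differentiable_expTransform {f : ℝ → ℂ} (hf : Continuous f) (hfc : HasCompactSupport f) :
    Differentiable ℂ (expTransform f) := fun s₀ => by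
  have hbound : Integrable fun t : ℝ => |t| * Real.exp ((‖s₀‖ + 1) * |t|) * ‖f t‖ :=
    (by fun_prop : Continuous fun t : ℝ => |t| * Real.exp ((‖s₀‖ + 1) * |t|) *
      ‖f t‖).integrable_of_hasCompactSupport
      (hfc.norm.mul_left (f := fun t : ℝ => |t| * Real.exp ((‖s₀‖ + 1) * |t|)))
  refine (hasDerivAt_integral_of_dominated_loc_of_deriv_le (𝕜 := ℂ) (μ := volume)
    (F := fun s (t : ℝ) => Complex.exp (s * t) * f t)
    (F' := fun s (t : ℝ) => Complex.exp (s * t) * t * f t)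
    (Metric.ball_mem_nhds s₀ one_pos)
    (Eventually.of_forall fun s => (integrable_exp_mul hf hfc s).aestronglyMeasurable)
    (integrable_exp_mul hf hfc s₀)
    (by fun_prop : Continuous fun t : ℝ => Complex.exp (s₀ * t) * t * f t).aestronglyMeasurable
    (Eventually.of_forall fun t s hs => ?_) hbound
    (Eventually.of_forall fun t s _ => ?_)).2.differentiableAt
  · rw [norm_mul, norm_mul, Complex.norm_real, Real.norm_eq_abs, mul_comm _ |t|]
    gcongr
    refine (Complex.norm_exp_le_exp_norm _).trans (Real.exp_le_exp.2 ?_)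
    rw [norm_mul, Complex.norm_real, Real.norm_eq_abs]
    have : ‖s‖ ≤ ‖s₀‖ + 1 := by
      have h1 := norm_sub_norm_le s s₀
      have h2 := mem_ball_iff_norm.1 hs
      linarith
    gcongr
  · have := ((hasDerivAt_id s).mul_const (t : ℂ)).cexp.mul_const (f t)
    simpa using this

theorem mul_expTransform {f : ℝ → ℂ} (hf : ContDiff ℝ 1 f) (hfc : HasCompactSupport f) (s : ℂ) :
    s * expTransform f s = -expTransform (deriv f) s := by
  have hexp : ∀ t : ℝ, HasDerivAt (fun t : ℝ => Complex.exp (s * t)) (Complex.exp (s * t) * s) t :=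
    fun t => by
      have := (((hasDerivAt_id (t : ℂ)).const_mul s).cexp).comp_ofReal
      simpa using this
  have h1 := integral_mul_deriv_eq_deriv_mul_of_integrable (u := fun t : ℝ => Complex.exp (s * t))
    (v := f) (u' := fun t : ℝ => Complex.exp (s * t) * s) (v' := deriv f)
    (fun t _ => hexp t) (fun t _ => (hf.differentiable one_ne_zero t).hasDerivAt)
    (integrable_exp_mul (hf.continuous_deriv le_rfl) hfc.deriv s)
    (((integrable_exp_mul hf.continuous hfc s).const_mul s).congr
      (Eventually.of_forall fun t => by simp only [Pi.mul_apply]; ring))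
    (integrable_exp_mul hf.continuous hfc s)
  rw [expTransform, expTransform, h1, neg_neg, ← integral_const_mul]
  congr 1 with t
  ring

theorem sq_mul_expTransform {f : ℝ → ℂ} (hf : ContDiff ℝ 2 f) (hfc : HasCompactSupport f) (s : ℂ) :
    s ^ 2 * expTransform f s = expTransform (deriv (deriv f)) s := by
  have hf' : ContDiff ℝ 1 (deriv f) := (contDiff_succ_iff_deriv.1 hf).2.2
  rw [sq, mul_assoc, mul_expTransform (hf.of_le one_le_two) hfc, mul_neg,
    mul_expTransform hf' hfc.deriv, neg_neg]

theorem conj_expTransform (f : ℝ → ℂ) (s : ℂ) :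
    (starRingEnd ℂ) (expTransform f s) =
      expTransform (fun t => (starRingEnd ℂ) (f t)) ((starRingEnd ℂ) s) := by
  rw [expTransform, expTransform, ← integral_conj]
  congr 1 with t
  rw [map_mul, ← Complex.exp_conj, map_mul, Complex.conj_ofReal]

variable {μσ με : Measure unitInterval} [IsFiniteMeasure μσ] [IsFiniteMeasure με]

/-- The same bound holds for f and for its second derivative, whose transform carries a factor s².
Adding the two gives the weight 1 + |s|². -/
theorem IsModel.exists_norm_waveSymbol_mul_expTransform_le (h : IsModel μσ με) {k : ℝ}
    (hk0 : 0 ≤ k)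
    (hk : TendstoUniformlyOn (Psi μσ με) (fun _ => (k : ℂ)) atTop (Icc (-Real.pi) Real.pi))
    {x t₁ t₂ : ℝ} (hx : k * |x| < t₁) {f : ℝ → ℂ} (hf : ContDiff ℝ 2 f)
    (hfs : tsupport f ⊆ Icc t₁ t₂) : ∃ C, ∀ s : ℂ, s ≠ 0 → s.re ≤ 1 →
      ‖waveSymbol μσ με x s * expTransform f s‖ ≤ C * rootDecay ‖s‖ := by
  obtain ⟨C, hC, hb⟩ := h.exists_norm_Psi_mul_exp_le hk0 hk t₂ (abs_nonneg x) hx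
  have hfc : HasCompactSupport f := isCompact_Icc.of_isClosed_subset (isClosed_tsupport f) hfs
  have key : ∀ g : ℝ → ℂ, Continuous g → HasCompactSupport g → tsupport g ⊆ Icc t₁ t₂ →
      ∀ s : ℂ, s ≠ 0 → s.re ≤ 1 → ‖waveSymbol μσ με x s * expTransform g s‖ ≤
        C * (1 + ‖s‖ ^ (-(1 / 2) : ℝ)) * ∫ t, ‖g t‖ := fun g hg hgc hgs s hs0 hs => by
    rw [expTransform, ← integral_const_mul, ← integral_const_mul]
    refine norm_integral_le_of_norm_le ((hg.integrable_of_hasCompactSupport hgc).norm.const_mul _)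
      (Eventually.of_forall fun t => ?_)
    by_cases ht : t ∈ Icc t₁ t₂
    · have h1 := hb x le_rfl t ht ‖s‖ (norm_pos_iff.2 hs0) s.arg (arg_mem_Icc s)
        (by rwa [Complex.norm_mul_cos_arg])
      rw [Complex.norm_mul_exp_arg_mul_I] at h1
      have e : waveSymbol μσ με x s * (Complex.exp (s * t) * g t) = 1 / 2 *
          (planePsi μσ με s * Complex.exp (-(|x| : ℝ) * s * planePsi μσ με s + s * t)) * g t := by
        rw [waveSymbol, Complex.exp_add]
        ring
      rw [e, norm_mul, norm_mul]
      refine mul_le_mul_of_nonneg_right ?_ (norm_nonneg _)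
      change ‖planePsi μσ με s * Complex.exp (-(|x| : ℝ) * s * planePsi μσ με s + s * t)‖ ≤ _ at h1
      have h2 : ‖(1 / 2 : ℂ)‖ ≤ 1 := by norm_num
      calc _ ≤ 1 * ‖planePsi μσ με s *
              Complex.exp (-(|x| : ℝ) * s * planePsi μσ με s + s * t)‖ := by gcongr
        _ ≤ _ := by rwa [one_mul]
    · simp [image_eq_zero_of_notMem_tsupport fun h' => ht (hgs h')]
  have hf' : ContDiff ℝ 1 (deriv f) := (contDiff_succ_iff_deriv.1 hf).2.2
  have h1 := key f hf.continuous hfc hfs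
  have h2 := key (deriv (deriv f)) (hf'.continuous_deriv le_rfl) hfc.deriv.deriv
    (((tsupport_deriv_subset (𝕜 := ℝ)).trans (tsupport_deriv_subset (𝕜 := ℝ))).trans hfs)
  refine ⟨C * ((∫ t, ‖f t‖) + ∫ t, ‖deriv (deriv f) t‖), fun s hs0 hs => ?_⟩
  have h3 := h2 s hs0 hs
  rw [← sq_mul_expTransform hf hfc, mul_left_comm, norm_mul, norm_pow] at h3
  have h4 := add_le_add (h1 s hs0 hs) h3
  rw [rootDecay, mul_div_assoc', le_div_iff₀ (by positivity)]
  linarith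

theorem IsModel.waveSymbol_conj (h : IsModel μσ με) (x : ℝ) {s : ℂ} (hs : s ∈ Complex.slitPlane) :
    waveSymbol μσ με x ((starRingEnd ℂ) s) = (starRingEnd ℂ) (waveSymbol μσ με x s) := by
  have h1 : planePsi μσ με ((starRingEnd ℂ) s) = (starRingEnd ℂ) (planePsi μσ με s) := by
    rw [planePsi, planePsi, RCLike.norm_conj, Complex.arg_conj,
      if_neg (Complex.mem_slitPlane_iff_arg.1 hs).1,
      h.Psi_neg (norm_pos_iff.2 (Complex.slitPlane_ne_zero hs)) (arg_mem_Icc s)]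
  rw [waveSymbol, waveSymbol, h1, map_mul, ← Complex.exp_conj, map_mul, map_mul, map_neg,
    Complex.conj_ofReal, map_div₀, Complex.conj_ofNat]

/-- `waveSymbol` takes its boundary values from above on the branch cut. -/
theorem IsModel.tendsto_waveSymbol (h : IsModel μσ με) (x : ℝ) {u : ℝ} (hu : u ≠ 0) :
    Tendsto (fun ρ : ℝ => waveSymbol μσ με x (u + ρ * Complex.I)) (nhdsWithin 0 (Ioi 0))
      (nhds (waveSymbol μσ με x u)) := by
  have hu' : (u : ℂ) ≠ 0 := by exact_mod_cast hu
  have h0 : Tendsto (fun ρ : ℝ => (u + ρ * Complex.I : ℂ)) (nhdsWithin 0 (Ioi 0)) (nhds u) := by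
    have : Continuous fun ρ : ℝ => (u + ρ * Complex.I : ℂ) := by fun_prop
    simpa using (this.tendsto 0).mono_left nhdsWithin_le_nhds
  have harg : Tendsto (fun ρ : ℝ => (u + ρ * Complex.I : ℂ).arg) (nhdsWithin 0 (Ioi 0))
      (nhds (u : ℂ).arg) := by
    rcases hu.lt_or_gt with hneg | hpos
    · rw [Complex.arg_ofReal_of_neg hneg]
      refine (Complex.tendsto_arg_nhdsWithin_im_nonneg_of_re_neg_of_im_zero (z := u) (by simpa)
        (by simp)).comp (tendsto_nhdsWithin_iff.2 ⟨h0, ?_⟩)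
      exact eventually_nhdsWithin_of_forall fun ρ (hρ : 0 < ρ) => by simpa using hρ.le
    · exact (Complex.continuousAt_arg (Complex.ofReal_mem_slitPlane.2 hpos)).tendsto.comp h0
  have hΨ : Tendsto (fun ρ : ℝ => planePsi μσ με (u + ρ * Complex.I)) (nhdsWithin 0 (Ioi 0))
      (nhds (planePsi μσ με u)) := by
    refine (h.continuousOn_Psi (‖(u : ℂ)‖, (u : ℂ).arg)
      ⟨norm_pos_iff.2 hu', arg_mem_Icc _⟩).tendsto.comp (f := fun ρ : ℝ =>
        (‖(u + ρ * Complex.I : ℂ)‖, (u + ρ * Complex.I : ℂ).arg)) (tendsto_nhdsWithin_iff.2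
        ⟨h0.norm.prodMk_nhds harg, eventually_nhdsWithin_of_forall fun ρ (hρ : 0 < ρ) =>
          ⟨norm_pos_iff.2 fun h' => ?_, arg_mem_Icc _⟩⟩)
    have := congrArg Complex.im h'
    simp at this
    exact hρ.ne' this
  exact (hΨ.div_const 2).mul ((h0.const_mul _).mul hΨ).cexp

theorem IsModel.integral_waveSymbol_quadrant (h : IsModel μσ με) {k : ℝ} (hk0 : 0 ≤ k)
    (hk : TendstoUniformlyOn (Psi μσ με) (fun _ => (k : ℂ)) atTop (Icc (-Real.pi) Real.pi))
    {x t₁ t₂ : ℝ} (hx : k * |x| < t₁) {f : ℝ → ℂ} (hf : ContDiff ℝ 2 f)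
    (hfs : tsupport f ⊆ Icc t₁ t₂) :
    (∫ u in Iic (1 : ℝ), waveSymbol μσ με x u * expTransform f u) +
      Complex.I * ∫ y in Ioi (0 : ℝ), waveSymbol μσ με x (1 + y * Complex.I) *
        expTransform f (1 + y * Complex.I) = 0 := by
  have hfc : HasCompactSupport f := isCompact_Icc.of_isClosed_subset (isClosed_tsupport f) hfs
  obtain ⟨C, hb⟩ := h.exists_norm_waveSymbol_mul_expTransform_le hk0 hk hx hf hfs
  have hL := differentiable_expTransform hf.continuous hfc
  refine integral_quadrant_eq_zero (F := fun s => waveSymbol μσ με x s * expTransform f s)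
    (C := C) ?_ (fun s hs hs1 => hb s (fun h0 => by simp [h0] at hs) hs1) fun u hu => ?_
  · exact ((h.differentiableOn_waveSymbol x).mono fun s (hs : 0 < s.im) => Or.inr hs.ne').mul
      hL.differentiableOn
  · have h0 : Continuous fun ρ : ℝ => expTransform f (u + ρ * Complex.I) :=
      hL.continuous.comp (f := fun ρ : ℝ => (u + ρ * Complex.I : ℂ)) (by fun_prop)
    have h1 : Tendsto (fun ρ : ℝ => expTransform f (u + ρ * Complex.I)) (nhdsWithin 0 (Ioi 0))
        (nhds (expTransform f u)) := by
      simpa using (h0.tendsto 0).mono_left nhdsWithin_le_nhds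
    exact (h.tendsto_waveSymbol x hu).mul h1

theorem IsModel.integrable_waveSymbol_vertical (h : IsModel μσ με) {k : ℝ} (hk0 : 0 ≤ k)
    (hk : TendstoUniformlyOn (Psi μσ με) (fun _ => (k : ℂ)) atTop (Icc (-Real.pi) Real.pi))
    {x t₁ t₂ : ℝ} (hx : k * |x| < t₁) {f : ℝ → ℂ} (hf : ContDiff ℝ 2 f)
    (hfs : tsupport f ⊆ Icc t₁ t₂) :
    Integrable fun y : ℝ => waveSymbol μσ με x (1 + y * Complex.I) *
      expTransform f (1 + y * Complex.I) := by
  have hfc : HasCompactSupport f := isCompact_Icc.of_isClosed_subset (isClosed_tsupport f) hfs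
  obtain ⟨C, hb⟩ := h.exists_norm_waveSymbol_mul_expTransform_le hk0 hk hx hf hfs
  have hL := differentiable_expTransform hf.continuous hfc
  have hW := (h.continuous_waveSymbol_vertical one_pos).comp (f := fun y : ℝ => (x, y))
    (by fun_prop)
  simp only [Function.comp_def, Complex.ofReal_one] at hW
  have hc : Continuous fun y : ℝ => waveSymbol μσ με x (1 + y * Complex.I) *
      expTransform f (1 + y * Complex.I) :=
    hW.mul (hL.continuous.comp (f := fun y : ℝ => (1 + y * Complex.I : ℂ)) (by fun_prop))
  have hC : 0 ≤ C := by
    have h1 := (norm_nonneg _).trans (hb 1 one_ne_zero (by simp))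
    rw [norm_one, rootDecay] at h1
    norm_num at h1
    exact h1
  refine integrable_vertical (a := 1) (C := C * 2) hc one_pos fun y => ?_
  have h1 : 1 ≤ ‖(1 + y * Complex.I : ℂ)‖ := by simpa using abs_le_norm_add_mul_I 1 y
  have h2 := norm_sq_add_mul_I 1 y
  rw [Complex.ofReal_one] at h2
  refine (hb _ (norm_pos_iff.1 (by linarith)) (by simp)).trans ?_
  rw [← h2, mul_div_assoc]
  gcongr
  exact rootDecay_le h1

theorem IsModel.integrableOn_waveSymbol_real (h : IsModel μσ με) {k : ℝ} (hk0 : 0 ≤ k)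
    (hk : TendstoUniformlyOn (Psi μσ με) (fun _ => (k : ℂ)) atTop (Icc (-Real.pi) Real.pi))
    {x t₁ t₂ : ℝ} (hx : k * |x| < t₁) {f : ℝ → ℂ} (hf : ContDiff ℝ 2 f)
    (hfs : tsupport f ⊆ Icc t₁ t₂) :
    IntegrableOn (fun u : ℝ => waveSymbol μσ με x u * expTransform f u) (Iic 1) := by
  have hfc : HasCompactSupport f := isCompact_Icc.of_isClosed_subset (isClosed_tsupport f) hfs
  obtain ⟨C, hb⟩ := h.exists_norm_waveSymbol_mul_expTransform_le hk0 hk hx hf hfs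
  have hL := differentiable_expTransform hf.continuous hfc
  have hne : ∀ᵐ u : ℝ ∂volume, u ≠ 0 := by simp [ae_iff]
  -- The symbol jumps across the cut, so measurability on the axis comes from its being the limit of
  -- the continuous restrictions to lines just above.
  have hW : AEStronglyMeasurable (fun u : ℝ => waveSymbol μσ με x u) volume := by
    refine aestronglyMeasurable_of_tendsto_ae atTop (f := fun (n : ℕ) (u : ℝ) =>
      waveSymbol μσ με x (u + (1 / ((n : ℝ) + 1) : ℝ) * Complex.I)) (fun n => ?_)
      (hne.mono fun u hu => (h.tendsto_waveSymbol x hu).comp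
        (tendsto_nhdsWithin_iff.2 ⟨tendsto_one_div_add_atTop_nhds_zero_nat,
          Eventually.of_forall fun n => by simp only [mem_Ioi]; positivity⟩))
    refine ((h.differentiableOn_waveSymbol x).continuousOn.comp_continuous (f := fun u : ℝ =>
      (u + (1 / ((n : ℝ) + 1) : ℝ) * Complex.I : ℂ)) (by fun_prop)
      fun u => Or.inr ?_).aestronglyMeasurable
    rw [Complex.add_im, Complex.ofReal_im, zero_add, Complex.im_ofReal_mul, Complex.I_im, mul_one]
    positivity
  refine (integrable_rootDecay_abs.const_mul C).integrableOn.mono'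
    (hW.restrict.mul (hL.continuous.comp Complex.continuous_ofReal).aestronglyMeasurable)
    ((ae_restrict_iff' measurableSet_Iic).2 (hne.mono fun u hu hu1 => ?_))
  simpa using hb u (by exact_mod_cast hu) (by simpa using hu1)

/-- The upper quadrant is treated with f. The lower one is the complex conjugate of the upper
quadrant for the conjugate of f, which gives the boundary values below the cut. The difference of
the two identities joins the half lines into Re s = 1 and leaves the jump on the real axis. -/
theorem IsModel.integral_waveSymbol_hankel (h : IsModel μσ με) {k : ℝ} (hk0 : 0 ≤ k)
    (hk : TendstoUniformlyOn (Psi μσ με) (fun _ => (k : ℂ)) atTop (Icc (-Real.pi) Real.pi))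
    {x t₁ t₂ : ℝ} (hx : k * |x| < t₁) {f : ℝ → ℂ} (hf : ContDiff ℝ 2 f)
    (hfs : tsupport f ⊆ Icc t₁ t₂) :
    Complex.I * ∫ y : ℝ, waveSymbol μσ με x (1 + y * Complex.I) *
      expTransform f (1 + y * Complex.I) =
    ∫ q in Ioi (0 : ℝ), ((starRingEnd ℂ) (waveSymbol μσ με x (-q : ℝ)) -
      waveSymbol μσ με x (-q : ℝ)) * expTransform f (-q : ℝ) := by
  set g : ℝ → ℂ := fun t => (starRingEnd ℂ) (f t) with hg
  have hgd : ContDiff ℝ 2 g := Complex.conjCLE.contDiff.comp hf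
  have hgs : tsupport g ⊆ Icc t₁ t₂ := by
    refine subset_trans (closure_mono fun t ht => ?_) hfs
    simpa [hg] using ht
  have hLg : ∀ s, (starRingEnd ℂ) (expTransform g ((starRingEnd ℂ) s)) = expTransform f s :=
    fun s => by
      rw [conj_expTransform]
      simp [hg]
  have hLg' : ∀ u : ℝ, (starRingEnd ℂ) (expTransform g u) = expTransform f u := fun u => by
    have := hLg u
    rwa [Complex.conj_ofReal] at this
  have hU := h.integral_waveSymbol_quadrant hk0 hk hx hf hfs
  have hV := congrArg (starRingEnd ℂ) (h.integral_waveSymbol_quadrant hk0 hk hx hgd hgs)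
  have hiU := h.integrableOn_waveSymbol_real hk0 hk hx hf hfs
  have hiV : IntegrableOn (fun u : ℝ => (starRingEnd ℂ) (waveSymbol μσ με x u) *
      expTransform f u) (Iic 1) := by
    have := (Complex.conjCLE : ℂ →L[ℝ] ℂ).integrable_comp
      (h.integrableOn_waveSymbol_real hk0 hk hx hgd hgs)
    refine this.congr (Eventually.of_forall fun u => ?_)
    simp [hLg']
  have hline := h.integrable_waveSymbol_vertical hk0 hk hx hf hfs
  have hmir : ∀ y : ℝ, (starRingEnd ℂ) (waveSymbol μσ με x (1 + y * Complex.I) *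
      expTransform g (1 + y * Complex.I)) = waveSymbol μσ με x (1 + (-y : ℝ) * Complex.I) *
        expTransform f (1 + (-y : ℝ) * Complex.I) := fun y => by
    have e : (1 + y * Complex.I : ℂ) = (starRingEnd ℂ) (1 + (-y : ℝ) * Complex.I) := by
      simp
    rw [map_mul, ← h.waveSymbol_conj x (slitPlane_of_re_pos (by simp)), e, hLg, Complex.conj_conj]
  rw [map_add, map_mul, Complex.conj_I, map_zero, ← integral_conj, ← integral_conj] at hV
  simp_rw [hmir] at hV
  rw [integral_comp_neg_Ioi (c := 0) (f := fun y : ℝ => waveSymbol μσ με x (1 + y * Complex.I) *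
    expTransform f (1 + y * Complex.I)), neg_zero] at hV
  simp_rw [map_mul, hLg'] at hV
  have hsplit := intervalIntegral.integral_Iic_add_Ioi (b := 0) hline.integrableOn
    hline.integrableOn
  have hsub := integral_sub hiV hiU
  -- On (0, 1] the symbol is real, so the two sides cancel and only the cut remains.
  have hzero : ∫ u in Iic (1 : ℝ), ((starRingEnd ℂ) (waveSymbol μσ με x u) * expTransform f u -
      waveSymbol μσ με x u * expTransform f u) = ∫ u in Iic (0 : ℝ),
      ((starRingEnd ℂ) (waveSymbol μσ με x u) - waveSymbol μσ με x u) * expTransform f u := by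
    simp_rw [← sub_mul]
    refine setIntegral_eq_of_subset_of_forall_sdiff_eq_zero measurableSet_Iic
      (Iic_subset_Iic.2 zero_le_one) fun u hu => ?_
    have hu0 : 0 < u := not_le.1 hu.2
    have := h.waveSymbol_conj x (Complex.ofReal_mem_slitPlane.2 hu0)
    rw [Complex.conj_ofReal] at this
    rw [← this, sub_self, zero_mul]
  rw [integral_comp_neg_Ioi (c := 0) (f := fun u : ℝ => ((starRingEnd ℂ) (waveSymbol μσ με x u) -
    waveSymbol μσ με x u) * expTransform f u), neg_zero, ← hzero, hsub, ← hsplit]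
  linear_combination hU - hV

/-- A negative real number has argument π, so the symbol at -q is the value on the upper side of the
cut, and its conjugate is the value on the lower side θ = -π. The factor 1/2 is the one in the
symbol. -/
theorem IsModel.cutIntegrand_eq_waveSymbol (h : IsModel μσ με) (x t : ℝ) {q : ℝ} (hq : 0 < q) :
    ((starRingEnd ℂ) (waveSymbol μσ με x (-q : ℝ)) - waveSymbol μσ με x (-q : ℝ)) *
      Complex.exp ((-q : ℝ) * t) = 1 / 2 * cutIntegrand μσ με x t q := by
  have hΨ : planePsi μσ με (-q : ℝ) = Psi μσ με q Real.pi := by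
    rw [planePsi, Complex.arg_ofReal_of_neg (neg_lt_zero.2 hq), Complex.norm_real, norm_neg,
      Real.norm_of_nonneg hq.le]
  have hΨ' := h.Psi_neg hq (θ := Real.pi) ⟨by linarith [Real.pi_pos], le_rfl⟩
  have e : ∀ z : ℂ, -((|x| : ℝ) : ℂ) * (-q : ℝ) * z = (|x| : ℝ) * q * z := fun z => by
    push_cast; ring
  rw [cutIntegrand, waveSymbol, hΨ, e, hΨ', map_mul, ← Complex.exp_conj, map_mul, map_mul,
    map_div₀, Complex.conj_ofNat, Complex.conj_ofReal, Complex.conj_ofReal, Complex.ofReal_neg]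
  ring

/-- Integrating in t first turns e^{-qt} into the transform of f at -q. What results is the integral
over the cut, which the contour deformation identifies with the line Re s = 1. -/
theorem IsModel.integral_KCone_mul (h : IsModel μσ με) {k : ℝ} (hk0 : 0 ≤ k)
    (hk : TendstoUniformlyOn (Psi μσ με) (fun _ => (k : ℂ)) atTop (Icc (-Real.pi) Real.pi))
    {x t₁ t₂ : ℝ} (hx : k * |x| < t₁) {f : ℝ → ℂ} (hf : ContDiff ℝ 2 f)
    (hfs : tsupport f ⊆ Icc t₁ t₂) :
    ∫ t : ℝ, KCone μσ με (x, t) * f t = 1 / (2 * Real.pi) *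
      ∫ y : ℝ, waveSymbol μσ με x (1 + y * Complex.I) * expTransform f (1 + y * Complex.I) := by
  have hfc : HasCompactSupport f := isCompact_Icc.of_isClosed_subset (isClosed_tsupport f) hfs
  obtain ⟨C, hC, hb⟩ := h.exists_norm_cutIntegrand_le hk0 hk (abs_nonneg x) hx
  have hint : Integrable (Function.uncurry fun t q : ℝ => cutIntegrand μσ με x t q * f t)
      (volume.prod (volume.restrict (Ioi 0))) := by
    have hdom : Integrable (fun p : ℝ × ℝ => ‖f p.1‖ * (C * rootDecay p.2))
        (volume.prod (volume.restrict (Ioi 0))) :=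
      (hf.continuous.integrable_of_hasCompactSupport hfc).norm.mul_prod
        (integrableOn_rootDecay.const_mul C)
    have e : (volume : Measure ℝ).prod (volume.restrict (Ioi (0 : ℝ))) =
        (volume.prod volume).restrict (univ ×ˢ Ioi (0 : ℝ)) := by
      rw [← Measure.prod_restrict, Measure.restrict_univ]
    rw [e] at hdom ⊢
    refine hdom.mono' (ContinuousOn.aestronglyMeasurable ?_
      (MeasurableSet.univ.prod measurableSet_Ioi)) ((ae_restrict_iff'
      (MeasurableSet.univ.prod measurableSet_Ioi)).2 (Eventually.of_forall fun p hp => ?_))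
    · exact (h.continuousOn_cutIntegrand x).mul
        (hf.continuous.comp continuous_fst).continuousOn
    · rw [Function.uncurry, norm_mul, mul_comm]
      by_cases ht : p.1 ∈ Icc t₁ t₂
      · exact mul_le_mul_of_nonneg_left (hb x le_rfl _ ht.1 _ hp.2) (norm_nonneg _)
      · simp [image_eq_zero_of_notMem_tsupport fun h' => ht (hfs h')]
  have h1 : ∫ q in Ioi (0 : ℝ), ((starRingEnd ℂ) (waveSymbol μσ με x (-q : ℝ)) -
      waveSymbol μσ με x (-q : ℝ)) * expTransform f (-q : ℝ) =
      ∫ q in Ioi (0 : ℝ), 1 / 2 * ∫ t : ℝ, cutIntegrand μσ με x t q * f t := by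
    refine setIntegral_congr_fun measurableSet_Ioi fun q hq => ?_
    simp only [expTransform]
    rw [← integral_const_mul, ← integral_const_mul]
    congr 1 with t
    rw [← mul_assoc, h.cutIntegrand_eq_waveSymbol x t hq, mul_assoc]
  have h2 := h.integral_waveSymbol_hankel hk0 hk hx hf hfs
  rw [h1, integral_const_mul, ← integral_integral_swap hint] at h2
  have h3 : ∫ t : ℝ, KCone μσ με (x, t) * f t = 1 / (4 * Real.pi * Complex.I) *
      ∫ t : ℝ, ∫ q in Ioi (0 : ℝ), cutIntegrand μσ με x t q * f t := by
    rw [← integral_const_mul]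
    congr 1 with t
    rw [KCone, integral_mul_const, mul_assoc]
  have hpi : (Real.pi : ℂ) ≠ 0 := by exact_mod_cast Real.pi_ne_zero
  have h4 : ∫ t : ℝ, ∫ q in Ioi (0 : ℝ), cutIntegrand μσ με x t q * f t =
      2 * (Complex.I * ∫ y : ℝ, waveSymbol μσ με x (1 + y * Complex.I) *
        expTransform f (1 + y * Complex.I)) := by
    rw [h2]; ring
  rw [h3, h4]
  field_simp
  ring

/-- The transform of f'' is s² times that of f, which cancels the denominator s² of the inversion
integral. The right-hand side agrees with the one found for K, which is how ∂_t S and K are matched.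
-/
theorem IsModel.integral_wavePrimitive_mul (h : IsModel μσ με) (x : ℝ) {f : ℝ → ℂ}
    (hf : ContDiff ℝ 2 f) (hfc : HasCompactSupport f) :
    ∫ t : ℝ, wavePrimitive μσ με (x, t) * deriv (deriv f) t = 1 / (2 * Real.pi) *
      ∫ y : ℝ, waveSymbol μσ με x (1 + y * Complex.I) * expTransform f (1 + y * Complex.I) := by
  set g := deriv (deriv f) with hg
  have hgc : HasCompactSupport g := hfc.deriv.deriv
  have hgcont : Continuous g :=
    ((contDiff_succ_iff_deriv.1 hf).2.2 : ContDiff ℝ 1 (deriv f)).continuous_deriv le_rfl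
  set G : ℝ → ℂ := fun y => waveSymbol μσ με x ((1 : ℝ) + y * Complex.I) /
    ((1 : ℝ) + y * Complex.I) ^ 2 with hG
  have hGint : Integrable G := h.integrable_waveSymbol_div one_pos x
  have hint : Integrable (Function.uncurry fun t y : ℝ =>
      G y * (Complex.exp (((1 : ℝ) + y * Complex.I) * t) * g t)) (volume.prod volume) := by
    have hdom : Integrable (fun p : ℝ × ℝ => (Real.exp p.1 * ‖g p.1‖) * ‖G p.2‖)
        (volume.prod volume) := by
      have hE : Integrable fun t : ℝ => Real.exp t * ‖g t‖ :=
        (by fun_prop : Continuous fun t : ℝ =>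
          Real.exp t * ‖g t‖).integrable_of_hasCompactSupport
          (hgc.norm.mul_left (f := fun t : ℝ => Real.exp t))
      exact hE.mul_prod hGint.norm
    refine hdom.mono' (hGint.aestronglyMeasurable.comp_snd.mul
      (by fun_prop : Continuous fun p : ℝ × ℝ => Complex.exp (((1 : ℝ) + p.2 * Complex.I) * p.1) *
        g p.1).aestronglyMeasurable) (Eventually.of_forall fun p => ?_)
    rw [Function.uncurry, norm_mul, norm_mul, norm_exp_vertical, one_mul, mul_comm]
  have h1 : ∀ t : ℝ, wavePrimitive μσ με (x, t) * g t = 1 / (2 * Real.pi) *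
      ∫ y : ℝ, G y * (Complex.exp (((1 : ℝ) + y * Complex.I) * t) * g t) := fun t => by
    rw [wavePrimitive, lineIntegral, mul_assoc, ← integral_mul_const]
    congr 2 with y
    rw [mul_assoc]
  rw [integral_congr_ae (Eventually.of_forall h1), integral_const_mul, integral_integral_swap hint]
  congr 2 with y
  have hne := add_mul_I_ne_zero one_pos y
  have h2 := sq_mul_expTransform hf hfc ((1 : ℝ) + y * Complex.I)
  rw [integral_const_mul]
  change G y * expTransform g ((1 : ℝ) + y * Complex.I) = _
  rw [hg, ← h2, hG]
  simp only [Complex.ofReal_one] at hne ⊢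
  field_simp

/-- By compactness the slice has a lowest support point, and it lies in the open cone. This gives
the strict gap k|x| < t₁ that the contour estimates need. -/
theorem exists_tsupport_slice_subset_Icc {k : ℝ} {η : 𝓢(ℝ × ℝ, ℂ)} (hη : HasCompactSupport η)
    (hs : tsupport η ⊆ openCone k) (x : ℝ) :
    ∃ t₁ t₂ : ℝ, k * |x| < t₁ ∧ tsupport (fun t => η (x, t)) ⊆ Icc t₁ t₂ := by
  have hsub : tsupport (fun t => η (x, t)) ⊆ (fun t => (x, t)) ⁻¹' tsupport η :=
    tsupport_comp_subset_preimage η (by fun_prop)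
  have hc : IsCompact (tsupport fun t => η (x, t)) := by
    refine (hη.isCompact.image continuous_snd).of_isClosed_subset (isClosed_tsupport _) ?_
    exact fun t ht => ⟨(x, t), hsub ht, rfl⟩
  rcases (tsupport fun t => η (x, t)).eq_empty_or_nonempty with h0 | h0
  -- For an empty slice only the gap condition matters; the interval itself may be empty.
  · exact ⟨k * |x| + 1, 0, by linarith, by simp [h0]⟩
  · obtain ⟨t₁, ht₁⟩ := hc.exists_isLeast h0
    obtain ⟨t₂, ht₂⟩ := hc.exists_isGreatest h0
    exact ⟨t₁, t₂, hs (hsub ht₁.1), fun t ht => ⟨ht₁.2 ht, ht₂.2 ht⟩⟩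

/-- The two signs from moving derivatives to the test function cancel. Fubini then reduces the claim
to each line of fixed x, where both sides equal the same integral over Re s = 1. -/
theorem IsModel.lineDerivOp_lineDerivOp_apply (h : IsModel μσ με) {k : ℝ} (hk0 : 0 ≤ k)
    (hk : TendstoUniformlyOn (Psi μσ με) (fun _ => (k : ℂ)) atTop (Icc (-Real.pi) Real.pi))
    {T : 𝓢'(ℝ × ℝ, ℂ)} (hT : ∀ ζ : 𝓢(ℝ × ℝ, ℂ), T ζ = ∫ p, wavePrimitive μσ με p * ζ p)
    {η : 𝓢(ℝ × ℝ, ℂ)} (hη : HasCompactSupport η) (hs : tsupport η ⊆ openCone k) :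
    (∂_{((0, 1) : ℝ × ℝ)} (∂_{((0, 1) : ℝ × ℝ)} T : 𝓢'(ℝ × ℝ, ℂ)) : 𝓢'(ℝ × ℝ, ℂ)) η =
      ∫ p : ℝ × ℝ, KCone μσ με p * η p := by
  obtain ⟨C, hC, hb⟩ := h.exists_norm_wavePrimitive_le hk hk0
  have hK : Integrable (fun p => KCone μσ με p * η p) (volume.prod volume) := by
    refine (integrableOn_iff_integrable_of_support_subset (s := tsupport η) fun p hp =>
      subset_tsupport η fun h0 => hp (by simp [h0])).1 ?_
    exact (((h.continuousOn_KCone hk0 hk).mono hs).mul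
      η.continuous.continuousOn).integrableOn_compact hη.isCompact
  have hd : ∀ x t : ℝ, (-∂_{((0, 1) : ℝ × ℝ)} (-∂_{((0, 1) : ℝ × ℝ)} η : 𝓢(ℝ × ℝ, ℂ)) :
      𝓢(ℝ × ℝ, ℂ)) (x, t) = deriv (deriv fun t => η (x, t)) t := fun x t => by
    have h1 : (deriv fun t => η (x, t)) = fun t => (∂_{((0, 1) : ℝ × ℝ)} η : 𝓢(ℝ × ℝ, ℂ)) (x, t) :=
      funext fun t => (hasDerivAt_snd η x t).deriv
    rw [LineDeriv.lineDerivOp_neg, neg_neg, h1, (hasDerivAt_snd _ x t).deriv]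
  rw [TemperedDistribution.lineDerivOp_apply_apply, TemperedDistribution.lineDerivOp_apply_apply,
    hT, Measure.volume_eq_prod, integral_prod _ hK,
    integral_prod _ (integrable_mul_schwartz h.continuous_wavePrimitive hb _)]
  congr 1 with x
  simp_rw [hd]
  obtain ⟨t₁, t₂, ht₁, hsub⟩ := exists_tsupport_slice_subset_Icc hη hs x
  have hf : ContDiff ℝ 2 fun t => η (x, t) := (η.smooth 2).comp (by fun_prop)
  rw [h.integral_KCone_mul hk0 hk ht₁ hf hsub, h.integral_wavePrimitive_mul x hf
    (isCompact_Icc.of_isClosed_subset (isClosed_tsupport _) hsub)]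

end Laplace

end DistributedOrderWave

end

theorem mainTheorem2 (μσ με : Measure unitInterval) [IsFiniteMeasure μσ] [IsFiniteMeasure με]
    (hσ : μσ ≠ 0) (hε : με ≠ 0)
    (hT : DistributedOrderWave.Thermodynamical μσ με)
    (hproper : DistributedOrderWave.ProperFractional μσ με) :
    -- `Ψ` is well defined, up to both sides of the branch cut
    (∀ r : ℝ, 0 < r → ∀ θ ∈ Icc (-Real.pi) Real.pi,
      DistributedOrderWave.Phi με r θ ≠ 0 ∧
      DistributedOrderWave.ratio μσ με r θ ∈ Complex.slitPlane) ∧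
    -- the fundamental solution exists and is unique
    (∃! S : 𝓢'(ℝ × ℝ, ℂ), DistributedOrderWave.IsFundamentalSolution μσ με S) ∧
    -- the limits `τ` and `k`
    ∃ τ k : ℝ, 0 ≤ τ ∧ k = √τ ∧
      TendstoUniformlyOn (DistributedOrderWave.ratio μσ με) (fun _ => (τ : ℂ)) atTop
        (Icc (-Real.pi) Real.pi) ∧
      TendstoUniformlyOn (DistributedOrderWave.Psi μσ με) (fun _ => (k : ℂ)) atTop
        (Icc (-Real.pi) Real.pi) ∧
      -- the integral converges absolutely inside the cone
      (∀ x t : ℝ, (x, t) ∈ DistributedOrderWave.openCone k →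
        IntegrableOn (DistributedOrderWave.cutIntegrand μσ με x t) (Ioi 0)) ∧
      LocallyIntegrableOn (DistributedOrderWave.KCone μσ με) (DistributedOrderWave.openCone k) ∧
      ∀ S : 𝓢'(ℝ × ℝ, ℂ), DistributedOrderWave.IsFundamentalSolution μσ με S →
        -- the support lies in the cone
        Distribution.dsupport S ⊆ DistributedOrderWave.cone k ∧
        -- the distribution `∂_t S` is given inside the cone by the integral
        ∀ η : 𝓢(ℝ × ℝ, ℂ), HasCompactSupport η →
          tsupport η ⊆ DistributedOrderWave.openCone k →
          (∂_{((0, 1) : ℝ × ℝ)} S) η =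
            ∫ p : ℝ × ℝ, DistributedOrderWave.KCone μσ με p * η p := by
  have h : DistributedOrderWave.IsModel μσ με := ⟨hσ, hε, hT, hproper⟩
  obtain ⟨τ, hτ, hlim⟩ := h.exists_tendsto_ratio
  have hk := DistributedOrderWave.tendsto_Psi_of_tendsto_ratio hτ hlim
  have hk0 : 0 ≤ √τ := Real.sqrt_nonneg τ
  obtain ⟨C, -, hb⟩ := h.exists_norm_wavePrimitive_le hk hk0
  obtain ⟨T, hTe⟩ :=
    DistributedOrderWave.exists_temperedDistribution h.continuous_wavePrimitive hb
  obtain ⟨hS, hvan⟩ := h.isFundamentalSolution hk0 hk hTe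
  refine ⟨fun r hr θ hθ => ⟨h.Phi_ne_zero hr hθ, h.ratio_mem_slitPlane hr hθ⟩,
    ⟨_, hS, fun S' hS' => hS'.unique hS⟩, τ, √τ, hτ, rfl, hlim, hk,
    fun x t hp => h.integrableOn_cutIntegrand hk0 hk hp,
    (h.continuousOn_KCone hk0 hk).locallyIntegrableOn
      (DistributedOrderWave.isOpen_openCone _).measurableSet, fun S' hS' => ?_⟩
  -- By uniqueness every fundamental solution is the t-derivative of the constructed T, so its
  -- support and its derivative can be read off from T.
  obtain rfl := hS'.unique hS
  refine ⟨fun p hp => ?_, fun η hη hs => h.lineDerivOp_lineDerivOp_apply hk0 hk hTe hη hs⟩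
  exact (Distribution.mem_dsupport_iff p).1 hp _ hvan (DistributedOrderWave.isClosed_cone _)
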